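/- **Setting.** Let $\mathcal K$ be a real reproducing kernel Hilbert space of functions on a set $\mathcal X$, with kernel $k$, let $f_\star\in\mathcal K$ with $\|f_\star\|_{\mathcal K}\le C$, $C>0$, and let $\mathbb X\subset\mathcal X$ be a finite non-empty set of arms. In round $t=1,2,\dots$ an algorithm plays $x_t\in\mathbb X$ and observes $y_t=f_\star(x_t)+\xi_t$, where, given the past and $x_t$, $\xi_t\sim\mathcal N(0,\sigma^2)$. Bounds $0<\sigma_-\le\sigma\le\sigma_+$ are known. Let $f_\star(\star)=\max_{\mathbb X}f_\star$, $R_T=\sum_{t=1}^T(f_\star(\star)-f_\star(x_t))$, and $R=\max_{x\in\mathbb X}(f_\star(\star)-f_\star(x))$, which is finite. For $\lambda>0$ put $k_t(x)=(k(x,x_s))_{s\le t}$, $\mathbf K_t=(k(x_s,x_{s'}))_{s,s'\le t}$, $Y_t=(y_1,\dots,y_t)^\top$ and $$f_{\lambda,t}(x)=k_t(x)^\top(\mathbf K_t+\lambda I)^{-1}Y_t,\qquad k_{\lambda,t}(x,x')=k(x,x')-k_t(x)^\top(\mathbf K_t+\lambda I)^{-1}k_t(x'),$$ $$\gamma_t(\lambda)=\tfrac12\sum_{s=1}^t\ln\Big(1+\tfrac1\lambda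 k_{\lambda,s-1}(x_s,x_s)\Big),\qquad \hat\sigma_{\lambda,t}^2=\tfrac1t\sum_{s=1}^t(y_s-f_{\lambda,t}(x_s))^2 .$$ Let $0<\delta<1$ and $\delta'=\delta/4$. Put $C_t=\ln(e/\delta')\big[1+\ln(\pi^2\ln(t)/6)/\ln(1/\delta')\big]$ and $D_{\lambda,t}=2\ln(1/\delta')+2\gamma_t(\lambda)$. The noise bounds are $\sigma_{\pm,0}=\sigma_{\pm,1}=\sigma_\pm$ and, for $t\ge2$, with $\lambda=\lambda_t$, $$\sigma_{-,t}=\max\Big\{\hat\sigma_{\lambda,t}-\sigma_+\sqrt{\tfrac{2C_t}{t}}-\|f_\star\|_{\mathcal K}\sqrt{\tfrac{\lambda}{t}\Big(1-\tfrac1{\max_{s\le t}(1+\frac1\lambda k_{\lambda,s-1}(x_s,x_s))}\Big)},\ \sigma_{-,t-1}\Big\},$$ $$\sigma_{+,t}=\min\Big\{\hat\sigma_{\lambda,t}+\sigma_+\Big(\sqrt{\tfrac{C_t}{t}}+\sqrt{\tfrac{C_t+2D_{\lambda_-,t}}{t}}\Big)+\sqrt{\tfrac{2\sigma_+\|f_\star\|_{\mathcal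 K}\sqrt{\lambda D_{\lambda_-,t}}}{t}},\ \sigma_{+,t-1}\Big\},\qquad \lambda_-=\sigma_{-,t}^2/C^2 .$$ Here, for $t\ge1$, $\lambda_t=\sigma_{+,t-1}^2/C^2$, and $$B_{\lambda_t,t-1}(\delta/4)=\sqrt{\lambda_t}\,C+\sigma_{+,t-1}\sqrt{2\ln(4/\delta)+2\gamma_{t-1}(\sigma_{-,t-1}^2/C^2)} .$$ Kernel Thompson Sampling draws in round $t$, given the past, $\tilde f_t\sim\mathcal N\big((f_{\lambda_t,t-1}(x))_{x\in\mathbb X},\,v_t^2\tfrac{\sigma_{+,t-1}^2}{\lambda_t}(k_{\lambda_t,t-1}(x,x'))_{x,x'\in\mathbb X}\big)$ with $v_t=B_{\lambda_t,t-1}(\delta/4)/\sigma_{+,t-1}$, and plays $x_t\in\operatorname{argmax}_{x\in\mathbb X}\tilde f_t(x)$ (ties broken in any way). **Theorem.** With probability at least $1-3\delta$, the following hold simultaneously for all $T\ge0$: 1. $$R_T\le C_{1,T}\sum_{t=1}^T\sqrt{\frac{k_{\lambda_t,t-1}(x_t,x_t)}{\lambda_t}}\,B_{\lambda_t,t-1}(\delta/4)+C_2R\sqrt{T\ln(1/\delta)}+4\pi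 eR\delta,$$ where $C_{1,T}=(4\sqrt{\pi e}+1)\Big(1+\sqrt{2\ln\big(\tfrac{T(T+1)|\mathbb X|}{\sqrt\pi\,\delta}\big)}\Big)$ and $C_2=\sqrt{8\pi e(1+\delta\sqrt{4\pi e})^2}$ (for $T=0$ both the regret and the first two terms are $0$). 2. If $k(x,x)\le1$ on $\mathbb X$, then $$R_T\le C_{1,T}\frac{\sigma_+}{\sigma}\Big(1+\sqrt{2\ln(4/\delta)+2\gamma_T(\sigma_-^2/C^2)}\Big)C\sqrt{T\frac{2\gamma_T(\sigma^2/C^2)}{\ln(1+C^2/\sigma^2)}}+C_2R\sqrt{T\ln(1/\delta)}+4\pi eR\delta .$$ 3. If $\kappa\le k(x,x)\le1$ on $\mathbb X$ for some $\kappa>0$, then $R_T\le K\,C\sqrt{T\ln(T|\mathbb X|)}\,\gamma_T(\sigma^2/C^2)$, where the constant $K$ depends only on $\delta,\sigma,\sigma_-,\sigma_+,C,\kappa$, and not on $T$, $\mathcal X$, $\mathbb X$, $k$ or $f_\star$. -/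

import Mathlib

open MeasureTheory ProbabilityTheory

noncomputable section

namespace KernelTS

/-! ### Regularised kernel regression

A sequence of points `x` and observations `y` is indexed by the rounds `1, 2, 3, …`; the entries of
index `0` are never used. -/

section Regression

variable {𝒳 : Type*} (k : 𝒳 → 𝒳 → ℝ) (x : ℕ → 𝒳) (y : ℕ → ℝ)

/-- The Gram matrix `K_t = (k (x_s, x_s'))` for `1 ≤ s, s' ≤ t`. -/
def gram (t : ℕ) : Matrix (Fin t) (Fin t) ℝ :=
  Matrix.of fun i j => k (x (i + 1)) (x (j + 1))

/-- The vector `k_t(z) = (k (z, x_s))` for `1 ≤ s ≤ t`. -/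
def kvec (t : ℕ) (z : 𝒳) : Fin t → ℝ := fun i => k z (x (i + 1))

/-- The posterior mean `f_{lam,t}(z) = k_t(z)ᵀ (K_t + lam I)⁻¹ Y_t`. -/
def postMean (lam : ℝ) (t : ℕ) (z : 𝒳) : ℝ :=
  kvec k x t z ⬝ᵥ ((gram k x t + lam • (1 : Matrix (Fin t) (Fin t) ℝ))⁻¹.mulVec
    fun i => y (i + 1))

/-- The posterior kernel
`k_{lam,t}(z, z') = k(z, z') - k_t(z)ᵀ (K_t + lam I)⁻¹ k_t(z')`. -/
def postKernel (lam : ℝ) (t : ℕ) (z z' : 𝒳) : ℝ :=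
  k z z' - kvec k x t z ⬝ᵥ
    ((gram k x t + lam • (1 : Matrix (Fin t) (Fin t) ℝ))⁻¹.mulVec (kvec k x t z'))

/-- The information gain
`γ_t(lam) = 1/2 ∑_{s=1}^t ln (1 + k_{lam,s-1}(x_s, x_s) / lam)`. -/
def infoGain (lam : ℝ) (t : ℕ) : ℝ :=
  1 / 2 * ∑ s ∈ Finset.Icc 1 t, Real.log (1 + 1 / lam * postKernel k x lam (s - 1) (x s) (x s))

/-- The empirical standard deviation, the square root of
`1/t ∑_{s=1}^t (y_s - f_{lam,t}(x_s))²`. -/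
def sdHat (lam : ℝ) (t : ℕ) : ℝ :=
  Real.sqrt (1 / (t : ℝ) * ∑ s ∈ Finset.Icc 1 t, (y s - postMean k x y lam t (x s)) ^ 2)

/-- `C_t(η) = ln(e/η) (1 + ln(π² ln(t) / 6) / ln(1/η))`, meaningful for `t ≥ 2`. -/
def cTerm (η : ℝ) (t : ℕ) : ℝ :=
  Real.log (Real.exp 1 / η) *
    (1 + Real.log (Real.pi ^ 2 * Real.log t / 6) / Real.log (1 / η))

/-- `D_{lam,t}(η) = 2 ln(1/η) + 2 γ_t(lam)`. -/
def dTerm (lam : ℝ) (η : ℝ) (t : ℕ) : ℝ :=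
  2 * Real.log (1 / η) + 2 * infoGain k x lam t

/-- Upper estimate of the noise standard deviation, built from `t ≥ 2` observations with
regularisation `lam`, a lower bound `lamLow` on the ideal regularisation, an a priori upper bound
`σhigh` on the standard deviation and the norm `N` of the regression function. -/
def sdUpper (N σhigh η lam lamLow : ℝ) (t : ℕ) : ℝ :=
  sdHat k x y lam t
    + σhigh * (Real.sqrt (cTerm η t / t)
        + Real.sqrt ((cTerm η t + 2 * dTerm k x lamLow η t) / t))
    + Real.sqrt (2 * σhigh * N * Real.sqrt (lam * dTerm k x lamLow η t) / t)

/-- Lower estimate of the noise standard deviation, built from `t ≥ 2` observations. -/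
def sdLower (N σhigh η lam : ℝ) (t : ℕ) : ℝ :=
  sdHat k x y lam t
    - σhigh * Real.sqrt (2 * cTerm η t / t)
    - N * Real.sqrt (lam / t *
        (1 - 1 / (⨆ s : Fin t, (1 + 1 / lam * postKernel k x lam s (x (s + 1)) (x (s + 1))))))

end Regression

/-! ### Online tuning -/

/-- What the algorithm is tuned with: the kernel, the norm of the target function and the upper
bound `C` on it, the initial lower and upper bounds on the noise standard deviation, and the
confidence level `η` at which all the estimates are computed. -/
structure Tuning (𝒳 : Type*) where
  /-- the kernel -/
  k : 𝒳 → 𝒳 → ℝ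
  /-- the RKHS norm of the target function -/
  fnorm : ℝ
  /-- the known upper bound on the RKHS norm -/
  C : ℝ
  /-- the initial lower bound on the noise standard deviation -/
  σlow : ℝ
  /-- the initial upper bound on the noise standard deviation -/
  σhigh : ℝ
  /-- the confidence level of the estimates -/
  η : ℝ

namespace Tuning

variable {𝒳 : Type*} (p : Tuning 𝒳) (x : ℕ → 𝒳) (y : ℕ → ℝ)

/-- The pair `(σ_{-,t}, σ_{+,t})` of running bounds on the noise standard deviation after `t`
observations. It is computed with the regularisation `λ_t = σ_{+,t-1}² / C²` of round `t`:
`σ_{-,t}` is the maximum of the lower estimate and `σ_{-,t-1}`, and `σ_{+,t}` is the minimum of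
`σ_{+,t-1}` and the upper estimate with `σ_{-,t}² / C²` as lower bound on the ideal regularisation.
With a single observation the estimates are not defined, as `ln (ln 1)` is not, and the initial
bounds are kept. -/
def sdBounds : ℕ → ℝ × ℝ
  | 0 => (p.σlow, p.σhigh)
  | 1 => (p.σlow, p.σhigh)
  | t + 2 =>
    let prev := sdBounds (t + 1)
    let lam := prev.2 ^ 2 / p.C ^ 2
    let low := max (sdLower p.k x y p.fnorm p.σhigh p.η lam (t + 2)) prev.1
    (low, min (sdUpper p.k x y p.fnorm p.σhigh p.η lam (low ^ 2 / p.C ^ 2) (t + 2)) prev.2)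

/-- `σ_{-,t}` -/
def sdMinus (t : ℕ) : ℝ := (p.sdBounds x y t).1

/-- `σ_{+,t}` -/
def sdPlus (t : ℕ) : ℝ := (p.sdBounds x y t).2

/-- The regularisation `λ_t = σ_{+,t-1}² / C²` of round `t ≥ 1`. -/
def reg (t : ℕ) : ℝ := p.sdPlus x y (t - 1) ^ 2 / p.C ^ 2

/-- The confidence term of round `t ≥ 1`, namely
`B_{λ_t,t-1}(η) = √λ_t C + σ_{+,t-1} √(2 ln(1/η) + 2 γ_{t-1}(σ_{-,t-1}² / C²))`. -/
def confB (t : ℕ) : ℝ :=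
  Real.sqrt (p.reg x y t) * p.C + p.sdPlus x y (t - 1) *
    Real.sqrt (2 * Real.log (1 / p.η)
      + 2 * infoGain p.k x (p.sdMinus x y (t - 1) ^ 2 / p.C ^ 2) (t - 1))

/-- The variance inflation `v_t = B_{λ_t,t-1}(η) / σ_{+,t-1}`. -/
def inflation (t : ℕ) : ℝ := p.confB x y t / p.sdPlus x y (t - 1)

/-- The mean vector, over the arms, from which round `t ≥ 1` samples. -/
def sampleMean (arms : Finset 𝒳) (t : ℕ) : EuclideanSpace ℝ arms :=
  WithLp.toLp 2 fun a => postMean p.k x y (p.reg x y t) (t - 1) a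

/-- The covariance matrix `v_t² Σ_{t-1}`, over the arms, with which round `t ≥ 1` samples, where
`Σ_{t-1} = σ_{+,t-1}² / λ_t (k_{λ_t,t-1}(a, b))`. -/
def sampleCov (arms : Finset 𝒳) (t : ℕ) : Matrix arms arms ℝ :=
  Matrix.of fun a b => p.inflation x y t ^ 2 *
    (p.sdPlus x y (t - 1) ^ 2 / p.reg x y t * postKernel p.k x (p.reg x y t) (t - 1) a b)

end Tuning

/-! ### Kernel Thompson sampling -/

section Bandit

variable {𝒳 Ω : Type*} {arms : Finset 𝒳}

/-- What happened strictly before round `t`: the σ-algebra generated by the sampled functions, the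
points played and the outcomes of the rounds `1, …, t - 1`. -/
abbrev past (ftilde : ℕ → Ω → EuclideanSpace ℝ arms) (x : ℕ → Ω → arms) (y : ℕ → Ω → ℝ) (t : ℕ) :
    MeasurableSpace Ω :=
  ⨆ s ∈ Finset.Ico 1 t, (MeasurableSpace.comap (ftilde s) inferInstance
    ⊔ MeasurableSpace.comap (x s) ⊤ ⊔ MeasurableSpace.comap (y s) inferInstance)

/-- The past of round `t` together with the sampled function and the point played in round `t`. -/
abbrev pastAndPlay (ftilde : ℕ → Ω → EuclideanSpace ℝ arms) (x : ℕ → Ω → arms) (y : ℕ → Ω → ℝ)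
    (t : ℕ) : MeasurableSpace Ω :=
  past ftilde x y t ⊔ MeasurableSpace.comap (ftilde t) inferInstance
    ⊔ MeasurableSpace.comap (x t) ⊤

/-- `ftilde`, `x`, `y` are the sampled functions, the points played and the outcomes of a run of
kernel Thompson sampling with tuning `p` on the finite set `arms`, when the mean reward is `f` and
the noise is Gaussian with standard deviation `σ`. Ties in the argmax are broken in any way. -/
structure IsRun [DecidableEq 𝒳] {mΩ : MeasurableSpace Ω} (P : Measure Ω) (p : Tuning 𝒳)
    (f : 𝒳 → ℝ) (σ : ℝ) (ftilde : ℕ → Ω → EuclideanSpace ℝ arms) (x : ℕ → Ω → arms)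
    (y : ℕ → Ω → ℝ) : Prop where
  measurable_ftilde : ∀ t, Measurable (ftilde t)
  measurable_x : ∀ t, Measurable[mΩ, ⊤] (x t)
  measurable_y : ∀ t, Measurable (y t)
  /-- Given the past, the function sampled in round `t` has the inflated Gaussian posterior law. -/
  sample : ∀ t, 1 ≤ t → ∀ s : Set (EuclideanSpace ℝ arms), MeasurableSet s →
    P⟦ftilde t ⁻¹' s | past ftilde x y t⟧ =ᵐ[P] fun ω =>
      (multivariateGaussian (p.sampleMean (fun i => (x i ω : 𝒳)) (fun i => y i ω) arms t)
        (p.sampleCov (fun i => (x i ω : 𝒳)) (fun i => y i ω) arms t)).real s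
  /-- The point played maximises the sampled function. -/
  argmax : ∀ t, 1 ≤ t → ∀ ω a, ftilde t ω a ≤ ftilde t ω (x t ω)
  /-- Given the past and the point played, the noise `y_t - f(x_t)` has law `N(0, σ²)`. -/
  noise : ∀ t, 1 ≤ t → ∀ s : Set ℝ, MeasurableSet s →
    P⟦(fun ω => y t ω - f (x t ω)) ⁻¹' s | pastAndPlay ftilde x y t⟧ =ᵐ[P] fun _ =>
      (gaussianReal 0 (σ ^ 2).toNNReal).real s

/-- The cumulative regret `R_T = ∑_{t=1}^T (max f - f(x_t))`. -/
def regret (harms : arms.Nonempty) (f : 𝒳 → ℝ) (x : ℕ → 𝒳) (T : ℕ) : ℝ :=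
  ∑ t ∈ Finset.Icc 1 T, (arms.sup' harms f - f (x t))

/-- The maximal instantaneous pseudo-regret. -/
def maxGap (harms : arms.Nonempty) (f : 𝒳 → ℝ) : ℝ :=
  arms.sup' harms fun a => arms.sup' harms f - f a

end Bandit

/-- `C_{1,T} = (4 √(π e) + 1) (1 + √(2 ln (T (T + 1) n / (√π δ))))`, with `n` arms. -/
def C₁ (n : ℕ) (δ : ℝ) (T : ℕ) : ℝ :=
  (4 * Real.sqrt (Real.pi * Real.exp 1) + 1) *
    (1 + Real.sqrt (2 * Real.log (T * (T + 1) * n / (Real.sqrt Real.pi * δ))))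

/-- `C_2 = √(8 π e (1 + δ √(4 π e))²)`. -/
def C₂ (δ : ℝ) : ℝ :=
  Real.sqrt (8 * Real.pi * Real.exp 1 * (1 + δ * Real.sqrt (4 * Real.pi * Real.exp 1)) ^ 2)

end KernelTS

end

/-! With `φ a` the kernel function at `a`, `k a b = ⟪φ a, φ b⟫` and `f a = ⟪f, φ a⟫`, so the
regression is ridge regression on features. It is handled through the normal equations (`IsRidge`)
and through variational forms of the posterior variance and of the quadratic form `S = ξᵀ K (K +
λ)⁻¹ ξ` of the noise. These forms give monotonicity in `λ`, which transfers estimates from the fixed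
ideal value `σ² / C²` to the random `λ_t`, without a union bound over regularisations.

Noise. Adding the observations one by one turns `S` into a sum of `ξ_s² - (ξ_s - m_s)² / τ_s` with
predictable `m_s`, `τ_s` (`noiseForm_eq_sum`). Divided by `σ²` and reduced by `∑ log τ_s = 2γ`, it
is twice the log-likelihood ratio of a predictable Gaussian model against the true noise. This ratio
is a nonnegative martingale started at `1`, so Ville's inequality bounds `S` at all times. Centred
models with constant `τ` give, in the same way, time-uniform deviations of `∑ ξ_s²` on both sides.
On these events (`GoodNoise`), an induction over the rounds yields `σ_{-,t} ≤ 1.01 σ` and `σ_{+,t} ≥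
σ / 1.11` (`GoodNoise.sdBounds`). The running bounds need not bracket `σ` exactly; the price is that
the posterior means are within `1.25` widths of `f` instead of `1`.

Sampling. The inflation `v_t` makes the sampled value at an arm Gaussian with standard deviation the
width `s_a` of its confidence interval. The sampled value at an optimal arm reaches the optimum `f⋆`
with probability at least `0.1005`, and from round 11 on some sampled value exceeds its mean by more
than `c` widths (`c` being `sampleRadius`) with probability at most `0.0045`. If the first happens
and not the second, every maximiser `i` of the sample satisfies `f⋆ ≤ m_i + c s_i`, and the width of
any such arm dominates the expected shortfall: `E (f⋆ - max f̃)⁺ ≤ (c + 1/2) s_i`. Hence the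
expected shortfall is at most a multiple of the expected width of the maximiser
(`integral_shortfall_le`).

To pass to realised sums, let `W` be the shortfall cut at the maximal gap `R`, and `Y` the least
value of `min R ((c + 1/2) s_i)` over the maximisers, which makes the choice among ties irrelevant.
Both lie in `[0, R]`, and `exp ((0.0172 W - 0.2 Y) / R)` has conditional mean at most `1`, so
Ville's inequality applies again. The additive cost `R log(1/δ) / 0.0172` does not grow with `T`; it
fits in `C₂ R √(T log(1/δ))` when `T` is large, and for small `T` the trivial bound `T R` does
(`sum_le_of_shortfall`).

The regret of a round is at most its shortfall plus `(c + 1.25)` widths, whence the first bound. For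
the second, `σ_{+,t-1}` cancels from the width, and monotonicity in `λ`, concavity of `log` and
Cauchy–Schwarz bring in the information gain (`sum_width_le`). For the third, the first round alone
bounds the information gain below, so that constants can be absorbed (`le_rate`). The failure
probabilities add up to less than `3δ` when `δ < 1/3`; otherwise the claimed probability is not
positive. -/

noncomputable section

namespace KernelTS

/-! ### Ridge regression in a feature space -/

section Ridge

variable {H : Type*} [NormedAddCommGroup H] [InnerProductSpace ℝ H]
variable {ι : Type*} [Fintype ι] {ψ : ι → H} {lam : ℝ}

/-- The linear combination of the features `ψ` with coefficients `β`. -/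
def synth (ψ : ι → H) (β : ι → ℝ) : H := ∑ i, β i • ψ i

/-- `β` solves the regularised normal equations `(K + lam I) β = v`, where `K` is the Gram matrix of
the features `ψ`. -/
def IsRidge (ψ : ι → H) (lam : ℝ) (v β : ι → ℝ) : Prop :=
  ∀ i, inner ℝ (synth ψ β) (ψ i) + lam * β i = v i

/-- The quadratic form `vᵀ K (K + lam I)⁻¹ v`, expressed through `β = (K + lam I)⁻¹ v`. -/
def ridgeForm (lam : ℝ) (v β : ι → ℝ) : ℝ := ∑ i, v i ^ 2 - lam * ∑ i, β i * v i

lemma inner_synth_left (β : ι → ℝ) (h : H) :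
    inner ℝ (synth ψ β) h = ∑ i, β i * inner ℝ (ψ i) h := by
  simp [synth, sum_inner, real_inner_smul_left]

lemma inner_synth_right (β : ι → ℝ) (h : H) :
    inner ℝ h (synth ψ β) = ∑ i, β i * inner ℝ h (ψ i) := by
  simp [synth, inner_sum, real_inner_smul_right]

lemma synth_add (β β' : ι → ℝ) : synth ψ (β + β') = synth ψ β + synth ψ β' := by
  simp [synth, add_smul, Finset.sum_add_distrib]

lemma synth_sub (β β' : ι → ℝ) : synth ψ (β - β') = synth ψ β - synth ψ β' := by
  simp [synth, sub_smul, Finset.sum_sub_distrib]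

lemma IsRidge.sum_mul {w β β' : ι → ℝ} (hw : IsRidge ψ lam w β') :
    ∑ i, β i * w i = inner ℝ (synth ψ β') (synth ψ β) + lam * ∑ i, β i * β' i := by
  rw [inner_synth_right, Finset.mul_sum, ← Finset.sum_add_distrib]
  refine Finset.sum_congr rfl fun i _ => ?_
  rw [← hw i]; ring

lemma IsRidge.sum_mul_self {v β : ι → ℝ} (h : IsRidge ψ lam v β) :
    ∑ i, β i * v i = ‖synth ψ β‖ ^ 2 + lam * ∑ i, β i ^ 2 := by
  rw [h.sum_mul, real_inner_self_eq_norm_sq]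
  simp [sq]

lemma IsRidge.sum_mul_comm {v w β β' : ι → ℝ} (hv : IsRidge ψ lam v β) (hw : IsRidge ψ lam w β') :
    ∑ i, β i * w i = ∑ i, β' i * v i := by
  rw [hw.sum_mul, hv.sum_mul, real_inner_comm]
  simp [mul_comm]

lemma IsRidge.add {v w β β' : ι → ℝ} (hv : IsRidge ψ lam v β) (hw : IsRidge ψ lam w β') :
    IsRidge ψ lam (v + w) (β + β') := by
  intro i
  rw [synth_add, inner_add_left, Pi.add_apply, Pi.add_apply, ← hv i, ← hw i]; ring

lemma IsRidge.sub {v w β β' : ι → ℝ} (hv : IsRidge ψ lam v β) (hw : IsRidge ψ lam w β') :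
    IsRidge ψ lam (v - w) (β - β') := by
  intro i
  rw [synth_sub, inner_sub_left, Pi.sub_apply, Pi.sub_apply, ← hv i, ← hw i]; ring

lemma IsRidge.unique (hlam : 0 < lam) {v β β' : ι → ℝ} (h : IsRidge ψ lam v β)
    (h' : IsRidge ψ lam v β') : β = β' := by
  have h0 := (h.sub h').sum_mul_self
  simp only [sub_self, Pi.zero_apply, mul_zero, Finset.sum_const_zero] at h0
  have h1 : 0 ≤ ∑ i, (β - β') i ^ 2 := Finset.sum_nonneg fun i _ => sq_nonneg _
  have h2 : ∑ i, (β - β') i ^ 2 = 0 := by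
    have := sq_nonneg ‖synth ψ (β - β')‖
    nlinarith
  funext i
  have h3 := (Finset.sum_eq_zero_iff_of_nonneg (fun i _ => sq_nonneg ((β - β') i))).1 h2 i
    (Finset.mem_univ i)
  have := pow_eq_zero_iff (two_ne_zero) |>.1 h3
  simpa [sub_eq_zero] using this

/-- The regularised least squares functional is minimal at the ridge estimate. -/
lemma IsRidge.le_objective (hlam : 0 < lam) {v β : ι → ℝ} (h : IsRidge ψ lam v β) (g : H) :
    lam * ∑ i, β i * v i ≤ ∑ i, (v i - inner ℝ g (ψ i)) ^ 2 + lam * ‖g‖ ^ 2 := by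
  have e1 := h.sum_mul_self
  -- The excess of the objective at `g` over `lam * ∑ i, β i * v i` is exactly this sum of squares
  -- plus `lam * ‖g - synth ψ β‖ ^ 2`.
  have e2 : ∑ i, (v i - inner ℝ g (ψ i) - lam * β i) ^ 2 =
      ∑ i, (v i - inner ℝ g (ψ i)) ^ 2 - 2 * lam * ∑ i, β i * v i
        + 2 * lam * inner ℝ g (synth ψ β) + lam ^ 2 * ∑ i, β i ^ 2 := by
    rw [inner_synth_right, Finset.mul_sum, Finset.mul_sum, Finset.mul_sum,
      ← Finset.sum_sub_distrib, ← Finset.sum_add_distrib, ← Finset.sum_add_distrib]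
    exact Finset.sum_congr rfl fun i _ => by ring
  have e3 : ‖g - synth ψ β‖ ^ 2 = ‖g‖ ^ 2 - 2 * inner ℝ g (synth ψ β) + ‖synth ψ β‖ ^ 2 :=
    norm_sub_sq_real _ _
  have p1 : 0 ≤ ∑ i, (v i - inner ℝ g (ψ i) - lam * β i) ^ 2 :=
    Finset.sum_nonneg fun i _ => sq_nonneg _
  have p2 : 0 ≤ lam * ‖g - synth ψ β‖ ^ 2 := by positivity
  rw [e2] at p1
  rw [e3] at p2
  rw [e1] at p1 ⊢
  linarith

lemma IsRidge.ridgeForm_eq {v β : ι → ℝ} (h : IsRidge ψ lam v β) :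
    ridgeForm lam v β = ∑ i, inner ℝ (synth ψ β) (ψ i) ^ 2 + lam * ‖synth ψ β‖ ^ 2 := by
  have e1 := inner_synth_right (ψ := ψ) β (synth ψ β)
  rw [real_inner_self_eq_norm_sq] at e1
  rw [ridgeForm, e1, Finset.mul_sum, Finset.mul_sum, ← Finset.sum_sub_distrib,
    ← Finset.sum_add_distrib]
  exact Finset.sum_congr rfl fun i _ => by rw [← h i]; ring

lemma IsRidge.ridgeForm_nonneg (hlam : 0 < lam) {v β : ι → ℝ} (h : IsRidge ψ lam v β) :
    0 ≤ ridgeForm lam v β := by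
  rw [h.ridgeForm_eq]; positivity

/-- Half of a variational formula: the left side is a concave functional of `g` whose maximum, at `g
= synth ψ β`, is `ridgeForm`. Testing it with the solution for another regularisation compares the
two forms. -/
lemma IsRidge.le_ridgeForm (hlam : 0 < lam) {v β : ι → ℝ} (h : IsRidge ψ lam v β) (g : H) :
    2 * ∑ i, v i * inner ℝ g (ψ i) - ∑ i, inner ℝ g (ψ i) ^ 2 - lam * ‖g‖ ^ 2
      ≤ ridgeForm lam v β := by
  have e := h.le_objective hlam g
  have e2 : ∑ i, (v i - inner ℝ g (ψ i)) ^ 2 =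
      ∑ i, v i ^ 2 - 2 * ∑ i, v i * inner ℝ g (ψ i) + ∑ i, inner ℝ g (ψ i) ^ 2 := by
    rw [Finset.mul_sum, ← Finset.sum_sub_distrib, ← Finset.sum_add_distrib]
    exact Finset.sum_congr rfl fun i _ => by ring
  rw [ridgeForm]
  linarith

lemma IsRidge.sum_mul_inner {v β : ι → ℝ} (h : IsRidge ψ lam v β) :
    ∑ i, v i * inner ℝ (synth ψ β) (ψ i) = ridgeForm lam v β := by
  rw [ridgeForm, Finset.mul_sum, ← Finset.sum_sub_distrib]
  refine Finset.sum_congr rfl fun i _ => ?_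
  have := h i
  have e : inner ℝ (synth ψ β) (ψ i) = v i - lam * β i := by linarith
  rw [e]; ring

/-- On an eigenvector of `K` with eigenvalue `μ` the form is `μ / (μ + lam)`, which decreases in
`lam`. -/
lemma IsRidge.ridgeForm_anti {lam' : ℝ} (hlam : 0 < lam) (hle : lam ≤ lam') {v β β' : ι → ℝ}
    (h : IsRidge ψ lam v β) (h' : IsRidge ψ lam' v β') :
    ridgeForm lam' v β' ≤ ridgeForm lam v β := by
  have e := h.le_ridgeForm hlam (synth ψ β')
  rw [h'.sum_mul_inner] at e
  have e2 := h'.ridgeForm_eq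
  have : lam * ‖synth ψ β'‖ ^ 2 ≤ lam' * ‖synth ψ β'‖ ^ 2 := by gcongr
  linarith

/-- Spectrally, `lam * μ / (μ + lam)` increases in `lam`. Here the test vector for `lam'` is the
solution for `lam` shrunk by `lam / lam'`. -/
lemma IsRidge.mul_ridgeForm_mono {lam' : ℝ} (hlam : 0 < lam) (hle : lam ≤ lam') {v β β' : ι → ℝ}
    (h : IsRidge ψ lam v β) (h' : IsRidge ψ lam' v β') :
    lam * ridgeForm lam v β ≤ lam' * ridgeForm lam' v β' := by
  have hlam' : 0 < lam' := hlam.trans_le hle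
  set r := lam / lam' with hr
  have hr0 : 0 < r := by positivity
  have hr1 : r ≤ 1 := (div_le_one hlam').2 hle
  have hrl : r * lam' = lam := by rw [hr]; field_simp
  have e := h'.le_ridgeForm hlam' (r • synth ψ β)
  simp only [real_inner_smul_left, norm_smul, Real.norm_eq_abs, abs_of_pos hr0, mul_pow] at e
  have s1 : ∑ i, v i * (r * inner ℝ (synth ψ β) (ψ i)) = r * ridgeForm lam v β := by
    rw [← h.sum_mul_inner, Finset.mul_sum]
    exact Finset.sum_congr rfl fun i _ => by ring
  rw [s1, ← Finset.mul_sum] at e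
  have e2 := h.ridgeForm_eq
  have p1 : 0 ≤ ∑ i, inner ℝ (synth ψ β) (ψ i) ^ 2 := Finset.sum_nonneg fun i _ => sq_nonneg _
  have p2 : r ^ 2 ≤ r := by nlinarith
  have e3 : r * ridgeForm lam v β ≤ ridgeForm lam' v β' := by
    have q1 : r ^ 2 * ∑ i, inner ℝ (synth ψ β) (ψ i) ^ 2 ≤
      r * ∑ i, inner ℝ (synth ψ β) (ψ i) ^ 2 := by gcongr
    have q2 : lam' * (r ^ 2 * ‖synth ψ β‖ ^ 2) = r * (lam * ‖synth ψ β‖ ^ 2) := by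
      rw [← hrl]; ring
    rw [q2] at e
    have : r * ridgeForm lam v β = r * ∑ i, inner ℝ (synth ψ β) (ψ i) ^ 2
      + r * (lam * ‖synth ψ β‖ ^ 2) := by rw [e2]; ring
    linarith
  calc lam * ridgeForm lam v β = lam' * (r * ridgeForm lam v β) := by rw [← hrl]; ring
    _ ≤ _ := by gcongr

/-! #### The posterior kernel -/

lemma IsRidge.inner_sub_synth {h : H} {α : ι → ℝ}
    (ha : IsRidge ψ lam (fun i => inner ℝ h (ψ i)) α) (i : ι) :
    inner ℝ (h - synth ψ α) (ψ i) = lam * α i := by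
  have := ha i
  rw [inner_sub_left]
  linarith

lemma IsRidge.inner_sub_synth_synth {h : H} {α : ι → ℝ}
    (ha : IsRidge ψ lam (fun i => inner ℝ h (ψ i)) α) (β : ι → ℝ) :
    inner ℝ (h - synth ψ α) (synth ψ β) = lam * ∑ i, α i * β i := by
  rw [inner_synth_right, Finset.mul_sum]
  exact Finset.sum_congr rfl fun i _ => by rw [ha.inner_sub_synth]; ring

/-- The posterior kernel as an inner product in `H ⊕ ℝ^ι`, of the vectors with components `h - synth
ψ α` and `√lam α`; positivity is then visible. -/
lemma IsRidge.posterior_eq {h h' : H} {α α' : ι → ℝ}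
    (ha : IsRidge ψ lam (fun i => inner ℝ h (ψ i)) α)
    (ha' : IsRidge ψ lam (fun i => inner ℝ h' (ψ i)) α') :
    inner ℝ h h' - ∑ i, inner ℝ h (ψ i) * α' i =
      inner ℝ (h - synth ψ α) (h' - synth ψ α') + lam * ∑ i, α i * α' i := by
  rw [inner_sub_right, ha.inner_sub_synth_synth, inner_sub_left]
  have e1 : inner ℝ (synth ψ α) h' = ∑ i, α' i * inner ℝ h (ψ i) := by
    rw [ha'.sum_mul_comm ha, inner_synth_left]
    exact Finset.sum_congr rfl fun i _ => by rw [real_inner_comm]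
  rw [e1]
  simp only [mul_comm (inner ℝ h _)]
  ring

/-- The posterior variance is a minimum over all coefficient vectors. Inserting the minimiser for
one regularisation into the functional for another shows that the variance increases with `lam` and
that its quotient by `lam` decreases. -/
lemma IsRidge.posterior_le (hlam : 0 < lam) {h : H} {α : ι → ℝ}
    (ha : IsRidge ψ lam (fun i => inner ℝ h (ψ i)) α) (α' : ι → ℝ) :
    ‖h - synth ψ α‖ ^ 2 + lam * ∑ i, α i ^ 2 ≤
      ‖h - synth ψ α'‖ ^ 2 + lam * ∑ i, α' i ^ 2 := by
  have e1 : h - synth ψ α' = (h - synth ψ α) - synth ψ (α' - α) := by rw [synth_sub]; abel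
  have e2 : ∑ i, α' i ^ 2 = ∑ i, α i ^ 2 + 2 * ∑ i, α i * (α' - α) i + ∑ i, (α' - α) i ^ 2 := by
    rw [Finset.mul_sum, ← Finset.sum_add_distrib, ← Finset.sum_add_distrib]
    exact Finset.sum_congr rfl fun i _ => by rw [Pi.sub_apply]; ring
  rw [e1, norm_sub_sq_real (h - synth ψ α), ha.inner_sub_synth_synth, e2]
  have p1 : 0 ≤ ∑ i, (α' - α) i ^ 2 := Finset.sum_nonneg fun i _ => sq_nonneg _
  nlinarith [sq_nonneg ‖synth ψ (α' - α)‖]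

/-! #### Prediction error -/

/-- Cauchy–Schwarz in two blocks, the second with weights `lam` and `1 / lam`; the gap between the
two sides is the square in `key`. -/
lemma sum_mul_sq_le_mul_add {a b : ι → ℝ} {p q r : ℝ} (hlam : 0 < lam) (hp : |r| ≤ p * q) :
    (r + ∑ i, a i * b i) ^ 2 ≤
      (p ^ 2 + lam * ∑ i, a i ^ 2) * (q ^ 2 + 1 / lam * ∑ i, b i ^ 2) := by
  have cs := Finset.sum_mul_sq_le_sq_mul_sq Finset.univ a b
  set X := ∑ i, a i * b i
  set A := ∑ i, a i ^ 2
  set B := ∑ i, b i ^ 2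
  have hA : 0 ≤ A := Finset.sum_nonneg fun i _ => sq_nonneg _
  have hB : 0 ≤ B := Finset.sum_nonneg fun i _ => sq_nonneg _
  have h1 : |X| ≤ √A * √B := by
    rw [← Real.sqrt_mul hA]; exact Real.abs_le_sqrt cs
  have h2 : |r + X| ≤ p * q + √A * √B := (abs_add_le _ _).trans (add_le_add hp h1)
  have h3 : (r + X) ^ 2 ≤ (p * q + √A * √B) ^ 2 := by
    rw [← sq_abs (r + X)]; gcongr
  have sA := Real.sq_sqrt hA
  have sB := Real.sq_sqrt hB
  have sl := Real.sq_sqrt hlam.le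
  have hl : 0 < √lam := Real.sqrt_pos.2 hlam
  have key : (p ^ 2 + lam * A) * (q ^ 2 + 1 / lam * B) - (p * q + √A * √B) ^ 2 =
      (p * √B / √lam - q * √A * √lam) ^ 2 := by
    have : (p * √B / √lam - q * √A * √lam) ^ 2 =
      p ^ 2 * √B ^ 2 / √lam ^ 2 - 2 * p * q * √A * √B + q ^ 2 * √A ^ 2 * √lam ^ 2 := by
      field_simp
      ring
    rw [this, sl, sB, sA, add_sq, mul_pow √A, sA, sB]
    field_simp
    ring
  nlinarith [sq_nonneg (p * √B / √lam - q * √A * √lam)]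

/-- The self-normalised bound: with `v` the noise, the left side is the squared noise part of the
posterior mean, controlled by the posterior variance times the quadratic form of the noise. -/
lemma IsRidge.sum_mul_sq_le (hlam : 0 < lam) {h : H} {α v β : ι → ℝ}
    (ha : IsRidge ψ lam (fun i => inner ℝ h (ψ i)) α) (hv : IsRidge ψ lam v β) :
    (∑ i, α i * v i) ^ 2 ≤
      (‖h - synth ψ α‖ ^ 2 + lam * ∑ i, α i ^ 2) * (ridgeForm lam v β / lam) := by
  have e1 : ∑ i, α i * v i = inner ℝ (h - synth ψ α) (synth ψ β) +
      ∑ i, α i * inner ℝ (synth ψ β) (ψ i) := by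
    rw [ha.inner_sub_synth_synth, Finset.mul_sum, ← Finset.sum_add_distrib]
    exact Finset.sum_congr rfl fun i _ => by rw [← hv i]; ring
  have e2 : ridgeForm lam v β / lam =
      ‖synth ψ β‖ ^ 2 + 1 / lam * ∑ i, inner ℝ (synth ψ β) (ψ i) ^ 2 := by
    rw [hv.ridgeForm_eq]; field_simp; ring
  rw [e1, e2]
  exact sum_mul_sq_le_mul_add hlam (abs_real_inner_le_norm _ _)

/-! #### Residuals -/

lemma IsRidge.sum_residual_sq_le (hlam : 0 < lam) {f : H} {ξ β : ι → ℝ}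
    (h : IsRidge ψ lam (fun i => inner ℝ f (ψ i) + ξ i) β) :
    ∑ i, (lam * β i) ^ 2 ≤ ∑ i, ξ i ^ 2 + lam * ‖f‖ ^ 2 := by
  have e := h.le_objective hlam f
  rw [h.sum_mul_self] at e
  simp only [add_sub_cancel_left] at e
  have : ∑ i, (lam * β i) ^ 2 = lam * (lam * ∑ i, β i ^ 2) := by
    rw [Finset.mul_sum, Finset.mul_sum]
    exact Finset.sum_congr rfl fun i _ => by ring
  have := sq_nonneg ‖synth ψ β‖
  nlinarith

lemma IsRidge.norm_synth_sq_le {v β : ι → ℝ} (h : IsRidge ψ lam v β) :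
    lam * ‖synth ψ β‖ ^ 2 ≤ ridgeForm lam v β := by
  rw [h.ridgeForm_eq]
  have : 0 ≤ ∑ i, inner ℝ (synth ψ β) (ψ i) ^ 2 := Finset.sum_nonneg fun i _ => sq_nonneg _
  linarith

/-- With `A = synth ψ`, one has `A v = (A Aᵀ + lam) (A β)`, and `A Aᵀ + lam` expands norms by at
least `lam`. -/
lemma IsRidge.norm_synth_le (hlam : 0 < lam) {v β : ι → ℝ} (h : IsRidge ψ lam v β) :
    lam * ‖synth ψ β‖ ≤ ‖synth ψ v‖ := by
  have e1 : synth ψ v = synth ψ (fun i => inner ℝ (synth ψ β) (ψ i)) + lam • synth ψ β := by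
    simp only [synth, Finset.smul_sum, ← Finset.sum_add_distrib, smul_smul, ← add_smul]
    exact Finset.sum_congr rfl fun i _ => by rw [← h i]; rfl
  have e2 : 0 ≤ inner ℝ (synth ψ (fun i => inner ℝ (synth ψ β) (ψ i))) (synth ψ β) := by
    rw [inner_synth_left]
    refine Finset.sum_nonneg fun i _ => ?_
    rw [real_inner_comm (ψ i)]
    exact mul_self_nonneg _
  refine le_of_sq_le_sq ?_ (norm_nonneg _)
  rw [e1, norm_add_sq_real, real_inner_smul_right, norm_smul, Real.norm_eq_abs, abs_of_pos hlam]
  nlinarith [sq_nonneg ‖synth ψ (fun i => inner ℝ (synth ψ β) (ψ i))‖, mul_nonneg hlam.le e2]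

/-- The residual is `lam (βf + βξ)`. The square of its bias part is dropped; the mixed term is the
inner product of `f` with a vector obtained from the noise by applying `(K + lam)⁻¹` twice, which
explains `ζ` and the two contraction bounds. -/
lemma IsRidge.le_sum_residual_sq (hlam : 0 < lam) {f : H} {ξ βf βξ ζ : ι → ℝ}
    (hf : IsRidge ψ lam (fun i => inner ℝ f (ψ i)) βf) (hξ : IsRidge ψ lam ξ βξ)
    (hζ : IsRidge ψ lam βξ ζ) :
    ∑ i, (lam * βξ i) ^ 2 - 2 * ‖f‖ * √(lam * ridgeForm lam ξ βξ) ≤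
      ∑ i, (lam * (βf i + βξ i)) ^ 2 := by
  have e1 : ∑ i, βf i * βξ i = inner ℝ f (synth ψ ζ) := by
    rw [hf.sum_mul_comm hζ, inner_synth_right]
  have e2 : lam ^ 2 * ‖synth ψ ζ‖ ≤ √(lam * ridgeForm lam ξ βξ) := by
    refine Real.le_sqrt_of_sq_le ?_
    have a1 := hζ.norm_synth_le hlam
    have a2 := hξ.norm_synth_sq_le
    calc (lam ^ 2 * ‖synth ψ ζ‖) ^ 2 = lam ^ 2 * (lam * ‖synth ψ ζ‖) ^ 2 := by ring
      _ ≤ lam ^ 2 * ‖synth ψ βξ‖ ^ 2 := by gcongr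
      _ = lam * (lam * ‖synth ψ βξ‖ ^ 2) := by ring
      _ ≤ _ := by gcongr
  have e3 : ∑ i, (lam * (βf i + βξ i)) ^ 2 = ∑ i, (lam * βf i) ^ 2
      + 2 * (lam ^ 2 * ∑ i, βf i * βξ i) + ∑ i, (lam * βξ i) ^ 2 := by
    rw [Finset.mul_sum, Finset.mul_sum, ← Finset.sum_add_distrib, ← Finset.sum_add_distrib]
    exact Finset.sum_congr rfl fun i _ => by ring
  have e4 : 0 ≤ ∑ i, (lam * βf i) ^ 2 := Finset.sum_nonneg fun i _ => sq_nonneg _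
  have e5 := (abs_le.1 (abs_real_inner_le_norm f (synth ψ ζ))).1
  have e6 : ‖f‖ * (lam ^ 2 * ‖synth ψ ζ‖) ≤ ‖f‖ * √(lam * ridgeForm lam ξ βξ) := by gcongr
  have e7 : lam ^ 2 * (-(‖f‖ * ‖synth ψ ζ‖)) ≤ lam ^ 2 * inner ℝ f (synth ψ ζ) := by gcongr
  rw [e3, e1]
  linarith

/-- `‖ξ‖² - S` is the inner product of `ξ` with the residual `lam β` of its own regression. -/
lemma sub_ridgeForm_sq_le {ξ β : ι → ℝ} :
    (∑ i, ξ i ^ 2 - ridgeForm lam ξ β) ^ 2 ≤ (∑ i, ξ i ^ 2) * ∑ i, (lam * β i) ^ 2 := by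
  have : ∑ i, ξ i ^ 2 - ridgeForm lam ξ β = ∑ i, ξ i * (lam * β i) := by
    rw [ridgeForm, sub_sub_cancel, Finset.mul_sum]
    exact Finset.sum_congr rfl fun i _ => by ring
  rw [this]
  exact Finset.sum_mul_sq_le_sq_mul_sq _ _ _

end Ridge

/-! #### One more observation -/

section Update

variable {H : Type*} [NormedAddCommGroup H] [InnerProductSpace ℝ H] {lam : ℝ} {t : ℕ}

/-- Block elimination: `κ` is the posterior variance at the new point, `lam + κ` the Schur
complement, and the new coefficient `d` the prediction error divided by it. -/
lemma isRidge_snoc {ψ : Fin (t + 1) → H} {v : Fin (t + 1) → ℝ} {β α : Fin t → ℝ}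
    (hβ : IsRidge (fun i : Fin t => ψ i.castSucc) lam (fun i => v i.castSucc) β)
    (hα : IsRidge (fun i : Fin t => ψ i.castSucc) lam
      (fun i => inner ℝ (ψ (Fin.last t)) (ψ i.castSucc)) α) {κ d : ℝ}
    (hκ : κ = ‖ψ (Fin.last t) - synth (fun i : Fin t => ψ i.castSucc) α‖ ^ 2
      + lam * ∑ i, α i ^ 2)
    (hd : d * (lam + κ) = v (Fin.last t) - ∑ i, α i * v i.castSucc) :
    IsRidge ψ lam v (Fin.snoc (fun i => β i - d * α i) d) := by
  set ψ' : Fin t → H := fun i => ψ i.castSucc with hψ'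
  set h := ψ (Fin.last t) with hh
  have es : synth ψ (Fin.snoc (fun i => β i - d * α i) d) = synth ψ' β + d • (h - synth ψ' α) := by
    simp only [synth, Fin.sum_univ_castSucc, Fin.snoc_castSucc, Fin.snoc_last, sub_smul,
      Finset.sum_sub_distrib, mul_smul, ← Finset.smul_sum, smul_sub]
    abel
  intro i
  rw [es]
  refine Fin.lastCases ?_ (fun j => ?_) i
  · rw [Fin.snoc_last, inner_add_left, real_inner_smul_left, ← hh]
    have a1 : inner ℝ (synth ψ' β) h = ∑ i, α i * v i.castSucc := by
      rw [inner_synth_left, hα.sum_mul_comm hβ]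
      exact Finset.sum_congr rfl fun i _ => by rw [real_inner_comm]
    have a2 : inner ℝ (h - synth ψ' α) h = κ := by
      have : h = (h - synth ψ' α) + synth ψ' α := by abel
      conv_lhs => rw [this]
      rw [add_sub_cancel_right, inner_add_right, hα.inner_sub_synth_synth,
        real_inner_self_eq_norm_sq, hκ]
      simp [sq]
    rw [a1, a2]
    linarith
  · rw [Fin.snoc_castSucc, inner_add_left, real_inner_smul_left, hα.inner_sub_synth j]
    have := hβ j
    simp only at this
    linarith

/-- Each observation adds its squared prediction error, normalised by the predictive variance, to
the minimum of the regularised least squares. -/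
lemma sum_mul_snoc (hlam : 0 < lam) {v : Fin (t + 1) → ℝ} {β α : Fin t → ℝ} {κ d m : ℝ}
    (hκ : 0 ≤ κ) (hm : ∑ i, α i * v i.castSucc = m)
    (hd : d * (lam + κ) = v (Fin.last t) - m) :
    lam * ∑ i, (Fin.snoc (fun i => β i - d * α i) d : Fin (t + 1) → ℝ) i * v i =
      lam * ∑ i, β i * v i.castSucc + (v (Fin.last t) - m) ^ 2 / (1 + κ / lam) := by
  have hp : 0 < lam + κ := by linarith
  have : ∑ i, (Fin.snoc (fun i => β i - d * α i) d : Fin (t + 1) → ℝ) i * v i =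
      ∑ i, β i * v i.castSucc - d * m + d * v (Fin.last t) := by
    rw [Fin.sum_univ_castSucc, ← hm]
    simp only [Fin.snoc_castSucc, Fin.snoc_last, sub_mul, Finset.sum_sub_distrib, Finset.mul_sum]
    simp only [mul_assoc]
  have hd' : d = (v (Fin.last t) - m) / (lam + κ) := by rw [← hd]; field_simp
  rw [this, hd']
  field_simp
  ring

end Update


/-! ### Kernel regression as ridge regression -/

section Regression

lemma sum_Icc_eq_sum_fin (g : ℕ → ℝ) (t : ℕ) : ∑ s ∈ Finset.Icc 1 t, g s = ∑ i : Fin t, g (i + 1) := by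
  induction t with
  | zero => simp
  | succ t ih => rw [Finset.sum_Icc_succ_top (by omega), ih, Fin.sum_univ_castSucc]; simp

variable {𝒳 H : Type*} [NormedAddCommGroup H] [InnerProductSpace ℝ H]
variable {k : 𝒳 → 𝒳 → ℝ} {φ : 𝒳 → H} {x : ℕ → 𝒳} {y ξ : ℕ → ℝ} {lam lam' : ℝ} {t : ℕ}

/-- The features of the first `t` points. -/
def feat (φ : 𝒳 → H) (x : ℕ → 𝒳) (t : ℕ) : Fin t → H := fun i => φ (x (i + 1))

/-- The coefficients `(K_t + lam I)⁻¹ v`. -/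
def ridgeCoef (k : 𝒳 → 𝒳 → ℝ) (x : ℕ → 𝒳) (lam : ℝ) (t : ℕ) (v : Fin t → ℝ) : Fin t → ℝ :=
  (gram k x t + lam • (1 : Matrix (Fin t) (Fin t) ℝ))⁻¹.mulVec v

lemma gram_mulVec (hk : ∀ a b, k a b = inner ℝ (φ a) (φ b)) (v : Fin t → ℝ) (i : Fin t) :
    (gram k x t).mulVec v i = inner ℝ (synth (feat φ x t) v) (feat φ x t i) := by
  rw [inner_synth_left]
  simp only [Matrix.mulVec, dotProduct, gram, Matrix.of_apply, hk, feat]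
  exact Finset.sum_congr rfl fun j _ => by rw [real_inner_comm, mul_comm]

lemma isUnit_gram_add (hk : ∀ a b, k a b = inner ℝ (φ a) (φ b)) (hlam : 0 < lam) :
    IsUnit (gram k x t + lam • (1 : Matrix (Fin t) (Fin t) ℝ)) := by
  rw [← Matrix.mulVec_injective_iff_isUnit]
  intro v w hvw
  have key : ∀ u : Fin t → ℝ, IsRidge (feat φ x t) lam
      ((gram k x t + lam • (1 : Matrix (Fin t) (Fin t) ℝ)).mulVec u) u := by
    intro u i
    rw [Matrix.add_mulVec, Pi.add_apply, gram_mulVec hk, Matrix.smul_mulVec, Matrix.one_mulVec,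
      Pi.smul_apply, smul_eq_mul]
  have h1 := key v
  have h2 := key w
  rw [← hvw] at h2
  exact h1.unique hlam h2

lemma isRidge_ridgeCoef (hk : ∀ a b, k a b = inner ℝ (φ a) (φ b)) (hlam : 0 < lam)
    (v : Fin t → ℝ) : IsRidge (feat φ x t) lam v (ridgeCoef k x lam t v) := by
  intro i
  have hu := (Matrix.isUnit_iff_isUnit_det _).1 (isUnit_gram_add (x := x) (t := t) hk hlam)
  have h1 : (gram k x t + lam • (1 : Matrix (Fin t) (Fin t) ℝ)).mulVec (ridgeCoef k x lam t v)
      = v := by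
    rw [ridgeCoef, Matrix.mulVec_mulVec, Matrix.mul_nonsing_inv _ hu, Matrix.one_mulVec]
  have h2 := congrFun h1 i
  rwa [Matrix.add_mulVec, Pi.add_apply, gram_mulVec hk, Matrix.smul_mulVec, Matrix.one_mulVec,
      Pi.smul_apply, smul_eq_mul] at h2

lemma isRidge_kvec (hk : ∀ a b, k a b = inner ℝ (φ a) (φ b)) (hlam : 0 < lam) (z : 𝒳) :
    IsRidge (feat φ x t) lam (fun i => inner ℝ (φ z) (feat φ x t i))
      (ridgeCoef k x lam t (kvec k x t z)) := by
  have := isRidge_ridgeCoef (x := x) (t := t) hk hlam (kvec k x t z)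
  have e : kvec k x t z = fun i => inner ℝ (φ z) (feat φ x t i) := by
    funext i; simp [kvec, hk, feat]
  rwa [e] at this ⊢

lemma postKernel_eq (hk : ∀ a b, k a b = inner ℝ (φ a) (φ b)) (hlam : 0 < lam) (z z' : 𝒳) :
    postKernel k x lam t z z' =
      inner ℝ (φ z - synth (feat φ x t) (ridgeCoef k x lam t (kvec k x t z)))
        (φ z' - synth (feat φ x t) (ridgeCoef k x lam t (kvec k x t z')))
      + lam * ∑ i, ridgeCoef k x lam t (kvec k x t z) i * ridgeCoef k x lam t (kvec k x t z') i := by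
  rw [← (isRidge_kvec hk hlam z).posterior_eq (isRidge_kvec hk hlam z'), postKernel, hk]
  simp only [dotProduct, kvec, hk, feat, ridgeCoef]

lemma postKernel_self (hk : ∀ a b, k a b = inner ℝ (φ a) (φ b)) (hlam : 0 < lam) (z : 𝒳) :
    postKernel k x lam t z z =
      ‖φ z - synth (feat φ x t) (ridgeCoef k x lam t (kvec k x t z))‖ ^ 2
      + lam * ∑ i, ridgeCoef k x lam t (kvec k x t z) i ^ 2 := by
  rw [postKernel_eq hk hlam, real_inner_self_eq_norm_sq]
  simp [sq]

lemma postKernel_self_nonneg (hk : ∀ a b, k a b = inner ℝ (φ a) (φ b)) (hlam : 0 < lam) (z : 𝒳) :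
    0 ≤ postKernel k x lam t z z := by
  rw [postKernel_self hk hlam]; positivity

lemma postKernel_self_le (hk : ∀ a b, k a b = inner ℝ (φ a) (φ b)) (hlam : 0 < lam) (z : 𝒳) :
    postKernel k x lam t z z ≤ k z z := by
  rw [postKernel_self hk hlam]
  refine ((isRidge_kvec hk hlam z).posterior_le hlam 0).trans ?_
  simp [synth, hk]

lemma postKernel_mono (hk : ∀ a b, k a b = inner ℝ (φ a) (φ b)) (hlam : 0 < lam) (hle : lam ≤ lam')
    (z : 𝒳) : postKernel k x lam t z z ≤ postKernel k x lam' t z z := by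
  rw [postKernel_self hk hlam, postKernel_self hk (hlam.trans_le hle)]
  refine ((isRidge_kvec hk hlam z).posterior_le hlam
    (ridgeCoef k x lam' t (kvec k x t z))).trans ?_
  gcongr

lemma postKernel_div_anti (hk : ∀ a b, k a b = inner ℝ (φ a) (φ b)) (hlam : 0 < lam)
    (hle : lam ≤ lam') (z : 𝒳) :
    postKernel k x lam' t z z / lam' ≤ postKernel k x lam t z z / lam := by
  have hlam' := hlam.trans_le hle
  rw [postKernel_self hk hlam, postKernel_self hk hlam']
  have h := (isRidge_kvec (x := x) (t := t) hk hlam' z).posterior_le hlam'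
    (ridgeCoef k x lam t (kvec k x t z))
  refine (div_le_div_of_nonneg_right h hlam'.le).trans ?_
  rw [add_div, add_div, mul_div_cancel_left₀ _ hlam.ne', mul_div_cancel_left₀ _ hlam'.ne']
  gcongr

/-- Needed to read off the marginals of the multivariate Gaussian with this covariance. -/
lemma posSemidef_postKernel (hk : ∀ a b, k a b = inner ℝ (φ a) (φ b)) (hlam : 0 < lam)
    (arms : Finset 𝒳) {c : ℝ} (hc : 0 ≤ c) :
    (Matrix.of fun a b : arms => c * postKernel k x lam t a b).PosSemidef := by
  refine Matrix.PosSemidef.of_dotProduct_mulVec_nonneg ?_ fun w => ?_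
  · ext a b
    simp only [Matrix.conjTranspose_apply, Matrix.of_apply, star_trivial]
    rw [postKernel_eq hk hlam, postKernel_eq hk hlam, real_inner_comm]
    simp [mul_comm]
  · set r : arms → H := fun a => φ a - synth (feat φ x t) (ridgeCoef k x lam t (kvec k x t a))
    set α : arms → Fin t → ℝ := fun a => ridgeCoef k x lam t (kvec k x t a)
    have : star w ⬝ᵥ (Matrix.of fun a b : arms => c * postKernel k x lam t a b).mulVec w =
        c * (‖synth r w‖ ^ 2 + lam * ∑ i, (∑ a, w a * α a i) ^ 2) := by
      have e1 : ‖synth r w‖ ^ 2 = ∑ a, ∑ b, w a * w b * inner ℝ (r a) (r b) := by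
        rw [← real_inner_self_eq_norm_sq, inner_synth_left]
        simp only [inner_synth_right, Finset.mul_sum]
        exact Finset.sum_congr rfl fun a _ => Finset.sum_congr rfl fun b _ => by ring
      have e2 : ∑ i, (∑ a, w a * α a i) ^ 2 = ∑ a, ∑ b, w a * w b * ∑ i, α a i * α b i := by
        simp only [sq, Finset.sum_mul_sum]
        rw [Finset.sum_comm]
        refine Finset.sum_congr rfl fun a _ => ?_
        rw [Finset.sum_comm]
        refine Finset.sum_congr rfl fun b _ => ?_
        rw [Finset.mul_sum]
        exact Finset.sum_congr rfl fun i _ => by ring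
      rw [e1, e2, Finset.mul_sum, ← Finset.sum_add_distrib, Finset.mul_sum]
      simp only [dotProduct, Matrix.mulVec, Matrix.of_apply, star_trivial, postKernel_eq hk hlam]
      refine Finset.sum_congr rfl fun a _ => ?_
      rw [Finset.mul_sum, Finset.mul_sum, ← Finset.sum_add_distrib, Finset.mul_sum]
      refine Finset.sum_congr rfl fun b _ => ?_
      simp only [r, α]
      ring
    rw [this]; positivity

/-! #### Information gain -/

lemma infoGain_mono (hk : ∀ a b, k a b = inner ℝ (φ a) (φ b)) (hlam : 0 < lam) {t t' : ℕ}
    (h : t ≤ t') : infoGain k x lam t ≤ infoGain k x lam t' := by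
  unfold infoGain
  refine mul_le_mul_of_nonneg_left ?_ (by norm_num)
  refine Finset.sum_le_sum_of_subset_of_nonneg (Finset.Icc_subset_Icc_right h) fun s _ _ => ?_
  refine Real.log_nonneg ?_
  have := postKernel_self_nonneg (x := x) (t := s - 1) hk hlam (x s)
  have : 0 ≤ 1 / lam * postKernel k x lam (s - 1) (x s) (x s) := by positivity
  linarith

lemma infoGain_nonneg (hk : ∀ a b, k a b = inner ℝ (φ a) (φ b)) (hlam : 0 < lam) :
    0 ≤ infoGain k x lam t := by
  have := infoGain_mono (x := x) hk hlam (Nat.zero_le t)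
  simpa [infoGain] using this

lemma infoGain_anti (hk : ∀ a b, k a b = inner ℝ (φ a) (φ b)) (hlam : 0 < lam)
    (hle : lam ≤ lam') : infoGain k x lam' t ≤ infoGain k x lam t := by
  unfold infoGain
  refine mul_le_mul_of_nonneg_left (Finset.sum_le_sum fun s _ => ?_) (by norm_num)
  have h0 := postKernel_self_nonneg (x := x) (t := s - 1) hk (hlam.trans_le hle) (x s)
  have h1 := postKernel_div_anti (x := x) (t := s - 1) hk hlam hle (x s)
  have : 0 ≤ postKernel k x lam' (s - 1) (x s) (x s) / lam' :=
    div_nonneg h0 (hlam.trans_le hle).le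
  rw [one_div_mul_eq_div, one_div_mul_eq_div]
  exact Real.log_le_log (by linarith) (by linarith)

lemma log_one_add_mul_le {c u : ℝ} (hc : 1 ≤ c) (hu : 0 ≤ u) :
    Real.log (1 + c * u) ≤ c * Real.log (1 + u) := by
  have h := one_add_mul_self_le_rpow_one_add (s := u) (by linarith) hc
  rw [← Real.log_rpow (by linarith)]
  exact Real.log_le_log (by positivity) h

/-- Decreasing the regularisation lowers the posterior variances, so only the prefactor `1 / lam`
grows; Bernoulli's inequality moves the ratio out of the logarithm. -/
lemma infoGain_le_mul (hk : ∀ a b, k a b = inner ℝ (φ a) (φ b)) (hlam : 0 < lam)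
    (hle : lam ≤ lam') : infoGain k x lam t ≤ lam' / lam * infoGain k x lam' t := by
  have hlam' := hlam.trans_le hle
  unfold infoGain
  rw [mul_left_comm]
  refine mul_le_mul_of_nonneg_left ?_ (by norm_num)
  rw [Finset.mul_sum]
  refine Finset.sum_le_sum fun s _ => ?_
  have h0 := postKernel_self_nonneg (x := x) (t := s - 1) hk hlam (x s)
  have h1 := postKernel_mono (x := x) (t := s - 1) hk hlam hle (x s)
  set u := postKernel k x lam (s - 1) (x s) (x s)
  set u' := postKernel k x lam' (s - 1) (x s) (x s)
  refine le_trans ?_ (log_one_add_mul_le ((one_le_div hlam).2 hle) (u := 1 / lam' * u')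
    (by have := h0.trans h1; positivity))
  refine Real.log_le_log (by positivity) ?_
  have : lam' / lam * (1 / lam' * u') = 1 / lam * u' := by field_simp
  rw [this]
  gcongr

/-! #### Sequential form of the quadratic form of the noise -/

/-- The quadratic form `vᵀ K_t (K_t + lam I)⁻¹ v` of the first `t` entries of `v`. -/
def noiseForm (k : 𝒳 → 𝒳 → ℝ) (x : ℕ → 𝒳) (ξ : ℕ → ℝ) (lam : ℝ) (t : ℕ) : ℝ :=
  ridgeForm lam (fun i : Fin t => ξ (i + 1)) (ridgeCoef k x lam t fun i => ξ (i + 1))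

lemma postMean_eq (hk : ∀ a b, k a b = inner ℝ (φ a) (φ b)) (hlam : 0 < lam) (z : 𝒳) :
    postMean k x y lam t z = ∑ i, ridgeCoef k x lam t (kvec k x t z) i * y (i + 1) := by
  have h := (isRidge_kvec (x := x) (t := t) hk hlam z).sum_mul_comm
    (isRidge_ridgeCoef hk hlam fun i => y (i + 1))
  rw [h, postMean]
  simp only [dotProduct, kvec, hk, feat, ridgeCoef]
  exact Finset.sum_congr rfl fun i _ => mul_comm _ _

lemma ridge_sum_succ (hk : ∀ a b, k a b = inner ℝ (φ a) (φ b)) (hlam : 0 < lam) (t : ℕ) :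
    lam * ∑ i : Fin (t + 1), ridgeCoef k x lam (t + 1) (fun i => ξ (i + 1)) i * ξ (i + 1) =
      lam * ∑ i : Fin t, ridgeCoef k x lam t (fun i => ξ (i + 1)) i * ξ (i + 1)
      + (ξ (t + 1) - postMean k x ξ lam t (x (t + 1))) ^ 2
        / (1 + 1 / lam * postKernel k x lam t (x (t + 1)) (x (t + 1))) := by
  have hκ0 := postKernel_self_nonneg (x := x) (t := t) hk hlam (x (t + 1))
  have hκ := postKernel_self (x := x) (t := t) hk hlam (x (t + 1))
  have hm := postMean_eq (x := x) (t := t) (y := ξ) hk hlam (x (t + 1))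
  set κ := postKernel k x lam t (x (t + 1)) (x (t + 1))
  set m := postMean k x ξ lam t (x (t + 1))
  set v : Fin (t + 1) → ℝ := fun i => ξ (i + 1) with hv
  have hp : 0 < lam + κ := by linarith
  have hd : (v (Fin.last t) - m) / (lam + κ) * (lam + κ) = v (Fin.last t) - m := by
    field_simp
  have h1 := isRidge_snoc (ψ := feat φ x (t + 1)) (v := v)
    (isRidge_ridgeCoef (x := x) (t := t) hk hlam fun i => ξ (i + 1))
    (isRidge_kvec (x := x) (t := t) hk hlam (x (t + 1))) hκ (by rw [hd, hm]; rfl)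
  rw [(isRidge_ridgeCoef hk hlam v).unique hlam h1,
    sum_mul_snoc hlam hκ0 (by rw [hm]; rfl) hd]
  rw [one_div_mul_eq_div]
  simp [hv]

/-- The summands are the exponents of a Gaussian likelihood ratio with predictable mean and
variance. This makes the matrix quantity accessible to a scalar supermartingale argument. -/
lemma noiseForm_eq_sum (hk : ∀ a b, k a b = inner ℝ (φ a) (φ b)) (hlam : 0 < lam) (t : ℕ) :
    noiseForm k x ξ lam t = ∑ s ∈ Finset.Icc 1 t, (ξ s ^ 2
      - (ξ s - postMean k x ξ lam (s - 1) (x s)) ^ 2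
        / (1 + 1 / lam * postKernel k x lam (s - 1) (x s) (x s))) := by
  induction t with
  | zero => simp [noiseForm, ridgeForm]
  | succ t ih =>
    rw [Finset.sum_Icc_succ_top (by omega), ← ih, noiseForm, noiseForm, ridgeForm, ridgeForm,
      ridge_sum_succ hk hlam, Fin.sum_univ_castSucc]
    simp only [Fin.val_castSucc, Fin.val_last, Nat.add_sub_cancel]
    ring

lemma noiseForm_nonneg (hk : ∀ a b, k a b = inner ℝ (φ a) (φ b)) (hlam : 0 < lam) :
    0 ≤ noiseForm k x ξ lam t :=
  (isRidge_ridgeCoef (x := x) (t := t) hk hlam _).ridgeForm_nonneg hlam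

lemma noiseForm_anti (hk : ∀ a b, k a b = inner ℝ (φ a) (φ b)) (hlam : 0 < lam)
    (hle : lam ≤ lam') : noiseForm k x ξ lam' t ≤ noiseForm k x ξ lam t :=
  (isRidge_ridgeCoef (x := x) (t := t) hk hlam _).ridgeForm_anti hlam hle
    (isRidge_ridgeCoef hk (hlam.trans_le hle) _)

lemma mul_noiseForm_mono (hk : ∀ a b, k a b = inner ℝ (φ a) (φ b)) (hlam : 0 < lam)
    (hle : lam ≤ lam') : lam * noiseForm k x ξ lam t ≤ lam' * noiseForm k x ξ lam' t :=
  (isRidge_ridgeCoef (x := x) (t := t) hk hlam _).mul_ridgeForm_mono hlam hle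
    (isRidge_ridgeCoef hk (hlam.trans_le hle) _)

/-! #### Errors of the mean and of the empirical variance -/

/-- The error of the posterior mean splits into a bias and a noise part. -/
lemma abs_postMean_sub_le (hk : ∀ a b, k a b = inner ℝ (φ a) (φ b)) (hlam : 0 < lam) (f : H)
    (hy : ∀ s, 1 ≤ s → y s = inner ℝ f (φ (x s)) + ξ s) (z : 𝒳) :
    |postMean k x y lam t z - inner ℝ f (φ z)| ≤
      √(postKernel k x lam t z z / lam) * (√lam * ‖f‖ + √(noiseForm k x ξ lam t)) := by
  have ha := isRidge_kvec (x := x) (t := t) hk hlam z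
  have hκ := postKernel_self (x := x) (t := t) hk hlam z
  have hκ0 := postKernel_self_nonneg (x := x) (t := t) hk hlam z
  set α := ridgeCoef k x lam t (kvec k x t z)
  set κ := postKernel k x lam t z z
  have hs := ha.sum_mul_sq_le hlam (isRidge_ridgeCoef hk hlam fun i => ξ (i + 1))
  rw [← hκ] at hs
  have e : postMean k x y lam t z - inner ℝ f (φ z) =
      -inner ℝ f (φ z - synth (feat φ x t) α) + ∑ i : Fin t, α i * ξ (i + 1) := by
    rw [postMean_eq hk hlam, inner_sub_right, inner_synth_right]
    simp only [hy _ (Nat.le_add_left 1 _), mul_add, Finset.sum_add_distrib, feat, α]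
    ring
  have b1 : |inner ℝ f (φ z - synth (feat φ x t) α)| ≤ ‖f‖ * √κ := by
    refine (abs_real_inner_le_norm _ _).trans ?_
    gcongr
    refine Real.le_sqrt_of_sq_le ?_
    rw [hκ]
    have : 0 ≤ lam * ∑ i, α i ^ 2 := by positivity
    linarith
  have b2 : |∑ i : Fin t, α i * ξ (i + 1)| ≤ √(κ / lam) * √(noiseForm k x ξ lam t) := by
    rw [← Real.sqrt_mul (by positivity)]
    refine Real.abs_le_sqrt (hs.trans_eq ?_)
    rw [noiseForm]; ring
  rw [e]
  have e2 : √κ = √(κ / lam) * √lam := by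
    rw [← Real.sqrt_mul (by positivity), div_mul_cancel₀ _ hlam.ne']
  calc _ ≤ |inner ℝ f (φ z - synth (feat φ x t) α)| + |∑ i : Fin t, α i * ξ (i + 1)| := by
        refine (abs_add_le _ _).trans_eq ?_
        rw [abs_neg]
    _ ≤ ‖f‖ * √κ + √(κ / lam) * √(noiseForm k x ξ lam t) := add_le_add b1 b2
    _ = _ := by rw [e2]; ring

lemma sub_postMean (hk : ∀ a b, k a b = inner ℝ (φ a) (φ b)) (hlam : 0 < lam) (i : Fin t) :
    y (i + 1) - postMean k x y lam t (x (i + 1)) =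
      lam * ridgeCoef k x lam t (fun i => y (i + 1)) i := by
  have h := isRidge_ridgeCoef (x := x) (t := t) hk hlam (fun i => y (i + 1)) i
  simp only at h
  rw [← h, inner_synth_left, postMean]
  have : ∑ j, ridgeCoef k x lam t (fun i => y (i + 1)) j *
      inner ℝ (feat φ x t j) (feat φ x t i) = kvec k x t (x (i + 1)) ⬝ᵥ
      ((gram k x t + lam • (1 : Matrix (Fin t) (Fin t) ℝ))⁻¹.mulVec fun i => y (i + 1)) := by
    simp only [dotProduct, kvec, hk, feat, ridgeCoef]
    exact Finset.sum_congr rfl fun j _ => by rw [real_inner_comm, mul_comm]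
  rw [this]; ring

lemma mul_sdHat_sq (hk : ∀ a b, k a b = inner ℝ (φ a) (φ b)) (hlam : 0 < lam) (ht : t ≠ 0) :
    t * sdHat k x y lam t ^ 2 =
      ∑ i, (lam * ridgeCoef k x lam t (fun i => y (i + 1)) i) ^ 2 := by
  have ht' : (t : ℝ) ≠ 0 := by exact_mod_cast ht
  rw [sdHat, Real.sq_sqrt (by positivity), ← mul_assoc, mul_one_div_cancel ht', one_mul,
    sum_Icc_eq_sum_fin (fun s => (y s - postMean k x y lam t (x s)) ^ 2)]
  exact Finset.sum_congr rfl fun i _ => by rw [sub_postMean hk hlam]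

lemma mul_sdHat_sq_le (hk : ∀ a b, k a b = inner ℝ (φ a) (φ b)) (hlam : 0 < lam) (ht : t ≠ 0)
    (f : H) (hy : ∀ s, 1 ≤ s → y s = inner ℝ f (φ (x s)) + ξ s) :
    t * sdHat k x y lam t ^ 2 ≤ ∑ s ∈ Finset.Icc 1 t, ξ s ^ 2 + lam * ‖f‖ ^ 2 := by
  rw [mul_sdHat_sq hk hlam ht, sum_Icc_eq_sum_fin (fun s => ξ s ^ 2)]
  have h := isRidge_ridgeCoef (x := x) (t := t) hk hlam (fun i => y (i + 1))
  refine IsRidge.sum_residual_sq_le (ψ := feat φ x t) hlam ?_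
  simpa only [hy _ (Nat.le_add_left 1 _), feat] using! h

/-- A lower bound on the empirical variance: the residual of the noise loses at most `S / ‖ξ‖`, and
the mixed term is at most `2 ‖f‖ √(lam S)`, where `S` is the quadratic form of the noise. -/
lemma le_mul_sdHat_sq (hk : ∀ a b, k a b = inner ℝ (φ a) (φ b)) (hlam : 0 < lam) (ht : t ≠ 0)
    (f : H) (hy : ∀ s, 1 ≤ s → y s = inner ℝ f (φ (x s)) + ξ s) :
    (∑ s ∈ Finset.Icc 1 t, ξ s ^ 2 - noiseForm k x ξ lam t) ^ 2 ≤
      (∑ s ∈ Finset.Icc 1 t, ξ s ^ 2) * (t * sdHat k x y lam t ^ 2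
        + 2 * ‖f‖ * √(lam * noiseForm k x ξ lam t)) := by
  rw [mul_sdHat_sq hk hlam ht, sum_Icc_eq_sum_fin (fun s => ξ s ^ 2)]
  refine (sub_ridgeForm_sq_le (lam := lam) (ξ := fun i : Fin t => ξ (i + 1))
    (β := ridgeCoef k x lam t fun i => ξ (i + 1))).trans ?_
  refine mul_le_mul_of_nonneg_left ?_ (Finset.sum_nonneg fun i _ => sq_nonneg _)
  have hξ := isRidge_ridgeCoef (x := x) (t := t) hk hlam (fun i => ξ (i + 1))
  have hf := isRidge_ridgeCoef (x := x) (t := t) hk hlam (fun i => inner ℝ f (feat φ x t i))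
  have h := hf.le_sum_residual_sq hlam hξ (isRidge_ridgeCoef hk hlam _)
  have e : ridgeCoef k x lam t (fun i => y (i + 1)) =
      ridgeCoef k x lam t (fun i => inner ℝ f (feat φ x t i)) +
      ridgeCoef k x lam t (fun i => ξ (i + 1)) := by
    refine (isRidge_ridgeCoef (x := x) (t := t) hk hlam _).unique hlam ?_
    have := hf.add hξ
    convert this using 1
    funext i
    simp [hy _ (Nat.le_add_left 1 _), feat]
  rw [e, noiseForm]
  simp only [Pi.add_apply]
  linarith

end Regression


/-! ### Conditional laws and time-uniform inequalities -/

section Probability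

open scoped ENNReal

variable {Ω : Type*} {mΩ : MeasurableSpace Ω} {P : Measure Ω} [IsProbabilityMeasure P]

/-- The hypothesis gives one null set per measurable set. A countable algebra generating the
σ-algebra reduces these to one null set, and a π-system argument then identifies the two measures.
-/
lemma ae_condDistrib_eq {E : Type*} {mE : MeasurableSpace E} [StandardBorelSpace E] [Nonempty E]
    {G : MeasurableSpace Ω} (hG : G ≤ mΩ) {Y : Ω → E} (hY : Measurable[mΩ] Y) {ν : Ω → Measure E}
    [∀ ω, IsProbabilityMeasure (ν ω)]
    (h : ∀ s, MeasurableSet s → P⟦Y ⁻¹' s | G⟧ =ᵐ[P] fun ω => (ν ω).real s) :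
    ∀ᵐ ω ∂P, (@condDistrib Ω Ω E mE _ _ mΩ G Y id P _) ω = ν ω := by
  have hid : @Measurable Ω Ω mΩ G id := measurable_id'' hG
  set κ := @condDistrib Ω Ω E mE _ _ mΩ G Y id P _ with hκ
  obtain ⟨b, hbc, -, hbg⟩ : ∃ b : Set (Set E), b.Countable ∧ b.Nonempty ∧
      mE = MeasurableSpace.generateFrom b := by
    refine ⟨MeasurableSpace.countableGeneratingSet E,
      MeasurableSpace.countable_countableGeneratingSet,
      MeasurableSpace.nonempty_countableGeneratingSet,
      (MeasurableSpace.generateFrom_countableGeneratingSet).symm⟩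
  have hπc : (generateSetAlgebra b).Countable := countable_generateSetAlgebra hbc
  have hmeas : ∀ s ∈ generateSetAlgebra b, MeasurableSet s := by
    intro s hs
    rw [hbg, ← generateFrom_generateSetAlgebra_eq]
    exact MeasurableSpace.measurableSet_generateFrom hs
  have hall : ∀ᵐ ω ∂P, ∀ s ∈ generateSetAlgebra b, κ ω s = ν ω s := by
    rw [ae_ball_iff hπc]
    intro s hs
    have h1 := @condDistrib_ae_eq_condExp Ω Ω E mE _ _ mΩ P _ id Y G s hid hY (hmeas s hs)
    rw [MeasurableSpace.comap_id] at h1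
    filter_upwards [h1, h s (hmeas s hs)] with ω h2 h3
    have h4 : (κ ω).real s = (ν ω).real s := h2.trans h3
    rwa [measureReal_def, measureReal_def, ENNReal.toReal_eq_toReal_iff' (measure_ne_top _ _)
      (measure_ne_top _ _)] at h4
  filter_upwards [hall] with ω hω
  refine ext_of_generate_finite (generateSetAlgebra b) ?_ ?_ hω (by simp)
  · rw [generateFrom_generateSetAlgebra_eq, ← hbg]
  · exact fun s hs u hu _ => isSetAlgebra_generateSetAlgebra.inter_mem hs hu

/-- If `ν` is a version of the conditional law of `Y` given `G`, then integrals of functions of the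
`G`-measurable data and `Y` can be computed by integrating first with respect to `ν`. -/
lemma lintegral_eq_lintegral_condLaw {E : Type*} {mE : MeasurableSpace E} [StandardBorelSpace E]
    [Nonempty E] {G : MeasurableSpace Ω} (hG : G ≤ mΩ) {Y : Ω → E} (hY : Measurable[mΩ] Y)
    {ν : Ω → Measure E} [∀ ω, IsProbabilityMeasure (ν ω)]
    (h : ∀ s, MeasurableSet s → P⟦Y ⁻¹' s | G⟧ =ᵐ[P] fun ω => (ν ω).real s)
    {F : Ω × E → ℝ≥0∞} (hF : @Measurable _ _ (G.prod mE) _ F) :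
    ∫⁻ ω, F (ω, Y ω) ∂P = ∫⁻ ω, ∫⁻ z, F (ω, z) ∂(ν ω) ∂P := by
  have hid : @Measurable Ω Ω mΩ G id := measurable_id'' hG
  have hae := ae_condDistrib_eq hG hY h
  have hc := @compProd_map_condDistrib Ω Ω E mE _ _ mΩ P _ id Y G hY.aemeasurable
  have e1 : ∫⁻ ω, F (ω, Y ω) ∂P =
      @lintegral _ (G.prod mE) (@Measure.map _ _ mΩ (G.prod mE) (fun a => (id a, Y a)) P) F := by
    have hm : @Measurable Ω (Ω × E) mΩ (G.prod mE) (fun a => (id a, Y a)) :=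
      Measurable.prodMk hid hY
    rw [@lintegral_map _ _ mΩ (G.prod mE) P F _ hF hm]
    rfl
  rw [e1, ← hc, @Measure.lintegral_compProd _ _ G mE _ _ _ _ F hF]
  rw [@lintegral_map _ _ mΩ G P _ id (hF.lintegral_kernel_prod_right') hid]
  refine lintegral_congr_ae ?_
  filter_upwards [hae] with ω hω
  simp only [id]
  rw [hω]

/-- Ville's inequality for a product of factors whose conditional expectations are at most `1`. -/
lemma mul_measure_exists_le_prod_le {𝒢 : ℕ → MeasurableSpace Ω} (hmono : Monotone 𝒢)
    (hle : ∀ s, 𝒢 s ≤ mΩ) {X : ℕ → Ω → ℝ≥0∞} (hX : ∀ s, 1 ≤ s → Measurable[𝒢 (s + 1)] (X s))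
    (hint : ∀ s, 1 ≤ s → ∀ W : Ω → ℝ≥0∞, Measurable[𝒢 s] W →
      ∫⁻ ω, W ω * X s ω ∂P ≤ ∫⁻ ω, W ω ∂P) (c : ℝ≥0∞) :
    c * P {ω | ∃ t, c ≤ ∏ s ∈ Finset.Icc 1 t, X s ω} ≤ 1 := by
  set M : ℕ → Ω → ℝ≥0∞ := fun t ω => ∏ s ∈ Finset.Icc 1 t, X s ω with hM
  have hMm : ∀ t, Measurable[𝒢 (t + 1)] (M t) := by
    intro t
    refine Finset.measurable_prod _ fun s hs => ?_
    rw [Finset.mem_Icc] at hs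
    exact (hX s hs.1).mono (hmono (by omega)) le_rfl
  set B : ℕ → Set Ω := fun t => {ω | ∃ s ≤ t, c ≤ M s ω} with hB
  have hBm : ∀ t, MeasurableSet[𝒢 (t + 1)] (B t) := by
    intro t
    have : B t = ⋃ s ∈ Set.Iic t, {ω | c ≤ M s ω} := by ext ω; simp [hB]
    rw [this]
    refine MeasurableSet.biUnion (Set.to_countable _) fun s hs => ?_
    exact hmono (Nat.succ_le_succ hs) _ (hMm s measurableSet_Ici)
  -- The product stopped at its first passage above `c`, with the value at passage lowered to `c`:
  -- its total mass does not increase in `t`.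
  have claim : ∀ t, ∫⁻ ω in (B t)ᶜ, M t ω ∂P + c * P (B t) ≤ 1 := by
    intro t
    induction t with
    | zero =>
      by_cases hc : c ≤ 1
      · have : B 0 = Set.univ := by ext ω; simp [hB, hM, hc]
        rw [this]; simpa using hc
      · have : B 0 = ∅ := by ext ω; simp [hB, hM, hc]
        rw [this]; simp [hM]
    | succ t ih =>
      refine le_trans ?_ ih
      have mB : MeasurableSet (B t) := hle _ _ (hBm t)
      have mB' : MeasurableSet (B (t + 1)) := hle _ _ (hBm (t + 1))
      have hsub : B t ⊆ B (t + 1) := fun ω ⟨s, hs, h⟩ => ⟨s, hs.trans (Nat.le_succ t), h⟩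
      set D := B (t + 1) \ B t with hD
      have mD : MeasurableSet D := mB'.diff mB
      have hDge : ∀ ω ∈ D, c ≤ M (t + 1) ω := by
        rintro ω ⟨⟨s, hs, h⟩, h2⟩
        rcases Nat.lt_or_ge s (t + 1) with h3 | h3
        · exact absurd ⟨s, by omega, h⟩ h2
        · have : s = t + 1 := le_antisymm hs h3
          rwa [this] at h
      have hW := hint (t + 1) (by omega) ((B t)ᶜ.indicator (M t))
        ((hMm t).indicator (hBm t).compl)
      have e1 : ∫⁻ ω, (B t)ᶜ.indicator (M t) ω * X (t + 1) ω ∂P =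
          ∫⁻ ω in (B t)ᶜ, M (t + 1) ω ∂P := by
        rw [← lintegral_indicator mB.compl]
        refine lintegral_congr fun ω => ?_
        by_cases hω : ω ∈ (B t)ᶜ
        · rw [Set.indicator_of_mem hω, Set.indicator_of_mem hω]
          simp only [hM]
          rw [Finset.prod_Icc_succ_top (by omega)]
        · rw [Set.indicator_of_notMem hω, Set.indicator_of_notMem hω, zero_mul]
      rw [e1, lintegral_indicator mB.compl] at hW
      have e2 : (B t)ᶜ = (B (t + 1))ᶜ ∪ D := by
        ext ω
        by_cases h1 : ω ∈ B t
        · have := hsub h1; simp [hD, h1, this]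
        · by_cases h2 : ω ∈ B (t + 1) <;> simp [hD, h1, h2]
      have e3 : ∫⁻ ω in (B t)ᶜ, M (t + 1) ω ∂P =
          ∫⁻ ω in (B (t + 1))ᶜ, M (t + 1) ω ∂P + ∫⁻ ω in D, M (t + 1) ω ∂P := by
        rw [e2, lintegral_union mD]
        exact Set.disjoint_left.2 fun ω h1 h2 => h1 h2.1
      have e4 : c * P D ≤ ∫⁻ ω in D, M (t + 1) ω ∂P := by
        rw [← setLIntegral_const]
        exact setLIntegral_mono' mD fun ω hω => hDge ω hω
      have e5 : P (B (t + 1)) ≤ P D + P (B t) := by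
        rw [hD]
        calc P (B (t + 1)) ≤ P ((B (t + 1) \ B t) ∪ B t) := measure_mono (by simp)
          _ ≤ _ := measure_union_le _ _
      calc _ ≤ ∫⁻ ω in (B (t + 1))ᶜ, M (t + 1) ω ∂P + c * (P D + P (B t)) := by gcongr
        _ = ∫⁻ ω in (B (t + 1))ᶜ, M (t + 1) ω ∂P + c * P D + c * P (B t) := by
          rw [mul_add, add_assoc]
        _ ≤ ∫⁻ ω in (B (t + 1))ᶜ, M (t + 1) ω ∂P + ∫⁻ ω in D, M (t + 1) ω ∂P + c * P (B t) := by
          gcongr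
        _ = ∫⁻ ω in (B t)ᶜ, M (t + 1) ω ∂P + c * P (B t) := by rw [e3]
        _ ≤ _ := by gcongr
  have hU : {ω | ∃ t, c ≤ M t ω} = ⋃ t, B t := by
    ext ω
    simp only [Set.mem_ofPred_eq, Set.mem_iUnion, hB]
    exact ⟨fun ⟨t, h⟩ => ⟨t, t, le_rfl, h⟩, fun ⟨_, s, _, h⟩ => ⟨s, h⟩⟩
  have hBmono : Monotone B := fun a b hab ω ⟨s, hs, h⟩ => ⟨s, hs.trans hab, h⟩
  change c * P {ω | ∃ t, c ≤ M t ω} ≤ 1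
  rw [hU, hBmono.measure_iUnion, ENNReal.mul_iSup]
  exact iSup_le fun t => le_add_self.trans (claim t)

/-- The likelihood ratio of two Gaussian laws has integral `1`. -/
lemma lintegral_gaussian_ratio {σ τ : ℝ} (hσ : 0 < σ) (hτ : 0 < τ) (μ : ℝ) :
    ∫⁻ z, ENNReal.ofReal (Real.exp (1 / 2 * ((z ^ 2 - (z - μ) ^ 2 / τ) / σ ^ 2 - Real.log τ)))
      ∂(gaussianReal 0 (σ ^ 2).toNNReal) = 1 := by
  have hv : (σ ^ 2).toNNReal ≠ 0 := by simp [hσ.ne']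
  have hv' : (σ ^ 2 * τ).toNNReal ≠ 0 := by
    have : 0 < σ ^ 2 * τ := by positivity
    simpa using this
  rw [gaussianReal_of_var_ne_zero _ hv,
    lintegral_withDensity_eq_lintegral_mul _ (measurable_gaussianPDF _ _) (by fun_prop),
    ← lintegral_gaussianPDF_eq_one μ hv']
  refine lintegral_congr fun z => ?_
  rw [Pi.mul_apply, gaussianPDF, gaussianPDF, ← ENNReal.ofReal_mul (gaussianPDFReal_nonneg _ _ _)]
  congr 1
  rw [gaussianPDFReal, gaussianPDFReal, Real.coe_toNNReal _ (by positivity),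
    Real.coe_toNNReal _ (by positivity)]
  have e1 : Real.exp (1 / 2 * ((z ^ 2 - (z - μ) ^ 2 / τ) / σ ^ 2 - Real.log τ)) =
      Real.exp (z ^ 2 / (2 * σ ^ 2)) * Real.exp (-(z - μ) ^ 2 / (2 * (σ ^ 2 * τ))) * (√τ)⁻¹ := by
    rw [Real.sqrt_eq_rpow, ← Real.rpow_neg hτ.le, Real.rpow_def_of_pos hτ, ← Real.exp_add,
      ← Real.exp_add]
    congr 1
    field_simp
    ring
  have e2 : √(2 * Real.pi * (σ ^ 2 * τ)) = √(2 * Real.pi * σ ^ 2) * √τ := by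
    rw [← Real.sqrt_mul (by positivity)]; congr 1; ring
  have e3 : Real.exp (-(z - 0) ^ 2 / (2 * σ ^ 2)) * Real.exp (z ^ 2 / (2 * σ ^ 2)) = 1 := by
    rw [← Real.exp_add, ← Real.exp_zero]; congr 1; ring
  rw [e1, e2, mul_inv]
  linear_combination ((√(2 * Real.pi * σ ^ 2))⁻¹ *
    Real.exp (-(z - μ) ^ 2 / (2 * (σ ^ 2 * τ))) * (√τ)⁻¹) * e3

/-- A time-uniform bound on the log-likelihood ratio of a predictable Gaussian model with means `μ`
and variances `σ² τ` against centred Gaussian noise of variance `σ²`. -/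
lemma measure_exists_le_logRatio_le {𝒢 𝒢' : ℕ → MeasurableSpace Ω} (hmono : Monotone 𝒢)
    (hle : ∀ s, 𝒢 s ≤ mΩ) (h𝒢 : ∀ s, 𝒢 s ≤ 𝒢' s) (h𝒢' : ∀ s, 1 ≤ s → 𝒢' s ≤ 𝒢 (s + 1))
    {ξ : ℕ → Ω → ℝ} (hξ : ∀ s, 1 ≤ s → Measurable[𝒢 (s + 1)] (ξ s)) {σ : ℝ} (hσ : 0 < σ)
    (hlaw : ∀ s, 1 ≤ s → ∀ B : Set ℝ, MeasurableSet B →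
      P⟦ξ s ⁻¹' B | 𝒢' s⟧ =ᵐ[P] fun _ => (gaussianReal 0 (σ ^ 2).toNNReal).real B)
    {μ τ : ℕ → Ω → ℝ} (hμ : ∀ s, 1 ≤ s → Measurable[𝒢' s] (μ s))
    (hτ : ∀ s, 1 ≤ s → Measurable[𝒢' s] (τ s)) (hτ0 : ∀ s, 1 ≤ s → ∀ ω, 0 < τ s ω) (x : ℝ) :
    P {ω | ∃ t, 2 * x ≤ ∑ s ∈ Finset.Icc 1 t,
      ((ξ s ω ^ 2 - (ξ s ω - μ s ω) ^ 2 / τ s ω) / σ ^ 2 - Real.log (τ s ω))}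
      ≤ ENNReal.ofReal (Real.exp (-x)) := by
  set ℓ : ℕ → Ω → ℝ := fun s ω =>
    (ξ s ω ^ 2 - (ξ s ω - μ s ω) ^ 2 / τ s ω) / σ ^ 2 - Real.log (τ s ω) with hℓ
  have hXm : ∀ s, 1 ≤ s →
      Measurable[𝒢 (s + 1)] (fun ω => ENNReal.ofReal (Real.exp (1 / 2 * ℓ s ω))) := by
    intro s hs
    have m1 := hξ s hs
    have m2 := (hμ s hs).mono (h𝒢' s hs) le_rfl
    have m3 := (hτ s hs).mono (h𝒢' s hs) le_rfl
    simp only [hℓ]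
    fun_prop
  have hV := mul_measure_exists_le_prod_le (P := P) hmono hle
    (X := fun s ω => ENNReal.ofReal (Real.exp (1 / 2 * ℓ s ω))) hXm ?_
    (ENNReal.ofReal (Real.exp x))
  · have hset : {ω | ∃ t, ENNReal.ofReal (Real.exp x) ≤
        ∏ s ∈ Finset.Icc 1 t, ENNReal.ofReal (Real.exp (1 / 2 * ℓ s ω))} =
        {ω | ∃ t, 2 * x ≤ ∑ s ∈ Finset.Icc 1 t, ℓ s ω} := by
      ext ω
      simp only [Set.mem_ofPred_eq]
      refine exists_congr fun t => ?_
      rw [← ENNReal.ofReal_prod_of_nonneg fun s _ => (Real.exp_pos _).le, ← Real.exp_sum,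
        ENNReal.ofReal_le_ofReal_iff (Real.exp_pos _).le, Real.exp_le_exp, ← Finset.mul_sum]
      constructor <;> intro h <;> linarith
    rw [hset] at hV
    have hx : ENNReal.ofReal (Real.exp x) ≠ 0 := by simp [Real.exp_pos]
    rw [Real.exp_neg, ENNReal.ofReal_inv_of_pos (Real.exp_pos _)]
    rw [mul_comm] at hV
    rw [← one_div]
    exact (ENNReal.le_div_iff_mul_le (Or.inl hx) (Or.inl ENNReal.ofReal_ne_top)).2 hV
  · intro s hs W hW
    have hle' : 𝒢' s ≤ mΩ := (h𝒢' s hs).trans (hle _)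
    have hξm : Measurable (ξ s) := (hξ s hs).mono (hle _) le_rfl
    have hF : @Measurable _ _ ((𝒢' s).prod inferInstance) _ (fun q : Ω × ℝ => W q.1 *
        ENNReal.ofReal (Real.exp (1 / 2 * ((q.2 ^ 2 - (q.2 - μ s q.1) ^ 2 / τ s q.1) / σ ^ 2
          - Real.log (τ s q.1))))) := by
      let _ : MeasurableSpace Ω := 𝒢' s
      have m1 : Measurable W := hW.mono (h𝒢 s) le_rfl
      have m2 : Measurable (μ s) := hμ s hs
      have m3 : Measurable (τ s) := hτ s hs
      fun_prop
    have h1 := lintegral_eq_lintegral_condLaw (mΩ := mΩ) hle' hξm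
      (ν := fun _ => gaussianReal 0 (σ ^ 2).toNNReal) (hlaw s hs) hF
    simp only at h1
    simp only [hℓ]
    rw [h1]
    refine le_of_eq (lintegral_congr fun ω => ?_)
    rw [lintegral_const_mul _ (by fun_prop), lintegral_gaussian_ratio hσ (hτ0 s hs ω), mul_one]

end Probability


/-! ### Time-uniform deviations of the squared norm of the noise -/

section ChiSquare

/-- The right side is `sinh (log u)`. It makes the chi-square exponent rational in the tilting
parameter. -/
lemma log_le_half_sub_inv {u : ℝ} (hu : 1 ≤ u) : Real.log u ≤ (u - u⁻¹) / 2 := by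
  rw [← Real.sinh_log (by linarith)]
  exact Real.self_le_sinh_iff.2 (Real.log_nonneg hu)

lemma add_sq_half_le_neg_log {w : ℝ} (h0 : 0 ≤ w) (h1 : w < 1) :
    w + w ^ 2 / 2 ≤ -Real.log (1 - w) := by
  have h := Real.hasSum_pow_div_log_of_abs_lt_one (abs_lt.2 ⟨by linarith, h1⟩)
  have := sum_le_hasSum (Finset.range 2) (fun i _ => by positivity) h
  simp [Finset.sum_range_succ] at this
  linarith

lemma log_le_add_div {s s₁ : ℝ} (hs : 0 < s) (hs₁ : 0 < s₁) :
    Real.log s ≤ Real.log s₁ - 1 + s / s₁ := by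
  have h := Real.log_le_sub_one_of_pos (div_pos hs hs₁)
  rw [Real.log_div hs.ne' hs₁.ne'] at h
  linarith

lemma log_eight_lt : Real.log 8 < 2.0795 := by
  have : (8 : ℝ) = 2 ^ 3 := by norm_num
  rw [this, Real.log_pow]
  have := Real.log_two_lt_d9
  push_cast; linarith

lemma log_thirtyTwo_lt : Real.log 32 < 3.4658 := by
  have : (32 : ℝ) = 2 ^ 5 := by norm_num
  rw [this, Real.log_pow]
  have := Real.log_two_lt_d9
  push_cast; linarith

/-- The numerical inequality behind the upper deviations; `c` is `√(1 + L)`. -/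
lemma log_mul_le_of_sqrt {s c : ℝ} (hs : 1.414 ≤ s) (hc : 1.84 ≤ c) :
    1.061 * s * (Real.log s - 1) / c + 2 * Real.log s ≤ 1 + 0.0201 * s ^ 2 + 0.734 * s * c := by
  have hs0 : 0 < s := by linarith
  have hc0 : 0 < c := by linarith
  have key : ∀ m, 0 ≤ m → Real.log s - 1 ≤ m →
      1.061 * s * (Real.log s - 1) / c ≤ 0.577 * s * m := by
    intro m hm hle
    rw [div_le_iff₀ hc0]
    have h1 : 1.061 * s * (Real.log s - 1) ≤ 1.061 * s * m := by gcongr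
    have h2 : 0.577 * s * m * 1.84 ≤ 0.577 * s * m * c := by gcongr
    have h3 : 0 ≤ s * m := by positivity
    nlinarith
  have hsc : 0.734 * s * 1.84 ≤ 0.734 * s * c := by gcongr
  rcases le_total s 10 with h | h
  · have h1 := log_le_add_div hs0 (by norm_num : (0 : ℝ) < 8)
    have h2 := log_eight_lt
    have h3 := key (0.0795 + s / 8) (by positivity) (by linarith)
    nlinarith
  · have h1 := log_le_add_div hs0 (by norm_num : (0 : ℝ) < 32)
    have h2 := log_thirtyTwo_lt
    have h3 := key (1.4658 + s / 32) (by positivity) (by linarith)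
    nlinarith

/-- Time `t = s²` lies in a dyadic block starting at `s₀²`, and `b = √x / s₀` is the near-optimal
tilt for the whole block. Without the `1`, the left side is the level which `X t` must exceed for
the exponential inequality to be violated at level `x`; the `1` is reserved for the bias of the
regression. The peeling cost `log s₀` is absorbed by the factor `1.01`. -/
lemma upper_deviation_le {L s s₀ b x : ℝ} (hL : 2.4 ≤ L) (hs₀ : 1.414 ≤ s₀) (h1 : s₀ ≤ s)
    (h2 : s ^ 2 ≤ 2 * s₀ ^ 2) (hx : x = L + Real.log s₀) (hb : b = √x / s₀) :
    x / b + 2 * x + s ^ 2 + s ^ 2 * b + 1 ≤ (1.01 * s + √(2 * (1 + L))) ^ 2 := by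
  have hs0 : 0 < s₀ := by linarith
  have hs : 0 < s := by linarith
  have hlog0 : 0 ≤ Real.log s₀ := Real.log_nonneg (by linarith)
  have hlog : Real.log s₀ ≤ Real.log s := Real.log_le_log hs0 h1
  have hx0 : 0 < x := by linarith
  set c := √(1 + L) with hc
  have hc2 : c ^ 2 = 1 + L := Real.sq_sqrt (by linarith)
  have hc1 : 1.84 ≤ c := Real.le_sqrt_of_sq_le (by norm_num; linarith)
  have hc0 : 0 < c := by linarith
  set r := √x with hr
  have hr2 : r ^ 2 = x := Real.sq_sqrt hx0.le
  have hr0 : 0 < r := Real.sqrt_pos.2 hx0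
  have hxb : x / b = r * s₀ := by rw [hb, ← hr2]; field_simp
  have hrc : r ≤ c + (Real.log s - 1) / (2 * c) := by
    have : (Real.log s - 1) / (2 * c) = (Real.log s - 1 + c ^ 2) / (2 * c) - c / 2 := by
      field_simp; ring
    rw [this, ← sub_le_iff_le_add']
    have h3 : r * (2 * c) ≤ r ^ 2 + c ^ 2 := by nlinarith [sq_nonneg (r - c)]
    have h4 : r ≤ (r ^ 2 + c ^ 2) / (2 * c) := by rw [le_div_iff₀ (by positivity)]; exact h3
    have h5 : (r ^ 2 + c ^ 2) / (2 * c) ≤ (Real.log s - 1 + c ^ 2) / (2 * c) + c / 2 := by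
      have : (Real.log s - 1 + c ^ 2) / (2 * c) + c / 2 =
        (Real.log s - 1 + c ^ 2 + c ^ 2) / (2 * c) := by field_simp
      rw [this]
      gcongr
      rw [hr2, hx, hc2]; linarith
    linarith
  have hw : r * s₀ + s ^ 2 * b ≤ 2.122 * r * s := by
    have e : s ^ 2 * b = r * (s ^ 2 / s₀) := by rw [hb]; field_simp
    rw [e, ← mul_add]
    have : s₀ + s ^ 2 / s₀ ≤ 2.122 * s := by
      rw [← sub_nonneg]
      have e2 : 2.122 * s - (s₀ + s ^ 2 / s₀) = (2.122 * s * s₀ - s₀ ^ 2 - s ^ 2) / s₀ := by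
        field_simp; ring
      rw [e2]
      have h3 : s ≤ 1.4143 * s₀ := by
        refine le_of_sq_le_sq ?_ (by positivity)
        nlinarith [sq_nonneg s₀]
      refine div_nonneg ?_ hs0.le
      have h4 := mul_nonneg (sub_nonneg.2 h1) (sub_nonneg.2 h3)
      have h5 : s₀ ^ 2 ≤ s * s₀ := by rw [sq]; gcongr
      linarith
    calc _ ≤ r * (2.122 * s) := by gcongr
      _ = _ := by ring
  have hnum := log_mul_le_of_sqrt (s := s) (by linarith) hc1
  have hsq2 : 1.4142 ≤ √2 := Real.le_sqrt_of_sq_le (by norm_num)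
  have e1 : √(2 * (1 + L)) = √2 * c := Real.sqrt_mul (by norm_num) _
  have e2 : (√2) ^ 2 = 2 := Real.sq_sqrt (by norm_num)
  have e3 : (1.01 * s + √2 * c) ^ 2 = 1.0201 * s ^ 2 + 2.02 * (√2 * (s * c)) + 2 * c ^ 2 := by
    rw [add_sq, mul_pow √2, e2]; ring
  have h5 : 1.4142 * (s * c) ≤ √2 * (s * c) := by gcongr
  have h6 : 2.122 * r * s ≤ 2.122 * (c + (Real.log s - 1) / (2 * c)) * s := by gcongr
  have h7 : 2.122 * (c + (Real.log s - 1) / (2 * c)) * s =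
      2.122 * (s * c) + 1.061 * s * (Real.log s - 1) / c := by field_simp; ring
  rw [hxb, e1, e3, hc2]
  have h8 : 0 < s * c := by positivity
  have h9 : 0.734 * s * c = 0.734 * (s * c) := by ring
  rw [h9] at hnum
  rw [h7] at h6
  rw [hx]
  linarith

variable {Ω : Type*} {mΩ : MeasurableSpace Ω} {P : Measure Ω} {X : ℕ → Ω → ℝ}

/-- The squared norms `X` satisfy the exponential inequality of sums of squares of independent
standard Gaussian variables, uniformly in time. -/
def ChiSquareBound (P : Measure Ω) (X : ℕ → Ω → ℝ) : Prop :=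
  ∀ τ : ℝ, 0 < τ → ∀ x : ℝ,
    P {ω | ∃ t : ℕ, 2 * x ≤ (1 - 1 / τ) * X t ω - t * Real.log τ} ≤
      ENNReal.ofReal (Real.exp (-x))

/-- Peeling over the blocks `[2^(j+1), 2^(j+2))`, each at level `L + log s₀`: the failure
probabilities are geometric with ratio `r = 1 / √2`, and `r / (1 - r) ≤ 2.42`. -/
lemma ChiSquareBound.measure_upper_le (h : ChiSquareBound P X) {L : ℝ} (hL : 2.4 ≤ L) :
    P {ω | ∃ t : ℕ, 2 ≤ t ∧ (1.01 * √t + √(2 * (1 + L))) ^ 2 < X t ω + 1} ≤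
      ENNReal.ofReal (2.42 * Real.exp (-L)) := by
  set s₀ : ℕ → ℝ := fun j => √((2 : ℝ) ^ (j + 1)) with hs₀
  set x : ℕ → ℝ := fun j => L + Real.log (s₀ j) with hx
  set b : ℕ → ℝ := fun j => √(x j) / s₀ j with hb
  set r : ℝ := 1 / √2 with hr
  have hs₀2 : ∀ j, s₀ j ^ 2 = 2 ^ (j + 1) := fun j => Real.sq_sqrt (by positivity)
  have hs₀1 : ∀ j, 1.414 ≤ s₀ j := by
    intro j
    refine Real.le_sqrt_of_sq_le ?_
    have : (2 : ℝ) ^ 1 ≤ 2 ^ (j + 1) := pow_le_pow_right₀ (by norm_num) (by omega)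
    norm_num at this ⊢; linarith
  have hs₀0 : ∀ j, 0 < s₀ j := fun j => by have := hs₀1 j; linarith
  have hx0 : ∀ j, 0 < x j := by
    intro j
    have := Real.log_nonneg (show (1 : ℝ) ≤ s₀ j by have := hs₀1 j; linarith)
    simp only [hx]; linarith
  have hb0 : ∀ j, 0 < b j := fun j => div_pos (Real.sqrt_pos.2 (hx0 j)) (hs₀0 j)
  have hsub : {ω | ∃ t : ℕ, 2 ≤ t ∧ (1.01 * √t + √(2 * (1 + L))) ^ 2 < X t ω + 1} ⊆
      ⋃ j, {ω | ∃ t : ℕ, 2 * x j ≤ (1 - 1 / (1 + 2 * b j)) * X t ω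
        - t * Real.log (1 + 2 * b j)} := by
    rintro ω ⟨t, ht, hω⟩
    have hlog2 : 1 ≤ Nat.log 2 t := Nat.le_log_of_pow_le (by norm_num) (by simpa using ht)
    obtain ⟨j, hj⟩ : ∃ j, Nat.log 2 t = j + 1 := ⟨Nat.log 2 t - 1, by omega⟩
    have ht1 : 2 ^ (j + 1) ≤ t := by rw [← hj]; exact Nat.pow_log_le_self 2 (by omega)
    have ht2 : t < 2 ^ (j + 1 + 1) := by rw [← hj]; exact Nat.lt_pow_succ_log_self (by norm_num) t
    rw [Set.mem_iUnion]
    refine ⟨j, t, ?_⟩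
    have ht1' : (2 : ℝ) ^ (j + 1) ≤ t := by exact_mod_cast ht1
    have ht2' : (t : ℝ) ≤ 2 * 2 ^ (j + 1) := by
      have : (t : ℝ) ≤ 2 ^ (j + 1 + 1) := by exact_mod_cast ht2.le
      rwa [pow_succ, mul_comm] at this
    have htsq : √(t : ℝ) ^ 2 = t := Real.sq_sqrt (Nat.cast_nonneg t)
    have hnum := upper_deviation_le (L := L) (s := √t) (s₀ := s₀ j) hL (hs₀1 j)
      (Real.sqrt_le_sqrt ht1') (by rw [htsq, hs₀2]; exact ht2') rfl rfl
    change x j / b j + 2 * x j + √t ^ 2 + √t ^ 2 * b j + 1 ≤ _ at hnum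
    rw [htsq] at hnum
    have hX : x j / b j + 2 * x j + t + t * b j < X t ω := by linarith
    have hβ := hb0 j
    have hlog := log_le_half_sub_inv (show 1 ≤ 1 + 2 * b j by linarith)
    have e1 : 1 - 1 / (1 + 2 * b j) = 2 * b j / (1 + 2 * b j) := by field_simp; ring
    have e2 : 2 * b j / (1 + 2 * b j) * (x j / b j + 2 * x j + t + t * b j) =
        2 * x j + t * ((1 + 2 * b j - (1 + 2 * b j)⁻¹) / 2) := by field_simp; ring
    have h3 : 2 * b j / (1 + 2 * b j) * (x j / b j + 2 * x j + t + t * b j) ≤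
        2 * b j / (1 + 2 * b j) * X t ω := by gcongr
    have h4 : (t : ℝ) * Real.log (1 + 2 * b j) ≤
        t * ((1 + 2 * b j - (1 + 2 * b j)⁻¹) / 2) := by gcongr
    rw [e1]; linarith
  have hr0 : 0 ≤ r := by positivity
  have hr1 : r ≤ 0.7072 := by
    rw [hr, div_le_iff₀ (by positivity)]
    have : 1.4142 ≤ √2 := Real.le_sqrt_of_sq_le (by norm_num)
    linarith
  have hterm : ∀ j, Real.exp (-x j) = Real.exp (-L) * r * r ^ j := by
    intro j
    simp only [hx, neg_add, Real.exp_add]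
    rw [Real.exp_neg (Real.log _), Real.exp_log (hs₀0 j), mul_assoc, ← pow_succ', hr, one_div,
      inv_pow]
    simp only [hs₀]
    rw [Real.sqrt_eq_rpow, Real.sqrt_eq_rpow, ← Real.rpow_natCast, ← Real.rpow_natCast,
      ← Real.rpow_mul (by norm_num), ← Real.rpow_mul (by norm_num), mul_comm (1 / 2 : ℝ)]
  have hsum : HasSum (fun j => Real.exp (-x j)) (Real.exp (-L) * r * (1 - r)⁻¹) := by
    simp only [hterm]
    exact (hasSum_geometric_of_lt_one hr0 (by linarith)).mul_left _
  calc _ ≤ P (⋃ j, {ω | ∃ t : ℕ, 2 * x j ≤ (1 - 1 / (1 + 2 * b j)) * X t ω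
        - t * Real.log (1 + 2 * b j)}) := measure_mono hsub
    _ ≤ ∑' j, P {ω | ∃ t : ℕ, 2 * x j ≤ (1 - 1 / (1 + 2 * b j)) * X t ω
        - t * Real.log (1 + 2 * b j)} := measure_iUnion_le _
    _ ≤ ∑' j, ENNReal.ofReal (Real.exp (-x j)) :=
      ENNReal.tsum_le_tsum fun j => h _ (by have := hb0 j; linarith) _
    _ = ENNReal.ofReal (Real.exp (-L) * r * (1 - r)⁻¹) := by
      rw [← ENNReal.ofReal_tsum_of_nonneg (fun j => (Real.exp_pos _).le) hsum.summable, hsum.tsum_eq]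
    _ ≤ _ := by
      refine ENNReal.ofReal_le_ofReal ?_
      have : r * (1 - r)⁻¹ ≤ 2.42 := by
        rw [← div_eq_mul_inv, div_le_iff₀ (by linarith)]; linarith
      calc Real.exp (-L) * r * (1 - r)⁻¹ = r * (1 - r)⁻¹ * Real.exp (-L) := by ring
        _ ≤ _ := by gcongr

/-- The numerical inequality behind the lower deviations. -/
lemma lower_exponent_ge {L s : ℝ} (hL : 2.4 ≤ L) (hs : 0 < s) :
    L + 4 * Real.log s - 4 ≤ (11 / 111 * s + √(1 + L)) ^ 2 := by
  have hc2 : √(1 + L) ^ 2 = 1 + L := Real.sq_sqrt (by linarith)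
  have hc1 : 1.84 ≤ √(1 + L) := Real.le_sqrt_of_sq_le (by norm_num; linarith)
  have h1 := log_le_add_div hs (by norm_num : (0 : ℝ) < 8)
  have h2 := log_eight_lt
  have h3 : s * 1.84 ≤ s * √(1 + L) := by gcongr
  nlinarith [sq_nonneg (s - 7)]

lemma hasSum_inv_mul_succ (m : ℕ) (hm : 0 < m) :
    HasSum (fun i : ℕ => 1 / (((i + m : ℕ) : ℝ) * ((i + m : ℕ) + 1))) (1 / m) := by
  rw [hasSum_iff_tendsto_nat_of_nonneg (fun i => by positivity)]
  have : ∀ n : ℕ, ∑ i ∈ Finset.range n, 1 / (((i + m : ℕ) : ℝ) * ((i + m : ℕ) + 1)) =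
      1 / m - 1 / ((n : ℝ) + m) := by
    intro n
    induction n with
    | zero => simp
    | succ n ih =>
      rw [Finset.sum_range_succ, ih]
      have hm' : (0 : ℝ) < m := by exact_mod_cast hm
      push_cast
      field_simp
      ring
  simp only [this]
  have h0 : Filter.Tendsto (fun n : ℕ => 1 / ((n : ℝ) + m)) Filter.atTop (nhds 0) := by
    have := (tendsto_const_div_atTop_nhds_zero_nat (1 : ℝ)).comp (Filter.tendsto_add_atTop_nat m)
    refine this.congr fun n => ?_
    simp
  simpa using h0.const_sub (1 / (m : ℝ))

/-- The slack `1.11` leaves an exponent growing linearly in `t`, so a plain union bound over `t ≥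
36` works. Each time fails with probability at most `exp (4 - L) / t²`, and `exp 4 / 35 ≤ 1.6`. -/
lemma ChiSquareBound.measure_lower_le (h : ChiSquareBound P X) (hX : ∀ t ω, 0 ≤ X t ω) {L : ℝ}
    (hL : 2.4 ≤ L) :
    P {ω | ∃ t : ℕ, 36 ≤ t ∧ √(X t ω) + √(1 + L) < √t / 1.11} ≤
      ENNReal.ofReal (1.6 * Real.exp (-L)) := by
  have hsub : {ω | ∃ t : ℕ, 36 ≤ t ∧ √(X t ω) + √(1 + L) < √t / 1.11} ⊆
      ⋃ i : ℕ, {ω | √(X (i + 36) ω) + √(1 + L) < √((i + 36 : ℕ) : ℝ) / 1.11} := by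
    rintro ω ⟨t, ht, hω⟩
    rw [Set.mem_iUnion]
    refine ⟨t - 36, ?_⟩
    have : t - 36 + 36 = t := by omega
    rw [this]; exact hω
  have hone : ∀ t : ℕ, 36 ≤ t → P {ω | √(X t ω) + √(1 + L) < √(t : ℝ) / 1.11} ≤
      ENNReal.ofReal (Real.exp (4 - L) / (t : ℝ) ^ 2) := by
    intro t ht
    have ht0 : (0 : ℝ) < t := by exact_mod_cast (by omega : 0 < t)
    set s := √(t : ℝ) with hs
    have hs0 : 0 < s := Real.sqrt_pos.2 ht0
    have hs2 : s ^ 2 = t := Real.sq_sqrt ht0.le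
    set c := √(1 + L) with hc
    have hc0 : 0 < c := Real.sqrt_pos.2 (by linarith)
    set q := s / 1.11 - c with hq
    rcases le_or_gt q 0 with hq0 | hq0
    · have : {ω | √(X t ω) + c < s / 1.11} = ∅ := by
        ext ω
        simp only [Set.mem_ofPred_eq, Set.mem_empty_iff_false, iff_false, not_lt]
        have := Real.sqrt_nonneg (X t ω)
        linarith
      rw [this]; simp
    -- The model variance is `τ = (1 - w)²`, the ratio of the threshold `q²` for `X t` to `t`;
    -- expanding `log (1 - w)` to second order gives the exponent `s² w²`.
    set w := 1 - q / s with hw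
    have hqs : q < s := by
      rw [hq]
      have : s / 1.11 ≤ s := div_le_self hs0.le (by norm_num)
      linarith
    have hw0 : 0 ≤ w := by rw [hw, sub_nonneg, div_le_one hs0]; exact hqs.le
    have hw1 : w < 1 := by rw [hw]; have := div_pos hq0 hs0; linarith
    have hlog := add_sq_half_le_neg_log hw0 hw1
    have hqw : q / s = 1 - w := by rw [hw]; ring
    have hle : P {ω | √(X t ω) + c < s / 1.11} ≤
        ENNReal.ofReal (Real.exp (-(s ^ 2 * w ^ 2))) := by
      refine le_trans (measure_mono ?_) (h ((q / s) ^ 2) (by positivity) (s ^ 2 * w ^ 2))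
      intro ω hω
      refine ⟨t, ?_⟩
      have h1 : √(X t ω) < q := by
        have : √(X t ω) + c < s / 1.11 := hω
        linarith
      have h2 : X t ω ≤ q ^ 2 := by
        rw [← Real.sq_sqrt (hX t ω)]
        have := Real.sqrt_nonneg (X t ω)
        gcongr
      rw [Real.log_pow, hqw]
      have h3 : 1 - 1 / (1 - w) ^ 2 ≤ 0 := by
        rw [sub_nonpos, le_div_iff₀ (by have : 0 < 1 - w := by linarith
                                        positivity)]
        nlinarith
      have h4 : (1 - 1 / (1 - w) ^ 2) * q ^ 2 ≤ (1 - 1 / (1 - w) ^ 2) * X t ω :=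
        mul_le_mul_of_nonpos_left h2 h3
      have h5 : (1 - 1 / (1 - w) ^ 2) * q ^ 2 = s ^ 2 * ((1 - w) ^ 2 - 1) := by
        rw [← hqw]; field_simp
      rw [← hs2]
      push_cast
      have h6 : s ^ 2 * (2 * (w + w ^ 2 / 2)) ≤ s ^ 2 * (2 * -Real.log (1 - w)) := by gcongr
      nlinarith
    refine hle.trans (ENNReal.ofReal_le_ofReal ?_)
    have e1 : s ^ 2 * w ^ 2 = (11 / 111 * s + c) ^ 2 := by
      have : s * w = 11 / 111 * s + c := by rw [hw, hq]; field_simp; ring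
      rw [← mul_pow, this]
    have e2 : Real.exp (4 - L) / (t : ℝ) ^ 2 = Real.exp (4 - L - 4 * Real.log s) := by
      rw [Real.exp_sub _ (4 * Real.log s), ← hs2]
      congr 1
      rw [mul_comm, Real.exp_mul, Real.exp_log hs0]
      norm_cast
      ring
    rw [e2, e1]
    have := lower_exponent_ge hL hs0
    exact Real.exp_le_exp.2 (by linarith)
  have hsum := (hasSum_inv_mul_succ 35 (by norm_num)).mul_left (Real.exp (4 - L))
  calc _ ≤ P (⋃ i : ℕ, {ω | √(X (i + 36) ω) + √(1 + L) < √((i + 36 : ℕ) : ℝ) / 1.11}) :=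
        measure_mono hsub
    _ ≤ ∑' i : ℕ, P {ω | √(X (i + 36) ω) + √(1 + L) < √((i + 36 : ℕ) : ℝ) / 1.11} :=
        measure_iUnion_le _
    _ ≤ ∑' i : ℕ, ENNReal.ofReal (Real.exp (4 - L) *
          (1 / (((i + 35 : ℕ) : ℝ) * ((i + 35 : ℕ) + 1)))) := by
        refine ENNReal.tsum_le_tsum fun i => (hone _ (by omega)).trans
          (ENNReal.ofReal_le_ofReal ?_)
        rw [div_eq_mul_one_div]
        push_cast
        gcongr
        nlinarith
    _ = ENNReal.ofReal (Real.exp (4 - L) * (1 / ((35 : ℕ) : ℝ))) := by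
        rw [← ENNReal.ofReal_tsum_of_nonneg (fun j => by positivity) hsum.summable, hsum.tsum_eq]
    _ ≤ _ := by
      refine ENNReal.ofReal_le_ofReal ?_
      have h1 : Real.exp 4 ≤ 56 := by
        have h2 := Real.exp_one_lt_d9
        have h3 : Real.exp 4 = Real.exp 1 ^ 4 := by rw [← Real.exp_nat_mul]; norm_num
        rw [h3]
        calc Real.exp 1 ^ 4 ≤ 2.72 ^ 4 := by gcongr; linarith
          _ ≤ 56 := by norm_num
      rw [sub_eq_add_neg, Real.exp_add]
      push_cast
      have := Real.exp_pos (-L)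
      nlinarith

end ChiSquare


/-! ### The running bounds on the noise level -/

section NoiseLevel

/-- The only property of `C_t` that is used: the iterated logarithm is nonnegative for `t ≥ 2`,
since `π² log 2 / 6 > 1`. -/
lemma one_add_log_le_cTerm {η : ℝ} (hη : 0 < η) (hη1 : η < 1) {t : ℕ} (ht : 2 ≤ t) :
    1 + Real.log (1 / η) ≤ cTerm η t := by
  have hL : 0 < Real.log (1 / η) := Real.log_pos (by rw [lt_div_iff₀ hη]; linarith)
  have h1 : Real.log (Real.exp 1 / η) = 1 + Real.log (1 / η) := by
    rw [Real.log_div (Real.exp_pos _).ne' hη.ne', Real.log_exp, one_div, Real.log_inv]; ring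
  have h2 : 0.69 ≤ Real.log t := by
    have := Real.log_two_gt_d9
    have : Real.log 2 ≤ Real.log t := Real.log_le_log (by norm_num) (by exact_mod_cast ht)
    linarith
  have h3 : 0 ≤ Real.log (Real.pi ^ 2 * Real.log t / 6) := by
    refine Real.log_nonneg ?_
    have := Real.pi_gt_d2
    have : 9.8 ≤ Real.pi ^ 2 := by nlinarith
    rw [le_div_iff₀ (by norm_num)]
    nlinarith
  rw [cTerm, h1]
  have : 0 ≤ Real.log (Real.pi ^ 2 * Real.log t / 6) / Real.log (1 / η) := by positivity
  nlinarith

/-- A lower bound on a residual norm, combined with the width of the upper estimate. -/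
lemma sqrt_le_of_residual {X s m ν r D : ℝ} (hX : 0 ≤ X) (hs0 : 0 ≤ s) (hs : s ≤ 1.26 * D)
    (hm : 0 ≤ m) (hν : 0 ≤ ν) (hr : 1 ≤ r) (hνr : ν ≤ r) (hD : 1 ≤ D)
    (h : (X - s) ^ 2 ≤ X * (m ^ 2 + 2 * ν * √s)) :
    √X ≤ m + r * √(2 * D) + √(2 * r * ν * √D) := by
  have hq0 : 0 ≤ √(2 * D) := Real.sqrt_nonneg _
  have he0 : 0 ≤ √(2 * r * ν * √D) := Real.sqrt_nonneg _
  have hrq : √(2 * D) ≤ r * √(2 * D) := le_mul_of_one_le_left hq0 hr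
  -- Either the term `√(2 D)` alone dominates `√X`, or the hypothesis can be divided by `X` and the
  -- loss `s / √X` is at most `0.63 √(2 D)`. The remaining `0.37` pays for the factor `1.06` in
  -- front of `e`.
  rcases le_or_gt X (2 * D) with h1 | h1
  · have := Real.sqrt_le_sqrt h1
    linarith
  have hX0 : 0 < X := by linarith
  set χ := √X with hχ
  have hχ0 : 0 < χ := Real.sqrt_pos.2 hX0
  have hχ2 : χ ^ 2 = X := Real.sq_sqrt hX
  have hqχ : √(2 * D) ≤ χ := Real.sqrt_le_sqrt h1.le
  set q := √(2 * D) with hq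
  have hqp : 0 < q := Real.sqrt_pos.2 (by linarith)
  have hq2 : q ^ 2 = 2 * D := Real.sq_sqrt (by linarith)
  set e := √(2 * ν * √D) with he
  have hen : 0 ≤ e := Real.sqrt_nonneg _
  have hDs : 0 ≤ √D := Real.sqrt_nonneg _
  have he2 : e ^ 2 = 2 * ν * √D := Real.sq_sqrt (by positivity)
  have hss : √s ≤ 1.1236 * √D := by
    rw [← Real.sqrt_sq (show (0 : ℝ) ≤ 1.1236 by norm_num), ← Real.sqrt_mul (by norm_num)]
    exact Real.sqrt_le_sqrt (by nlinarith)
  have hχs : χ - s / χ ≤ m + 1.06 * e := by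
    refine le_of_sq_le_sq ?_ (by positivity)
    have e1 : (χ - s / χ) ^ 2 = (X - s) ^ 2 / X := by
      rw [← hχ2]; field_simp
    rw [e1, div_le_iff₀ hX0]
    have h2 : 2 * ν * √s ≤ 1.1236 * e ^ 2 := by
      rw [he2]
      calc 2 * ν * √s ≤ 2 * ν * (1.1236 * √D) := by gcongr
        _ = _ := by ring
    have h3 : m ^ 2 + 2 * ν * √s ≤ (m + 1.06 * e) ^ 2 := by
      have := mul_nonneg hm hen
      nlinarith
    calc _ ≤ X * (m ^ 2 + 2 * ν * √s) := h
      _ ≤ X * (m + 1.06 * e) ^ 2 := by gcongr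
      _ = _ := mul_comm _ _
  have hsχ : s / χ ≤ 0.63 * q := by
    rw [div_le_iff₀ hχ0]
    have : q * q ≤ q * χ := by gcongr
    nlinarith
  have hee : e ≤ √(2 * r * ν * √D) := by
    refine Real.sqrt_le_sqrt ?_
    have : ν * √D ≤ r * (ν * √D) := le_mul_of_one_le_left (by positivity) hr
    linarith
  have heq : e ≤ r * q := by
    refine le_of_sq_le_sq ?_ (by positivity)
    rw [he2, mul_pow, hq2]
    have h4 : √D ≤ D := by
      rw [Real.sqrt_le_left (by linarith)]
      nlinarith
    have h5 : ν ≤ r ^ 2 := by nlinarith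
    calc 2 * ν * √D ≤ 2 * r ^ 2 * D := by gcongr
      _ = _ := by ring
  linarith

variable {𝒳 H : Type*} [NormedAddCommGroup H] [InnerProductSpace ℝ H]
variable {k : 𝒳 → 𝒳 → ℝ} {φ : 𝒳 → H} {x : ℕ → 𝒳} {y ξ : ℕ → ℝ} {f : H}
variable {σ σlow σhigh C η : ℝ}

/-- The noise of a run is well behaved: its quadratic form, at the ideal regularisation, and its
squared norm obey the bounds that hold with high probability. -/
structure GoodNoise (k : 𝒳 → 𝒳 → ℝ) (x : ℕ → 𝒳) (ξ : ℕ → ℝ) (σ C L : ℝ) : Prop where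
  form_le : ∀ t, noiseForm k x ξ (σ ^ 2 / C ^ 2) t ≤
    σ ^ 2 * (2 * L + 2 * infoGain k x (σ ^ 2 / C ^ 2) t)
  sum_le : ∀ t : ℕ, 2 ≤ t →
    (∑ s ∈ Finset.Icc 1 t, ξ s ^ 2) / σ ^ 2 + 1 ≤ (1.01 * √t + √(2 * (1 + L))) ^ 2
  le_sum : ∀ t : ℕ, 36 ≤ t →
    √t / 1.11 ≤ √((∑ s ∈ Finset.Icc 1 t, ξ s ^ 2) / σ ^ 2) + √(1 + L)

/-- Transfer from the ideal regularisation to estimated ones: `S` decreases and `λ S` increases in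
`λ`, so moving `u` below `σ` costs at most `1.11²`; likewise the information gain costs at most
`1.01²`. -/
lemma GoodNoise.form_le_of_le {L : ℝ} (hg : GoodNoise k x ξ σ C L)
    (hk : ∀ a b, k a b = inner ℝ (φ a) (φ b)) (hσ : 0 < σ) (hC : 0 < C) (hL : 0 ≤ L) {u l : ℝ}
    (hu : σ / 1.11 ≤ u) (hl0 : 0 < l) (hl : l ≤ 1.01 * σ) (t : ℕ) :
    noiseForm k x ξ (u ^ 2 / C ^ 2) t ≤
      (1.11 * 1.01 * σ) ^ 2 * (2 * L + 2 * infoGain k x (l ^ 2 / C ^ 2) t) := by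
  have hu0 : 0 < u := lt_of_lt_of_le (by positivity) hu
  have hus : σ ≤ 1.11 * u := by rw [div_le_iff₀ (by norm_num)] at hu; linarith
  have hu' : 0 < u ^ 2 / C ^ 2 := by positivity
  have hs' : 0 < σ ^ 2 / C ^ 2 := by positivity
  have hl' : 0 < l ^ 2 / C ^ 2 := by positivity
  have h1 : noiseForm k x ξ (u ^ 2 / C ^ 2) t ≤ 1.11 ^ 2 * noiseForm k x ξ (σ ^ 2 / C ^ 2) t := by
    have hn := noiseForm_nonneg (x := x) (ξ := ξ) (t := t) hk hs'
    rcases le_total σ u with h | h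
    · have := noiseForm_anti (x := x) (ξ := ξ) (t := t) hk hs'
        (show σ ^ 2 / C ^ 2 ≤ u ^ 2 / C ^ 2 by gcongr)
      linarith
    · have h2 := mul_noiseForm_mono (x := x) (ξ := ξ) (t := t) hk hu'
        (show u ^ 2 / C ^ 2 ≤ σ ^ 2 / C ^ 2 by gcongr)
      have h3 : σ ^ 2 ≤ (1.11 * u) ^ 2 := by gcongr
      have h4 : σ ^ 2 / C ^ 2 ≤ 1.11 ^ 2 * (u ^ 2 / C ^ 2) := by
        rw [← mul_div_assoc]; gcongr; linarith
      have h5 : u ^ 2 / C ^ 2 * noiseForm k x ξ (u ^ 2 / C ^ 2) t ≤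
          u ^ 2 / C ^ 2 * (1.11 ^ 2 * noiseForm k x ξ (σ ^ 2 / C ^ 2) t) := by
        calc _ ≤ _ := h2
          _ ≤ 1.11 ^ 2 * (u ^ 2 / C ^ 2) * noiseForm k x ξ (σ ^ 2 / C ^ 2) t := by gcongr
          _ = _ := by ring
      exact le_of_mul_le_mul_left h5 hu'
  have h2 : infoGain k x (σ ^ 2 / C ^ 2) t ≤ 1.01 ^ 2 * infoGain k x (l ^ 2 / C ^ 2) t := by
    have hn := infoGain_nonneg (x := x) (t := t) hk hl'
    rcases le_total l σ with h | h
    · have := infoGain_anti (x := x) (t := t) hk hl'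
        (show l ^ 2 / C ^ 2 ≤ σ ^ 2 / C ^ 2 by gcongr)
      linarith
    · have h3 := infoGain_le_mul (x := x) (t := t) hk hs'
        (show σ ^ 2 / C ^ 2 ≤ l ^ 2 / C ^ 2 by gcongr)
      refine h3.trans ?_
      gcongr
      rw [div_div_div_cancel_right₀ (by positivity), div_le_iff₀ (by positivity), ← mul_pow]
      gcongr
  calc _ ≤ _ := h1
    _ ≤ 1.11 ^ 2 * (σ ^ 2 * (2 * L + 2 * infoGain k x (σ ^ 2 / C ^ 2) t)) := by
      gcongr; exact hg.form_le t
    _ ≤ 1.11 ^ 2 * (σ ^ 2 * (1.01 ^ 2 * (2 * L) +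
          2 * (1.01 ^ 2 * infoGain k x (l ^ 2 / C ^ 2) t))) :=
      mul_le_mul_of_nonneg_left (mul_le_mul_of_nonneg_left (by linarith) (sq_nonneg σ))
        (by norm_num)
    _ = _ := by ring

/-- The residual norm is at most the noise norm plus the bias `λ ‖f‖²`, and the subtracted
confidence term covers both; the last subtracted term is not needed. -/
lemma GoodNoise.sdLower_le (hg : GoodNoise k x ξ σ C (Real.log (1 / η)))
    (hk : ∀ a b, k a b = inner ℝ (φ a) (φ b)) (hσ : 0 < σ) (hσhigh : σ ≤ σhigh) (hC : 0 < C)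
    (hη : 0 < η) (hη1 : η < 1) (hf : ‖f‖ ≤ C)
    (hy : ∀ s, 1 ≤ s → y s = inner ℝ f (φ (x s)) + ξ s) {u : ℝ} (hu : 0 < u) (huσ : u ≤ σhigh)
    {t : ℕ} (ht : 2 ≤ t) :
    sdLower k x y ‖f‖ σhigh η (u ^ 2 / C ^ 2) t ≤ 1.01 * σ := by
  set L := Real.log (1 / η) with hL
  have hL0 : 0 < L := Real.log_pos (by rw [lt_div_iff₀ hη]; linarith)
  have hct := one_add_log_le_cTerm hη hη1 ht
  have ht0 : (0 : ℝ) < t := by exact_mod_cast (by omega : 0 < t)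
  have hs0 : 0 < √(t : ℝ) := Real.sqrt_pos.2 ht0
  have hsd := mul_sdHat_sq_le (t := t) hk (show 0 < u ^ 2 / C ^ 2 by positivity) (by omega) f hy
  have hN : u ^ 2 / C ^ 2 * ‖f‖ ^ 2 ≤ σhigh ^ 2 := by
    calc _ ≤ u ^ 2 / C ^ 2 * C ^ 2 := by gcongr
      _ = u ^ 2 := by field_simp
      _ ≤ _ := by gcongr
  have hsum := hg.sum_le t ht
  set Q := ∑ s ∈ Finset.Icc 1 t, ξ s ^ 2
  set c := √(2 * (1 + L)) with hc
  have hc0 : 0 ≤ c := Real.sqrt_nonneg _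
  have hc2 : c ^ 2 = 2 * (1 + L) := Real.sq_sqrt (by linarith)
  have hQ : Q + σ ^ 2 ≤ (σ * (1.01 * √t + c)) ^ 2 := by
    have h1 : Q = σ ^ 2 * (Q / σ ^ 2) := by field_simp
    rw [h1, mul_pow]
    calc _ = σ ^ 2 * (Q / σ ^ 2 + 1) := by ring
      _ ≤ _ := by gcongr
  -- The bias is at most `σhigh²`. Of this, `σ²` is the reserve in `hQ`, and the excess is gained by
  -- replacing `σ c` by `σhigh c`, as `c² ≥ 2`.
  have hroot : √t * sdHat k x y (u ^ 2 / C ^ 2) t ≤ 1.01 * σ * √t + σhigh * c := by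
    have hσh : 0 ≤ σhigh := by linarith
    refine le_of_sq_le_sq ?_ (by positivity)
    rw [mul_pow, Real.sq_sqrt ht0.le]
    have h2 : σ * c * √t ≤ σhigh * c * √t := by gcongr
    have h3 : σ ^ 2 ≤ σhigh ^ 2 := by gcongr
    nlinarith
  have hlow : sdHat k x y (u ^ 2 / C ^ 2) t - σhigh * √(2 * cTerm η t / t) ≤ 1.01 * σ := by
    rw [Real.sqrt_div (by linarith)]
    have h4 : c ≤ √(2 * cTerm η t) := Real.sqrt_le_sqrt (by linarith)
    have h5 : sdHat k x y (u ^ 2 / C ^ 2) t ≤ 1.01 * σ + σhigh * (c / √t) := by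
      have : 1.01 * σ + σhigh * (c / √t) = (1.01 * σ * √t + σhigh * c) / √t := by field_simp
      rw [this, le_div_iff₀ hs0]; linarith
    have h6 : σhigh * (c / √t) ≤ σhigh * (√(2 * cTerm η t) / √t) := by
      have : 0 ≤ σhigh := by linarith
      gcongr
    linarith
  rw [sdLower]
  have : 0 ≤ ‖f‖ * √(u ^ 2 / C ^ 2 / t * (1 - 1 / (⨆ s : Fin t, (1 + 1 / (u ^ 2 / C ^ 2) *
    postKernel k x (u ^ 2 / C ^ 2) s (x (s + 1)) (x (s + 1)))))) := by positivity
  linarith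

/-- After scaling by `√t / σ`, the residual bound `sqrt_le_of_residual` controls `√(Q / σ²)` by the
empirical deviation plus confidence terms, and the lower deviations of the noise give `√t / 1.11` up
to `√(1 + L)`. -/
lemma GoodNoise.le_sdUpper (hg : GoodNoise k x ξ σ C (Real.log (1 / η)))
    (hk : ∀ a b, k a b = inner ℝ (φ a) (φ b)) (hσ : 0 < σ) (hσhigh : σ ≤ σhigh) (hC : 0 < C)
    (hη : 0 < η) (hη1 : 2.4 ≤ Real.log (1 / η)) (hη2 : η < 1) (hf : ‖f‖ ≤ C)
    (hy : ∀ s, 1 ≤ s → y s = inner ℝ f (φ (x s)) + ξ s) {u l : ℝ} (hu : σ / 1.11 ≤ u)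
    (huσ : u ≤ σhigh) (hl0 : 0 < l) (hl : l ≤ 1.01 * σ) {t : ℕ} (ht : 2 ≤ t) :
    σ / 1.11 ≤ sdUpper k x y ‖f‖ σhigh η (u ^ 2 / C ^ 2) (l ^ 2 / C ^ 2) t := by
  set L := Real.log (1 / η) with hL
  have hu0 : 0 < u := lt_of_lt_of_le (by positivity) hu
  have hct := one_add_log_le_cTerm hη hη2 ht
  have ht0 : (0 : ℝ) < t := by exact_mod_cast (by omega : 0 < t)
  set s := √(t : ℝ) with hs
  have hs0 : 0 < s := Real.sqrt_pos.2 ht0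
  have hs2 : s ^ 2 = t := Real.sq_sqrt ht0.le
  have hlam : 0 < u ^ 2 / C ^ 2 := by positivity
  have hform := hg.form_le_of_le hk hσ hC (by linarith) hu hl0 hl t
  have hγ := infoGain_nonneg (x := x) (t := t) hk (show 0 < l ^ 2 / C ^ 2 by positivity)
  have hres := le_mul_sdHat_sq (t := t) hk hlam (by omega) f hy
  have hS0 := noiseForm_nonneg (x := x) (ξ := ξ) (t := t) hk hlam
  have hQ0 : 0 ≤ ∑ s ∈ Finset.Icc 1 t, ξ s ^ 2 := Finset.sum_nonneg fun i _ => sq_nonneg _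
  have hleS := hg.le_sum t
  rw [sdUpper, dTerm]
  set D := 2 * Real.log (1 / η) + 2 * infoGain k x (l ^ 2 / C ^ 2) t with hD
  have hDL : 2 * L ≤ D := by linarith
  set Q := ∑ s ∈ Finset.Icc 1 t, ξ s ^ 2
  set S := noiseForm k x ξ (u ^ 2 / C ^ 2) t
  set sd := sdHat k x y (u ^ 2 / C ^ 2) t with hsd
  have hsd0 : 0 ≤ sd := Real.sqrt_nonneg _
  set A := cTerm η t
  set r := σhigh / σ with hr
  have hr1 : 1 ≤ r := (one_le_div hσ).2 hσhigh
  set ν := ‖f‖ * (u / C) / σ with hν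
  have hν0 : 0 ≤ ν := by positivity
  have hνr : ν ≤ r := by
    rw [hν, hr]
    gcongr
    calc ‖f‖ * (u / C) ≤ C * (u / C) := by gcongr
      _ = u := by field_simp
      _ ≤ _ := huσ
  have hmain : √(Q / σ ^ 2) ≤ s * sd / σ + r * √(2 * D) + √(2 * r * ν * √D) := by
    refine sqrt_le_of_residual (s := S / σ ^ 2) (by positivity) (by positivity) ?_ (by positivity)
      hν0 hr1 hνr (by linarith) ?_
    · rw [div_le_iff₀ (by positivity)]
      nlinarith [sq_nonneg σ, mul_nonneg (sq_nonneg σ) (show 0 ≤ D by linarith)]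
    · have e1 : √(u ^ 2 / C ^ 2 * S) = u / C * √S := by
        rw [← div_pow, Real.sqrt_mul (by positivity), Real.sqrt_sq (by positivity)]
      have e2 : √(S / σ ^ 2) = √S / σ := by
        rw [Real.sqrt_div hS0, Real.sqrt_sq hσ.le]
      rw [e1] at hres
      rw [e2, hν]
      have e3 : (Q / σ ^ 2 - S / σ ^ 2) ^ 2 = (Q - S) ^ 2 / σ ^ 4 := by field_simp
      have e4 : Q / σ ^ 2 * ((s * sd / σ) ^ 2 + 2 * (‖f‖ * (u / C) / σ) * (√S / σ)) =
          Q * (t * sd ^ 2 + 2 * ‖f‖ * (u / C * √S)) / σ ^ 4 := by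
        rw [← hs2]; field_simp
      rw [e3, e4]
      gcongr
  have hA : √(1 + L) ≤ √A := Real.sqrt_le_sqrt hct
  have hAD : √(2 * D) ≤ √(A + 2 * D) := Real.sqrt_le_sqrt (by linarith)
  have hfin : s / 1.11 ≤ s * sd / σ + r * (√A + √(A + 2 * D)) + √(2 * r * ν * √D) := by
    have hA0 : 0 ≤ √A := Real.sqrt_nonneg _
    have h1 : √A ≤ r * √A := le_mul_of_one_le_left hA0 hr1
    -- For `t ≤ 35` the confidence terms alone exceed `√t / 1.11`, as `1.84 + 3.6 > 5.34`.
    rcases Nat.lt_or_ge t 36 with h36 | h36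
    · have h2 : 1.84 ≤ √A := Real.le_sqrt_of_sq_le (by norm_num; linarith)
      have h3 : 3.6 ≤ √(A + 2 * D) := Real.le_sqrt_of_sq_le (by norm_num; linarith)
      have h4 : s ≤ 6 := by
        rw [hs, Real.sqrt_le_left (by norm_num)]
        have : (t : ℝ) ≤ 36 := by exact_mod_cast h36.le
        linarith
      have h4' : s ≤ 5.92 := by
        rw [hs, Real.sqrt_le_left (by norm_num)]
        have : (t : ℝ) ≤ 35 := by exact_mod_cast Nat.le_of_lt_succ h36
        linarith
      have h5 : √(A + 2 * D) ≤ r * √(A + 2 * D) :=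
        le_mul_of_one_le_left (Real.sqrt_nonneg _) hr1
      have h6 : 0 ≤ s * sd / σ := by positivity
      have h7 : 0 ≤ √(2 * r * ν * √D) := Real.sqrt_nonneg _
      have h8 : s / 1.11 ≤ 5.34 := by rw [div_le_iff₀ (by norm_num)]; linarith
      linarith
    · have h2 := hleS h36
      have h3 : r * √(2 * D) ≤ r * √(A + 2 * D) := by gcongr
      linarith
  have e1 : √(A / t) = √A / s := Real.sqrt_div (by linarith) _
  have e2 : √((A + 2 * D) / t) = √(A + 2 * D) / s := Real.sqrt_div (by linarith) _
  have e3 : √(2 * σhigh * ‖f‖ * √(u ^ 2 / C ^ 2 * D) / t) = σ * √(2 * r * ν * √D) / s := by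
    have e4 : √(u ^ 2 / C ^ 2 * D) = u / C * √D := by
      rw [← div_pow, Real.sqrt_mul (by positivity), Real.sqrt_sq (by positivity)]
    have hσh : 0 ≤ σhigh := by linarith
    rw [e4, Real.sqrt_div (by positivity), ← hs]
    congr 1
    conv_rhs => rw [← Real.sqrt_sq hσ.le]
    rw [← Real.sqrt_mul (by positivity)]
    congr 1
    rw [hr, hν]; field_simp
  rw [e1, e2, e3]
  have e5 : sd + σhigh * (√A / s + √(A + 2 * D) / s) + σ * √(2 * r * ν * √D) / s =
      σ / s * (s * sd / σ + r * (√A + √(A + 2 * D)) + √(2 * r * ν * √D)) := by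
    rw [hr]; field_simp
  rw [e5]
  calc σ / 1.11 = σ / s * (s / 1.11) := by field_simp
    _ ≤ _ := by gcongr

/-- A joint induction: the regularisation comes from the previous upper bound, and the new upper
bound uses the new lower bound. The constants `1.01` and `1.11` reproduce themselves because the
estimates only assume these relaxed bounds. -/
lemma GoodNoise.sdBounds (hg : GoodNoise k x ξ σ C (Real.log (1 / η)))
    (hk : ∀ a b, k a b = inner ℝ (φ a) (φ b)) (hlow : 0 < σlow) (hlowσ : σlow ≤ σ)
    (hσhigh : σ ≤ σhigh) (hC : 0 < C) (hη : 0 < η) (hη1 : 2.4 ≤ Real.log (1 / η)) (hη2 : η < 1)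
    (hf : ‖f‖ ≤ C) (hy : ∀ s, 1 ≤ s → y s = inner ℝ f (φ (x s)) + ξ s) (t : ℕ) :
    σlow ≤ Tuning.sdMinus ⟨k, ‖f‖, C, σlow, σhigh, η⟩ x y t ∧
    Tuning.sdMinus ⟨k, ‖f‖, C, σlow, σhigh, η⟩ x y t ≤ 1.01 * σ ∧
    σ / 1.11 ≤ Tuning.sdPlus ⟨k, ‖f‖, C, σlow, σhigh, η⟩ x y t ∧
    Tuning.sdPlus ⟨k, ‖f‖, C, σlow, σhigh, η⟩ x y t ≤ σhigh := by
  have hσ : 0 < σ := hlow.trans_le hlowσ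
  have h0 : σlow ≤ σlow ∧ σlow ≤ 1.01 * σ ∧ σ / 1.11 ≤ σhigh ∧ σhigh ≤ σhigh := by
    refine ⟨le_rfl, by linarith, ?_, le_rfl⟩
    rw [div_le_iff₀ (by norm_num)]; linarith
  induction t with
  | zero => exact h0
  | succ t ih =>
    cases t with
    | zero => exact h0
    | succ t =>
      obtain ⟨h1, h2, h3, h4⟩ := ih
      simp only [Tuning.sdMinus, Tuning.sdPlus, Tuning.sdBounds] at h1 h2 h3 h4 ⊢
      set prev := Tuning.sdBounds ⟨k, ‖f‖, C, σlow, σhigh, η⟩ x y (t + 1)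
      have hu0 : 0 < prev.2 := lt_of_lt_of_le (by positivity) h3
      have hlow' := hg.sdLower_le hk hσ hσhigh hC hη hη2 hf hy hu0 h4 (t := t + 2) (by omega)
      have hlo := h1.trans (le_max_right
        (sdLower k x y ‖f‖ σhigh η (prev.2 ^ 2 / C ^ 2) (t + 2)) prev.1)
      have hlo2 := max_le hlow' h2
      refine ⟨hlo, hlo2, le_min ?_ h3, (min_le_right _ _).trans h4⟩
      exact hg.le_sdUpper hk hσ hσhigh hC hη hη1 hη2 hf hy h3 h4 (hlow.trans_le hlo) hlo2
        (by omega)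

/-- The posterior means are within `1.25` posterior widths of the target function. -/
lemma GoodNoise.abs_postMean_sub_le (hg : GoodNoise k x ξ σ C (Real.log (1 / η)))
    (hk : ∀ a b, k a b = inner ℝ (φ a) (φ b)) (hlow : 0 < σlow) (hlowσ : σlow ≤ σ)
    (hσhigh : σ ≤ σhigh) (hC : 0 < C) (hη : 0 < η) (hη1 : 2.4 ≤ Real.log (1 / η)) (hη2 : η < 1)
    (hf : ‖f‖ ≤ C) (hy : ∀ s, 1 ≤ s → y s = inner ℝ f (φ (x s)) + ξ s) (t : ℕ) (z : 𝒳)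
    {p : Tuning 𝒳} (hp : p = ⟨k, ‖f‖, C, σlow, σhigh, η⟩) :
    |postMean k x y (p.reg x y t) (t - 1) z - inner ℝ f (φ z)| ≤
      1.25 * (√(postKernel k x (p.reg x y t) (t - 1) z z / p.reg x y t) * p.confB x y t) := by
  have hσ : 0 < σ := hlow.trans_le hlowσ
  obtain ⟨h1, h2, h3, h4⟩ := hg.sdBounds hk hlow hlowσ hσhigh hC hη hη1 hη2 hf hy (t - 1)
  rw [← hp] at h1 h2 h3 h4
  have hpC : p.C = C := by rw [hp]
  have hpk : p.k = k := by rw [hp]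
  have hpη : p.η = η := by rw [hp]
  rw [Tuning.confB, Tuning.reg, hpC, hpk, hpη]
  set u := p.sdPlus x y (t - 1)
  set l := p.sdMinus x y (t - 1)
  have hu0 : 0 < u := lt_of_lt_of_le (by positivity) h3
  have hl0 : 0 < l := hlow.trans_le h1
  have hform := hg.form_le_of_le hk hσ hC (by linarith) h3 hl0 h2 (t - 1)
  have hγ := infoGain_nonneg (x := x) (t := t - 1) hk (show 0 < l ^ 2 / C ^ 2 by positivity)
  refine (KernelTS.abs_postMean_sub_le hk (by positivity) f hy z).trans ?_
  rw [mul_left_comm 1.25]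
  refine mul_le_mul_of_nonneg_left ?_ (Real.sqrt_nonneg _)
  set D := 2 * Real.log (1 / η) + 2 * infoGain k x (l ^ 2 / C ^ 2) (t - 1)
  have a1 : √(noiseForm k x ξ (u ^ 2 / C ^ 2) (t - 1)) ≤ 1.11 * 1.01 * σ * √D := by
    rw [← Real.sqrt_sq (show 0 ≤ 1.11 * 1.01 * σ by positivity), ← Real.sqrt_mul (by positivity)]
    exact Real.sqrt_le_sqrt hform
  have a2 : √(u ^ 2 / C ^ 2) * ‖f‖ ≤ √(u ^ 2 / C ^ 2) * C := by gcongr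
  -- `σ ≤ 1.11 u` and `1.11² * 1.01 < 1.25`.
  have a3 : 1.11 * 1.01 * σ * √D ≤ 1.25 * (u * √D) := by
    rw [← mul_assoc]
    refine mul_le_mul_of_nonneg_right ?_ (Real.sqrt_nonneg _)
    rw [div_le_iff₀ (by norm_num)] at h3
    nlinarith
  have a4 : 0 ≤ √(u ^ 2 / C ^ 2) * C := by positivity
  linarith

end NoiseLevel


/-! ### Gaussian estimates for one sampled function -/

section Gaussian

lemma gaussianReal_eq_map_std (m : ℝ) {s : ℝ} :
    gaussianReal m (s ^ 2).toNNReal = (gaussianReal 0 1).map (fun u => s * u + m) := by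
  have h : (fun u : ℝ => s * u + m) = (fun u => u + m) ∘ (fun u => s * u) := rfl
  rw [h, ← Measure.map_map (by fun_prop) (by fun_prop), gaussianReal_map_const_mul,
    gaussianReal_map_add_const]
  congr 1
  · simp
  · rw [mul_one]; ext; simp [sq_nonneg]

lemma gaussianReal_Ioi_le (m : ℝ) {s c : ℝ} (hs : 0 ≤ s) (hc : 0 ≤ c) :
    (gaussianReal m (s ^ 2).toNNReal).real (Set.Ioi (m + c * s)) ≤ Real.exp (-(c ^ 2 / 2)) := by
  have hstd : (gaussianReal 0 1).real {u | c ≤ id u} ≤ Real.exp (-(c ^ 2 / 2)) := by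
    have h := measure_ge_le_exp_mul_mgf (μ := gaussianReal 0 1) (X := id) c hc
      (by simpa using integrable_exp_mul_gaussianReal (μ := 0) (v := 1) c)
    rw [mgf_id_gaussianReal] at h
    refine h.trans_eq ?_
    rw [← Real.exp_add]
    congr 1
    simp only [zero_mul, NNReal.coe_one, one_mul, zero_add]
    ring
  rw [gaussianReal_eq_map_std, map_measureReal_apply (by fun_prop) measurableSet_Ioi]
  refine le_trans (measureReal_mono ?_) hstd
  intro u hu
  simp only [Set.mem_preimage, Set.mem_Ioi, Set.mem_ofPred_eq, id] at hu ⊢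
  by_contra hlt
  push Not at hlt
  nlinarith

lemma exp_neg_ge : (0.4577 : ℝ) ≤ Real.exp (-(1.25 ^ 2 / 2)) := by
  have h := Real.exp_bound' (x := 1.25 ^ 2 / 2) (by norm_num) (by norm_num) (n := 8) (by norm_num)
  simp only [Finset.sum_range_succ, Finset.sum_range_zero, Nat.factorial] at h
  rw [Real.exp_neg]
  refine (le_inv_comm₀ (by norm_num) (Real.exp_pos _)).2 (h.trans ?_)
  norm_num

/-- A standard Gaussian variable exceeds `1.25` with probability at least `0.1005`. -/
lemma le_gaussianReal_Ici : 0.1005 ≤ (gaussianReal 0 1).real (Set.Ici 1.25) := by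
  set φ : ℝ → ℝ := fun z => gaussianPDFReal 0 1 z with hφ
  set c : ℝ := (√(2 * Real.pi))⁻¹ with hc
  have hφe : ∀ z, φ z = c * Real.exp (-(z ^ 2 / 2)) := by
    intro z
    simp only [hφ, gaussianPDFReal, hc, NNReal.coe_one, mul_one, sub_zero]
    congr 2; ring
  have hc0 : 0 < c := by positivity
  -- The fraction is the fourth convergent of the continued fraction of the Mills ratio, a lower
  -- bound: `g' = φ (1 - 24 / (z⁴ + 6 z² + 3)²) ≤ φ`. The integral is cut at `8`, where `g` is
  -- negligible.
  set g : ℝ → ℝ := fun z => -(φ z * ((z ^ 3 + 5 * z) / (z ^ 4 + 6 * z ^ 2 + 3))) with hg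
  have hd : ∀ z : ℝ, 0 < z ^ 4 + 6 * z ^ 2 + 3 := fun z => by positivity
  have hderφ : ∀ z, HasDerivAt φ (-z * φ z) z := by
    intro z
    have h1 : HasDerivAt (fun z : ℝ => c * Real.exp (-(z ^ 2 / 2)))
        (c * (Real.exp (-(z ^ 2 / 2)) * (-(2 * z / 2)))) z := by
      have h2 : HasDerivAt (fun z : ℝ => -(z ^ 2 / 2)) (-(2 * z / 2)) z := by
        have := ((hasDerivAt_pow 2 z).div_const 2).neg
        simpa using! this
      exact (h2.exp).const_mul c
    have h3 : φ = fun z : ℝ => c * Real.exp (-(z ^ 2 / 2)) := funext hφe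
    rw [h3]
    convert h1 using 1
    ring
  have hderg : ∀ z, HasDerivAt g (-((-z * φ z) * ((z ^ 3 + 5 * z) / (z ^ 4 + 6 * z ^ 2 + 3)) +
      φ z * (((3 * z ^ 2 + 5) * (z ^ 4 + 6 * z ^ 2 + 3) - (z ^ 3 + 5 * z) * (4 * z ^ 3 + 12 * z))
        / (z ^ 4 + 6 * z ^ 2 + 3) ^ 2))) z := by
    intro z
    have hn : HasDerivAt (fun z : ℝ => z ^ 3 + 5 * z) (3 * z ^ 2 + 5) z := by
      have := (hasDerivAt_pow 3 z).add ((hasDerivAt_id z).const_mul 5)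
      simpa using! this
    have hdd : HasDerivAt (fun z : ℝ => z ^ 4 + 6 * z ^ 2 + 3) (4 * z ^ 3 + 12 * z) z := by
      have := ((hasDerivAt_pow 4 z).add ((hasDerivAt_pow 2 z).const_mul 6)).add_const 3
      refine this.congr_deriv ?_
      norm_num
      ring
    exact ((hderφ z).mul (hn.div hdd (hd z).ne')).neg
  have hder_le : ∀ z, -((-z * φ z) * ((z ^ 3 + 5 * z) / (z ^ 4 + 6 * z ^ 2 + 3)) +
      φ z * (((3 * z ^ 2 + 5) * (z ^ 4 + 6 * z ^ 2 + 3) - (z ^ 3 + 5 * z) * (4 * z ^ 3 + 12 * z))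
        / (z ^ 4 + 6 * z ^ 2 + 3) ^ 2)) ≤ φ z := by
    intro z
    have hφ0 : 0 ≤ φ z := gaussianPDFReal_nonneg _ _ _
    have e : -((-z * φ z) * ((z ^ 3 + 5 * z) / (z ^ 4 + 6 * z ^ 2 + 3)) +
      φ z * (((3 * z ^ 2 + 5) * (z ^ 4 + 6 * z ^ 2 + 3) - (z ^ 3 + 5 * z) * (4 * z ^ 3 + 12 * z))
        / (z ^ 4 + 6 * z ^ 2 + 3) ^ 2)) =
        φ z * (1 - 24 / (z ^ 4 + 6 * z ^ 2 + 3) ^ 2) := by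
      have := (hd z).ne'
      field_simp
      ring
    rw [e]
    refine mul_le_of_le_one_right hφ0 ?_
    have : 0 ≤ 24 / (z ^ 4 + 6 * z ^ 2 + 3) ^ 2 := by positivity
    linarith
  have hcφ : Continuous φ := continuous_iff_continuousAt.2 fun z => (hderφ z).continuousAt
  have hint := intervalIntegral.sub_le_integral_of_hasDeriv_right_of_le (a := 1.25) (b := 8)
    (g := g) (φ := φ) (by norm_num)
    (fun z _ => (hderg z).continuousAt.continuousWithinAt)
    (fun z _ => (hderg z).hasDerivWithinAt)
    (hcφ.continuousOn.integrableOn_compact isCompact_Icc) (fun z _ => hder_le z)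
  have hle : ∫ z in (1.25 : ℝ)..8, φ z ≤ (gaussianReal 0 1).real (Set.Ici 1.25) := by
    rw [measureReal_def, gaussianReal_apply_eq_integral 0 one_ne_zero, ENNReal.toReal_ofReal
      (integral_nonneg fun z => gaussianPDFReal_nonneg _ _ _),
      intervalIntegral.integral_of_le (by norm_num)]
    refine setIntegral_mono_set (integrable_gaussianPDFReal 0 1).integrableOn
      (Filter.Eventually.of_forall fun z => gaussianPDFReal_nonneg _ _ _) ?_
    exact Filter.Eventually.of_forall fun z hz => hz.1.le
  refine le_trans ?_ (hint.trans hle)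
  simp only [hg, hφe]
  have h1 := exp_neg_ge
  have h2 : Real.exp (-(8 ^ 2 / 2)) ≤ 0.00001 := by
    have h3 : (2 : ℝ) ^ 32 ≤ Real.exp (8 ^ 2 / 2) := by
      have : Real.exp (8 ^ 2 / 2) = Real.exp 1 ^ 32 := by rw [← Real.exp_nat_mul]; norm_num
      rw [this]
      gcongr
      have := Real.exp_one_gt_d9
      linarith
    rw [Real.exp_neg]
    calc _ ≤ ((2 : ℝ) ^ 32)⁻¹ := by gcongr
      _ ≤ _ := by norm_num
  have hc1 : 0.39892 ≤ c := by
    rw [hc]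
    refine (le_inv_comm₀ (by norm_num) (by positivity)).2 ?_
    rw [Real.sqrt_le_left (by norm_num)]
    have := Real.pi_lt_d4
    norm_num at this ⊢
    linarith
  have hc2 : c ≤ 1 := by
    rw [hc]
    refine inv_le_one_of_one_le₀ (Real.le_sqrt_of_sq_le ?_)
    have := Real.pi_gt_three
    linarith
  have h4 : c * Real.exp (-(8 ^ 2 / 2)) ≤ 1 * 0.00001 := by gcongr
  have h5 : 0.39892 * 0.4577 ≤ c * Real.exp (-(1.25 ^ 2 / 2)) := by gcongr
  norm_num at h4 h5 ⊢
  linarith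

lemma le_gaussianReal_Ici_of_le {m s b : ℝ} (hs : 0 ≤ s) (hb : b ≤ m + 1.25 * s) :
    0.1005 ≤ (gaussianReal m (s ^ 2).toNNReal).real (Set.Ici b) := by
  refine le_gaussianReal_Ici.trans ?_
  rw [gaussianReal_eq_map_std, map_measureReal_apply (by fun_prop) measurableSet_Ici]
  refine measureReal_mono fun u hu => ?_
  simp only [Set.mem_preimage, Set.mem_Ici] at hu ⊢
  nlinarith

/-- With `w = m - u`, bound `w⁺ = (w + |w|) / 2` and `|w| ≤ (w² / s + s) / 2`, then integrate using
only mean and variance. -/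
lemma integral_posPart_gaussianReal_le (m : ℝ) {s a : ℝ} (hs : 0 ≤ s) (ha : 0 ≤ a) :
    ∫ u, max (m + a - u) 0 ∂(gaussianReal m (s ^ 2).toNNReal) ≤ a + s / 2 := by
  rcases hs.eq_or_lt with rfl | hs
  · simp [ha]
  have hid : Integrable (fun u : ℝ => u) (gaussianReal m (s ^ 2).toNNReal) :=
    (memLp_id_gaussianReal 1).integrable le_rfl
  have hsq : Integrable (fun u : ℝ => (u - m) ^ 2) (gaussianReal m (s ^ 2).toNNReal) :=
    ((memLp_id_gaussianReal 2).sub (memLp_const m)).integrable_sq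
  have hvar : ∫ u, (u - m) ^ 2 ∂(gaussianReal m (s ^ 2).toNNReal) = s ^ 2 := by
    have := variance_fun_id_gaussianReal (μ := m) (v := (s ^ 2).toNNReal)
    rw [variance_eq_integral (by fun_prop)] at this
    rw [integral_id_gaussianReal] at this
    rw [this, Real.coe_toNNReal _ (by positivity)]
  have hpt : ∀ u : ℝ, max (m + a - u) 0 ≤ a + (m - u) / 2 + ((u - m) ^ 2 / s + s) / 4 := by
    intro u
    have h0 : 0 ≤ (m - u) / 2 + ((u - m) ^ 2 / s + s) / 4 := by
      have : (m - u) / 2 + ((u - m) ^ 2 / s + s) / 4 = (u - m - s) ^ 2 / (4 * s) := by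
        field_simp; ring
      rw [this]; positivity
    have h1 : 0 ≤ -(m - u) / 2 + ((u - m) ^ 2 / s + s) / 4 := by
      have : -(m - u) / 2 + ((u - m) ^ 2 / s + s) / 4 = (u - m + s) ^ 2 / (4 * s) := by
        field_simp; ring
      rw [this]; positivity
    exact max_le (by linarith) (by linarith)
  have hi2 : Integrable (fun u : ℝ => a + (m - u) / 2 + ((u - m) ^ 2 / s + s) / 4)
      (gaussianReal m (s ^ 2).toNNReal) :=
    ((integrable_const _).add (((integrable_const m).sub hid).div_const 2)).add
      (((hsq.div_const s).add (integrable_const s)).div_const 4)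
  have hi1 : Integrable (fun u : ℝ => max (m + a - u) 0) (gaussianReal m (s ^ 2).toNNReal) :=
    ((integrable_const (m + a)).sub hid).pos_part
  refine (integral_mono hi1 hi2 hpt).trans_eq ?_
  have hi3 : Integrable (fun u : ℝ => (m - u) / 2) (gaussianReal m (s ^ 2).toNNReal) :=
    ((integrable_const m).sub hid).div_const 2
  have hi4 : Integrable (fun u : ℝ => a + (m - u) / 2) (gaussianReal m (s ^ 2).toNNReal) :=
    (integrable_const _).add hi3
  have hi5 : Integrable (fun u : ℝ => ((u - m) ^ 2 / s + s) / 4)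
      (gaussianReal m (s ^ 2).toNNReal) :=
    ((hsq.div_const s).add (integrable_const s)).div_const 4
  rw [integral_add hi4 hi5, integral_add (integrable_const _) hi3, integral_div,
    integral_sub (integrable_const m) hid, integral_id_gaussianReal, integral_div,
    integral_add (hsq.div_const s) (integrable_const s), integral_div, hvar]
  simp only [integral_const, probReal_univ, one_smul]
  field_simp
  ring

end Gaussian

/-! ### One round of Thompson sampling -/

section OneStep

variable {ι : Type*} [Fintype ι] [Nonempty ι]

/-- The shortfall of the sampled maximum below the optimal value `fstar`, cut at `R`. -/
def shortfall (R fstar : ℝ) (z : EuclideanSpace ℝ ι) : ℝ :=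
  min R (max (fstar - Finset.univ.sup' Finset.univ_nonempty fun i => z i) 0)

/-- The smallest width `min R w` among the maximisers of the sampled function. -/
def playedWidth (R : ℝ) (w : ι → ℝ) (z : EuclideanSpace ℝ ι) : ℝ :=
  open scoped Classical in
  Finset.univ.inf' Finset.univ_nonempty fun i => if ∀ j, z j ≤ z i then min R (w i) else R

lemma measurable_shortfall {R fstar : ℝ} : Measurable (shortfall (ι := ι) R fstar) := by
  unfold shortfall
  have h : Measurable (Finset.univ.sup' Finset.univ_nonempty
      fun (i : ι) (z : EuclideanSpace ℝ ι) => z i) :=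
    Finset.measurable_sup' _ fun i _ => by fun_prop
  have h' : Measurable fun z : EuclideanSpace ℝ ι =>
      Finset.univ.sup' Finset.univ_nonempty fun i => z i := by
    convert h using 1
    ext z
    rw [Finset.sup'_apply]
  fun_prop

lemma measurable_playedWidth {α : Type*} {mα : MeasurableSpace α} {R : ℝ} {w : α → ι → ℝ}
    {z : α → EuclideanSpace ℝ ι} (hw : ∀ i, Measurable fun a => w a i) (hz : Measurable z) :
    Measurable fun a => playedWidth R (w a) (z a) := by
  classical
  unfold playedWidth
  have hzi : ∀ i, Measurable fun a => z a i := fun i => by fun_prop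
  have h : Measurable (Finset.univ.inf' Finset.univ_nonempty
      fun (i : ι) (a : α) => if ∀ j, z a j ≤ z a i then min R (w a i) else R) := by
    refine Finset.inf'_induction _ _ (fun f hf g hg => hf.inf hg) fun i _ => ?_
    refine Measurable.ite ?_ (measurable_const.min (hw i)) measurable_const
    have : {a | ∀ j, z a j ≤ z a i} = ⋂ j, {a | z a j ≤ z a i} := by ext; simp
    rw [this]
    exact MeasurableSet.iInter fun j => measurableSet_le (hzi j) (hzi i)
  convert h using 1
  ext a
  rw [Finset.inf'_apply]

lemma shortfall_nonneg {R fstar : ℝ} (hR : 0 ≤ R) (z : EuclideanSpace ℝ ι) :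
    0 ≤ shortfall R fstar z := le_min hR (le_max_right _ _)

lemma shortfall_le {R fstar : ℝ} (z : EuclideanSpace ℝ ι) : shortfall R fstar z ≤ R :=
  min_le_left _ _

lemma shortfall_le_min {R fstar u : ℝ} (z : EuclideanSpace ℝ ι) (i : ι) (h : fstar ≤ u) :
    shortfall R fstar z ≤ min R (max (u - z i) 0) := by
  have : z i ≤ Finset.univ.sup' Finset.univ_nonempty fun i => z i :=
    Finset.le_sup' (fun i => z i) (Finset.mem_univ i)
  exact min_le_min_left _ (max_le_max_right _ (by linarith))

lemma playedWidth_nonneg {R : ℝ} (hR : 0 ≤ R) {w : ι → ℝ} (hw : ∀ i, 0 ≤ w i)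
    (z : EuclideanSpace ℝ ι) : 0 ≤ playedWidth R w z := by
  refine Finset.le_inf' _ _ fun i _ => ?_
  split_ifs
  exacts [le_min hR (hw i), hR]

lemma playedWidth_le {R : ℝ} (w : ι → ℝ) (z : EuclideanSpace ℝ ι) : playedWidth R w z ≤ R := by
  obtain ⟨i⟩ := ‹Nonempty ι›
  refine (Finset.inf'_le _ (Finset.mem_univ i)).trans ?_
  split_ifs
  exacts [min_le_left _ _, le_rfl]

lemma playedWidth_le_of_forall_le {R : ℝ} (w : ι → ℝ) {z : EuclideanSpace ℝ ι} {i : ι}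
    (hi : ∀ j, z j ≤ z i) : playedWidth R w z ≤ min R (w i) :=
  (Finset.inf'_le _ (Finset.mem_univ i)).trans_eq (if_pos hi)

lemma le_playedWidth {R I : ℝ} {w : ι → ℝ} {z : EuclideanSpace ℝ ι} (hI : I ≤ R)
    (h : ∀ i, (∀ j, z j ≤ z i) → I ≤ w i) : I ≤ playedWidth R w z := by
  refine Finset.le_inf' _ _ fun i _ => ?_
  split_ifs with hi
  exacts [le_min hI (h i hi), hI]

variable {ν : Measure (EuclideanSpace ℝ ι)} [IsProbabilityMeasure ν] {m s f : ι → ℝ}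
  {R c fstar : ℝ}

omit [Nonempty ι] [IsProbabilityMeasure ν] in
/-- The probability that a sampled value exceeds its mean by more than `c` standard deviations. -/
lemma measureReal_exists_lt_le
    (hlaw : ∀ i, ν.map (fun z => z i) = gaussianReal (m i) (s i ^ 2).toNNReal)
    (hs : ∀ i, 0 ≤ s i) (hc : 0 ≤ c) :
    ν.real {z | ∃ i, m i + c * s i < z i} ≤ Fintype.card ι * Real.exp (-(c ^ 2 / 2)) := by
  have h : {z : EuclideanSpace ℝ ι | ∃ i, m i + c * s i < z i} =
      ⋃ i, (fun z => z i) ⁻¹' Set.Ioi (m i + c * s i) := by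
    ext; simp
  rw [h]
  refine (measureReal_iUnion_fintype_le _).trans ?_
  rw [← nsmul_eq_mul, ← Finset.card_univ, ← Finset.sum_const]
  refine Finset.sum_le_sum fun i _ => ?_
  rw [← map_measureReal_apply (by fun_prop) measurableSet_Ioi, hlaw]
  exact gaussianReal_Ioi_le _ (hs i) hc

/-- The expected shortfall of the sampled maximum is at most a multiple of the expected width of
the maximiser. -/
lemma integral_shortfall_le
    (hlaw : ∀ i, ν.map (fun z => z i) = gaussianReal (m i) (s i ^ 2).toNNReal)
    (hs : ∀ i, 0 ≤ s i) (hm : ∀ i, |m i - f i| ≤ 1.25 * s i) (hstar : ∃ i, f i = fstar)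
    (hR : 0 ≤ R) (hc : 0 ≤ c) (hn : Fintype.card ι * Real.exp (-(c ^ 2 / 2)) ≤ 0.0045) :
    0.096 * ∫ z, shortfall R fstar z ∂ν ≤
      ∫ z, playedWidth R (fun i => (c + 1 / 2) * s i) z ∂ν := by
  obtain ⟨i₀, hi₀⟩ := hstar
  set I := ∫ z, shortfall R fstar z ∂ν with hI
  have hw : ∀ i, 0 ≤ (c + 1 / 2) * s i := fun i => mul_nonneg (by linarith) (hs i)
  have hsi : Integrable (shortfall R fstar) ν :=
    Integrable.of_bound measurable_shortfall.aestronglyMeasurable R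
      (Filter.Eventually.of_forall fun z => by
        rw [Real.norm_of_nonneg (shortfall_nonneg hR z)]; exact shortfall_le z)
  have hpm : Measurable fun z : EuclideanSpace ℝ ι =>
      playedWidth R (fun i => (c + 1 / 2) * s i) z :=
    measurable_playedWidth (fun i => measurable_const) measurable_id
  have hpi : Integrable (fun z => playedWidth R (fun i => (c + 1 / 2) * s i) z) ν :=
    Integrable.of_bound hpm.aestronglyMeasurable R
      (Filter.Eventually.of_forall fun z => by
        rw [Real.norm_of_nonneg (playedWidth_nonneg hR hw z)]; exact playedWidth_le _ z)
  have hI0 : 0 ≤ I := integral_nonneg fun z => shortfall_nonneg hR z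
  have hIR : I ≤ R := by
    refine (integral_mono hsi (integrable_const R) shortfall_le).trans_eq ?_
    simp
  -- The sampled maximum is at least the sampled value at `i`, so the shortfall is at most a
  -- one-dimensional Gaussian shortfall below `m i + c * s i`.
  have hIw : ∀ i, fstar ≤ m i + c * s i → I ≤ (c + 1 / 2) * s i := by
    intro i hi
    have hmp : Integrable (fun u : ℝ => max (m i + c * s i - u) 0)
        (ν.map (fun z => z i)) := by
      rw [hlaw]
      exact ((integrable_const _).sub ((memLp_id_gaussianReal 1).integrable le_rfl)).pos_part
    have hmi : Integrable (fun z : EuclideanSpace ℝ ι => max (m i + c * s i - z i) 0) ν :=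
      hmp.comp_measurable (by fun_prop)
    calc I ≤ ∫ z, max (m i + c * s i - z i) 0 ∂ν :=
          integral_mono hsi hmi fun z => (shortfall_le_min z i hi).trans (min_le_right _ _)
      _ = ∫ u, max (m i + c * s i - u) 0 ∂(ν.map (fun z => z i)) :=
          (integral_map (f := fun u : ℝ => max (m i + c * s i - u) 0) (by fun_prop)
            hmp.aestronglyMeasurable).symm
      _ ≤ c * s i + s i / 2 := by
          rw [hlaw]
          exact integral_posPart_gaussianReal_le _ (hs i) (mul_nonneg hc (hs i))
      _ = _ := by ring
  set O : Set (EuclideanSpace ℝ ι) := (fun z => z i₀) ⁻¹' Set.Ici fstar with hO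
  set B : Set (EuclideanSpace ℝ ι) := {z | ∃ i, m i + c * s i < z i} with hB
  have hOm : MeasurableSet O := measurableSet_Ici.preimage (by fun_prop)
  have hBm : MeasurableSet B := by
    have h : B = ⋃ i, (fun z => z i) ⁻¹' Set.Ioi (m i + c * s i) := by ext; simp [hB]
    rw [h]
    exact MeasurableSet.iUnion fun i => measurableSet_Ioi.preimage (by fun_prop)
  have hOν : 0.1005 ≤ ν.real O := by
    rw [hO, ← map_measureReal_apply (by fun_prop) measurableSet_Ici, hlaw]
    refine le_gaussianReal_Ici_of_le (hs i₀) ?_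
    have := (abs_le.1 (hm i₀)).1
    linarith
  have hBν : ν.real B ≤ 0.0045 := (measureReal_exists_lt_le hlaw hs hc).trans hn
  -- `0.1005 - 0.0045`. On `O \ B` every maximiser `i` has `m i + c * s i ≥ fstar`, so `hIw` applies
  -- to it.
  have hOB : 0.096 ≤ ν.real (O \ B) := by
    have h1 := measureReal_sdiff_add_inter (μ := ν) (s := O) hBm
    have h2 : ν.real (O ∩ B) ≤ ν.real B := measureReal_mono Set.inter_subset_right
    linarith
  calc 0.096 * I ≤ ν.real (O \ B) * I := by gcongr
    _ = ∫ z, (O \ B).indicator (fun _ => I) z ∂ν := by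
        rw [integral_indicator_const _ (hOm.diff hBm), smul_eq_mul]
    _ ≤ _ := by
        refine integral_mono ((integrable_const I).indicator (hOm.diff hBm)) hpi fun z => ?_
        by_cases hz : z ∈ O \ B
        · rw [Set.indicator_of_mem hz]
          refine le_playedWidth hIR fun i hi => hIw i ?_
          have h1 : fstar ≤ z i₀ := hz.1
          have h2 : ¬ ∃ i, m i + c * s i < z i := hz.2
          push Not at h2
          exact h1.trans ((hi i₀).trans (h2 i))
        · rw [Set.indicator_of_notMem hz]
          exact playedWidth_nonneg hR hw z

lemma exp_mul_le_one_add {a w : ℝ} (hw : 0 ≤ w) (hw1 : w ≤ 1) :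
    Real.exp (a * w) ≤ 1 + (Real.exp a - 1) * w := by
  have h := convexOn_exp.2 (Set.mem_univ 0) (Set.mem_univ a) (sub_nonneg.2 hw1) hw (by ring)
  simp only [smul_eq_mul, mul_zero, zero_add, Real.exp_zero] at h
  rw [mul_comm a w]
  linarith

/-- The exponential moment that makes the cumulated shortfall comparable to the cumulated width. -/
lemma lintegral_exp_shortfall_le_one
    (hlaw : ∀ i, ν.map (fun z => z i) = gaussianReal (m i) (s i ^ 2).toNNReal)
    (hs : ∀ i, 0 ≤ s i) (hm : ∀ i, |m i - f i| ≤ 1.25 * s i) (hstar : ∃ i, f i = fstar)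
    (hR : 0 < R) (hc : 0 ≤ c) (hn : Fintype.card ι * Real.exp (-(c ^ 2 / 2)) ≤ 0.0045) :
    ∫⁻ z, ENNReal.ofReal (Real.exp ((0.0172 * shortfall R fstar z -
      0.2 * playedWidth R (fun i => (c + 1 / 2) * s i) z) / R)) ∂ν ≤ 1 := by
  have key := integral_shortfall_le hlaw hs hm hstar hR.le hc hn
  set Y : EuclideanSpace ℝ ι → ℝ := playedWidth R (fun i => (c + 1 / 2) * s i) with hY
  set W : EuclideanSpace ℝ ι → ℝ := shortfall R fstar with hW
  have hw : ∀ i, 0 ≤ (c + 1 / 2) * s i := fun i => mul_nonneg (by linarith) (hs i)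
  have hWm : Measurable W := measurable_shortfall
  have hYm : Measurable Y := measurable_playedWidth (fun i => measurable_const) measurable_id
  have hW0 : ∀ z, 0 ≤ W z := shortfall_nonneg hR.le
  have hWR : ∀ z, W z ≤ R := shortfall_le
  have hY0 : ∀ z, 0 ≤ Y z := playedWidth_nonneg hR.le hw
  have hYR : ∀ z, Y z ≤ R := playedWidth_le _
  have hWi : Integrable W ν := Integrable.of_bound hWm.aestronglyMeasurable R
    (Filter.Eventually.of_forall fun z => by rw [Real.norm_of_nonneg (hW0 z)]; exact hWR z)
  have hYi : Integrable Y ν := Integrable.of_bound hYm.aestronglyMeasurable R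
    (Filter.Eventually.of_forall fun z => by rw [Real.norm_of_nonneg (hY0 z)]; exact hYR z)
  have hα : Real.exp 0.0172 - 1 ≤ 0.01735 := by
    have h := Real.exp_bound' (x := 0.0172) (by norm_num) (by norm_num) (n := 3) (by norm_num)
    norm_num [Finset.sum_range_succ, Nat.factorial] at h ⊢
    linarith
  have hα0 : 0 ≤ Real.exp 0.0172 - 1 := by
    have := Real.add_one_le_exp (0.0172 : ℝ)
    linarith
  have hβ : Real.exp (-0.2) ≤ 0.8189 := by
    rw [Real.exp_neg]
    have h := Real.sum_le_exp_of_nonneg (x := 0.2) (by norm_num) 4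
    norm_num [Finset.sum_range_succ, Nat.factorial] at h ⊢
    refine (inv_le_comm₀ (Real.exp_pos _) (by norm_num)).2 (le_trans ?_ h)
    norm_num
  have hpt : ∀ z, Real.exp ((0.0172 * W z - 0.2 * Y z) / R) ≤
      1 + ((Real.exp 0.0172 - 1) * W z - (1 - Real.exp (-0.2)) * Y z) / R := by
    intro z
    have hw0 : 0 ≤ W z / R := div_nonneg (hW0 z) hR.le
    have hw1 : W z / R ≤ 1 := (div_le_one hR).2 (hWR z)
    have hy0 : 0 ≤ Y z / R := div_nonneg (hY0 z) hR.le
    have hy1 : Y z / R ≤ 1 := (div_le_one hR).2 (hYR z)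
    have e : (0.0172 * W z - 0.2 * Y z) / R = 0.0172 * (W z / R) + (-0.2) * (Y z / R) := by ring
    rw [e, Real.exp_add]
    calc _ ≤ (1 + (Real.exp 0.0172 - 1) * (W z / R)) * (1 + (Real.exp (-0.2) - 1) * (Y z / R)) :=
          mul_le_mul (exp_mul_le_one_add hw0 hw1) (exp_mul_le_one_add hy0 hy1) (Real.exp_pos _).le
            (by positivity)
      _ ≤ _ := by
          have : 0 ≤ (Real.exp 0.0172 - 1) * (W z / R) * ((1 - Real.exp (-0.2)) * (Y z / R)) :=
            mul_nonneg (by positivity) (mul_nonneg (by linarith) hy0)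
          rw [sub_div, mul_div_assoc, mul_div_assoc]
          linarith
  have hri : Integrable (fun z => 1 + ((Real.exp 0.0172 - 1) * W z -
      (1 - Real.exp (-0.2)) * Y z) / R) ν :=
    (integrable_const 1).add (((hWi.const_mul _).sub (hYi.const_mul _)).div_const R)
  calc _ ≤ ∫⁻ z, ENNReal.ofReal (1 + ((Real.exp 0.0172 - 1) * W z -
        (1 - Real.exp (-0.2)) * Y z) / R) ∂ν :=
        lintegral_mono fun z => ENNReal.ofReal_le_ofReal (hpt z)
    _ = ENNReal.ofReal (∫ z, (1 + ((Real.exp 0.0172 - 1) * W z -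
        (1 - Real.exp (-0.2)) * Y z) / R) ∂ν) :=
        (ofReal_integral_eq_lintegral_ofReal hri (Filter.Eventually.of_forall fun z =>
          (Real.exp_pos _).le.trans (hpt z))).symm
    _ ≤ ENNReal.ofReal 1 := by
        refine ENNReal.ofReal_le_ofReal ?_
        have hi : Integrable (fun z => ((Real.exp 0.0172 - 1) * W z -
            (1 - Real.exp (-0.2)) * Y z) / R) ν :=
          ((hWi.const_mul _).sub (hYi.const_mul _)).div_const R
        rw [integral_add (integrable_const 1) hi, integral_div,
          integral_sub (hWi.const_mul _) (hYi.const_mul _), integral_const_mul,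
          integral_const_mul]
        simp only [integral_const, probReal_univ, one_smul]
        have hEW : 0 ≤ ∫ z, W z ∂ν := integral_nonneg hW0
        have hEY : 0 ≤ ∫ z, Y z ∂ν := integral_nonneg hY0
        -- The rates `0.0172` and `0.2` are chosen so that `0.01735 ≤ 0.1811 * 0.096`.
        have : ((Real.exp 0.0172 - 1) * ∫ z, W z ∂ν) - (1 - Real.exp (-0.2)) * ∫ z, Y z ∂ν ≤ 0 := by
          nlinarith
        have := div_nonpos_of_nonpos_of_nonneg this hR.le
        linarith
    _ = 1 := ENNReal.ofReal_one

end OneStep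


/-! ### Measurability of the statistics of a run -/

section Measurability

variable {Ω : Type*} {m : MeasurableSpace Ω}

/-- Points played range over finitely many arms with the discrete σ-algebra, so random arms can be
substituted without any regularity of the kernel. -/
lemma measurable_apply_of_countable {α β : Type*} {mβ : MeasurableSpace β} [Countable α]
    {F : α → Ω → β} (hF : ∀ a, Measurable (F a)) {X : Ω → α} (hX : Measurable[m, ⊤] X) :
    Measurable fun ω => F (X ω) ω := by
  intro B hB
  have h : (fun ω => F (X ω) ω) ⁻¹' B = ⋃ a, X ⁻¹' {a} ∩ F a ⁻¹' B := by
    ext ω; simp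
  rw [h]
  exact MeasurableSet.iUnion fun a => (hX trivial).inter (hF a hB)

lemma measurable_det {ι : Type*} [Fintype ι] [DecidableEq ι] {A : Ω → Matrix ι ι ℝ}
    (hA : ∀ i j, Measurable fun ω => A ω i j) : Measurable fun ω => (A ω).det := by
  simp only [Matrix.det_apply]
  exact Finset.measurable_fun_sum _ fun σ _ =>
    (Finset.measurable_fun_prod _ fun i _ => hA _ _).const_smul _

lemma measurable_inv_apply {ι : Type*} [Fintype ι] [DecidableEq ι] {A : Ω → Matrix ι ι ℝ}
    (hA : ∀ i j, Measurable fun ω => A ω i j) (i j : ι) : Measurable fun ω => (A ω)⁻¹ i j := by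
  simp only [Matrix.inv_def, Ring.inverse_eq_inv', Matrix.smul_apply, smul_eq_mul,
    Matrix.adjugate_apply]
  refine (measurable_det hA).inv.mul (measurable_det fun a b => ?_)
  by_cases h : a = j
  · subst h; simp
  · simpa [Matrix.updateRow_ne h] using hA a b

variable {𝒳 : Type*} {arms : Finset 𝒳} {k : 𝒳 → 𝒳 → ℝ} {x : ℕ → Ω → arms} {y : ℕ → Ω → ℝ}
  {lam : Ω → ℝ} {t : ℕ}

lemma measurable_gram_add_inv (hx : ∀ s, 1 ≤ s → s ≤ t → Measurable[m, ⊤] (x s))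
    (hlam : Measurable lam) (i j : Fin t) :
    Measurable fun ω => (gram k (fun s => (x s ω : 𝒳)) t +
      lam ω • (1 : Matrix (Fin t) (Fin t) ℝ))⁻¹ i j := by
  refine measurable_inv_apply (fun i j => ?_) i j
  simp only [Matrix.add_apply, Matrix.smul_apply, smul_eq_mul, gram, Matrix.of_apply]
  refine Measurable.add ?_ (hlam.mul_const _)
  exact measurable_apply_of_countable (F := fun (a : arms) ω => k a (x (j + 1) ω))
    (fun a => measurable_apply_of_countable (F := fun (b : arms) _ => k a b)
      (fun b => measurable_const) (hx (j + 1) (by omega) (by omega)))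
    (hx (i + 1) (by omega) (by omega))

lemma measurable_kvec (hx : ∀ s, 1 ≤ s → s ≤ t → Measurable[m, ⊤] (x s)) (z : 𝒳) (i : Fin t) :
    Measurable fun ω => kvec k (fun s => (x s ω : 𝒳)) t z i :=
  measurable_apply_of_countable (F := fun (b : arms) _ => k z b) (fun b => measurable_const)
    (hx (i + 1) (by omega) (by omega))

lemma measurable_postMean (hx : ∀ s, 1 ≤ s → s ≤ t → Measurable[m, ⊤] (x s))
    (hy : ∀ s, 1 ≤ s → s ≤ t → Measurable (y s)) (hlam : Measurable lam) (z : 𝒳) :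
    Measurable fun ω => postMean k (fun s => (x s ω : 𝒳)) (fun s => y s ω) (lam ω) t z := by
  simp only [postMean, dotProduct, Matrix.mulVec]
  refine Finset.measurable_fun_sum _ fun i _ => (measurable_kvec hx z i).mul
    (Finset.measurable_fun_sum _ fun j _ => (measurable_gram_add_inv hx hlam i j).mul ?_)
  exact hy _ (by omega) (by omega)

lemma measurable_postKernel (hx : ∀ s, 1 ≤ s → s ≤ t → Measurable[m, ⊤] (x s))
    (hlam : Measurable lam) (z z' : 𝒳) :
    Measurable fun ω => postKernel k (fun s => (x s ω : 𝒳)) (lam ω) t z z' := by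
  simp only [postKernel, dotProduct, Matrix.mulVec]
  exact measurable_const.sub (Finset.measurable_fun_sum _ fun i _ => (measurable_kvec hx z i).mul
    (Finset.measurable_fun_sum _ fun j _ => (measurable_gram_add_inv hx hlam i j).mul
      (measurable_kvec hx z' j)))

lemma measurable_postMean_apply (hx : ∀ s, 1 ≤ s → s ≤ t → Measurable[m, ⊤] (x s))
    (hy : ∀ s, 1 ≤ s → s ≤ t → Measurable (y s)) (hlam : Measurable lam) {X : Ω → arms}
    (hX : Measurable[m, ⊤] X) :
    Measurable fun ω => postMean k (fun s => (x s ω : 𝒳)) (fun s => y s ω) (lam ω) t (X ω) :=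
  measurable_apply_of_countable (F := fun (a : arms) ω =>
    postMean k (fun s => (x s ω : 𝒳)) (fun s => y s ω) (lam ω) t a)
    (fun a => measurable_postMean hx hy hlam a) hX

lemma measurable_postKernel_apply (hx : ∀ s, 1 ≤ s → s ≤ t → Measurable[m, ⊤] (x s))
    (hlam : Measurable lam) {X : Ω → arms} (hX : Measurable[m, ⊤] X) :
    Measurable fun ω => postKernel k (fun s => (x s ω : 𝒳)) (lam ω) t (X ω) (X ω) :=
  measurable_apply_of_countable (F := fun (a : arms) ω =>
    postKernel k (fun s => (x s ω : 𝒳)) (lam ω) t a a)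
    (fun a => measurable_postKernel hx hlam a a) hX

lemma measurable_infoGain (hx : ∀ s, 1 ≤ s → s ≤ t → Measurable[m, ⊤] (x s))
    (hlam : Measurable lam) :
    Measurable fun ω => infoGain k (fun s => (x s ω : 𝒳)) (lam ω) t := by
  unfold infoGain
  refine (Finset.measurable_fun_sum _ fun s hs => ?_).const_mul _
  rw [Finset.mem_Icc] at hs
  have := measurable_postKernel_apply (k := k) (t := s - 1)
    (fun r h1 h2 => hx r h1 (by omega)) hlam (hx s hs.1 hs.2)
  fun_prop

lemma measurable_sdHat (hx : ∀ s, 1 ≤ s → s ≤ t → Measurable[m, ⊤] (x s))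
    (hy : ∀ s, 1 ≤ s → s ≤ t → Measurable (y s)) (hlam : Measurable lam) :
    Measurable fun ω => sdHat k (fun s => (x s ω : 𝒳)) (fun s => y s ω) (lam ω) t := by
  unfold sdHat
  refine ((Finset.measurable_fun_sum _ fun s hs => ?_).const_mul _).sqrt
  rw [Finset.mem_Icc] at hs
  exact ((hy s hs.1 hs.2).sub
    (measurable_postMean_apply hx hy hlam (hx s hs.1 hs.2))).pow_const 2

lemma measurable_sdUpper {N σhigh η : ℝ} {lamLow : Ω → ℝ}
    (hx : ∀ s, 1 ≤ s → s ≤ t → Measurable[m, ⊤] (x s))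
    (hy : ∀ s, 1 ≤ s → s ≤ t → Measurable (y s)) (hlam : Measurable lam)
    (hlamLow : Measurable lamLow) :
    Measurable fun ω => sdUpper k (fun s => (x s ω : 𝒳)) (fun s => y s ω) N σhigh η (lam ω)
      (lamLow ω) t := by
  have h1 := measurable_sdHat (k := k) hx hy hlam
  have h2 := measurable_infoGain (k := k) hx hlamLow
  unfold sdUpper dTerm
  fun_prop

lemma measurable_sdLower {N σhigh η : ℝ} (hx : ∀ s, 1 ≤ s → s ≤ t → Measurable[m, ⊤] (x s))
    (hy : ∀ s, 1 ≤ s → s ≤ t → Measurable (y s)) (hlam : Measurable lam) :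
    Measurable fun ω => sdLower k (fun s => (x s ω : 𝒳)) (fun s => y s ω) N σhigh η (lam ω) t := by
  have h1 := measurable_sdHat (k := k) hx hy hlam
  have h2 : Measurable fun ω => ⨆ s : Fin t, (1 + 1 / lam ω *
      postKernel k (fun s => (x s ω : 𝒳)) (lam ω) s (x (s + 1) ω) (x (s + 1) ω)) := by
    refine Measurable.iSup fun s => ?_
    have := measurable_postKernel_apply (k := k) (t := s)
      (fun r h1 h2 => hx r h1 (by omega)) hlam (hx (s + 1) (by omega) (by omega))
    fun_prop
  unfold sdLower
  fun_prop

variable {p : Tuning 𝒳}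

lemma measurable_sdBounds (hx : ∀ s, 1 ≤ s → s ≤ t → Measurable[m, ⊤] (x s))
    (hy : ∀ s, 1 ≤ s → s ≤ t → Measurable (y s)) :
    Measurable fun ω => p.sdBounds (fun s => (x s ω : 𝒳)) (fun s => y s ω) t := by
  induction t with
  | zero => exact measurable_const
  | succ t ih =>
    cases t with
    | zero => exact measurable_const
    | succ t =>
      have h := ih (fun s h1 h2 => hx s h1 (by omega)) fun s h1 h2 => hy s h1 (by omega)
      have hlam : Measurable fun ω =>
          (p.sdBounds (fun s => (x s ω : 𝒳)) (fun s => y s ω) (t + 1)).2 ^ 2 / p.C ^ 2 :=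
        (h.snd.pow_const 2).div_const _
      have hl := (measurable_sdLower (k := p.k) (N := p.fnorm) (σhigh := p.σhigh) (η := p.η)
        hx hy hlam).max h.fst
      exact hl.prodMk ((measurable_sdUpper (k := p.k) (N := p.fnorm) (σhigh := p.σhigh)
        (η := p.η) hx hy hlam ((hl.pow_const 2).div_const _)).min h.snd)

/-- Only the rounds up to `t - 1` enter, so the regularisation of round `t` is measurable with
respect to its past. -/
lemma measurable_reg (hx : ∀ s, 1 ≤ s → s ≤ t - 1 → Measurable[m, ⊤] (x s))
    (hy : ∀ s, 1 ≤ s → s ≤ t - 1 → Measurable (y s)) :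
    Measurable fun ω => p.reg (fun s => (x s ω : 𝒳)) (fun s => y s ω) t :=
  ((measurable_sdBounds hx hy).snd.pow_const 2).div_const _

lemma measurable_confB (hx : ∀ s, 1 ≤ s → s ≤ t - 1 → Measurable[m, ⊤] (x s))
    (hy : ∀ s, 1 ≤ s → s ≤ t - 1 → Measurable (y s)) :
    Measurable fun ω => p.confB (fun s => (x s ω : 𝒳)) (fun s => y s ω) t := by
  have h1 := measurable_reg (p := p) hx hy
  have h2 := measurable_sdBounds (p := p) hx hy
  have h3 := measurable_infoGain (k := p.k) hx ((h2.fst.pow_const 2).div_const (p.C ^ 2))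
  have h4 := h2.snd
  unfold Tuning.confB Tuning.sdPlus Tuning.sdMinus
  fun_prop

end Measurability

/-! ### The filtration of a run -/

section Filtration

variable {𝒳 Ω : Type*} {arms : Finset 𝒳} {ftilde : ℕ → Ω → EuclideanSpace ℝ arms}
  {x : ℕ → Ω → arms} {y : ℕ → Ω → ℝ} {s t : ℕ}

lemma past_mono : Monotone (past ftilde x y) := fun _ _ h =>
  biSup_mono fun s hs => by
    rw [Finset.mem_Ico] at hs ⊢
    omega

lemma round_le_past (hs : 1 ≤ s) (hst : s < t) :
    MeasurableSpace.comap (ftilde s) inferInstance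
      ⊔ MeasurableSpace.comap (x s) ⊤ ⊔ MeasurableSpace.comap (y s) inferInstance
      ≤ past ftilde x y t :=
  le_iSup₂_of_le (f := fun s (_ : s ∈ Finset.Ico 1 t) =>
    MeasurableSpace.comap (ftilde s) inferInstance
      ⊔ MeasurableSpace.comap (x s) ⊤ ⊔ MeasurableSpace.comap (y s) inferInstance)
    s (Finset.mem_Ico.2 ⟨hs, hst⟩) le_rfl

lemma measurable_past_ftilde (hs : 1 ≤ s) (hst : s < t) :
    Measurable[past ftilde x y t] (ftilde s) :=
  Measurable.of_comap_le ((le_sup_left.trans le_sup_left).trans (round_le_past hs hst))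

lemma measurable_past_x (hs : 1 ≤ s) (hst : s < t) : Measurable[past ftilde x y t, ⊤] (x s) :=
  Measurable.of_comap_le ((le_sup_right.trans le_sup_left).trans (round_le_past hs hst))

lemma measurable_past_y (hs : 1 ≤ s) (hst : s < t) : Measurable[past ftilde x y t] (y s) :=
  Measurable.of_comap_le (le_sup_right.trans (round_le_past hs hst))

lemma past_le_pastAndPlay : past ftilde x y t ≤ pastAndPlay ftilde x y t :=
  le_sup_left.trans le_sup_left

lemma measurable_pastAndPlay_x : Measurable[pastAndPlay ftilde x y t, ⊤] (x t) :=
  Measurable.of_comap_le le_sup_right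

lemma pastAndPlay_le_past (ht : 1 ≤ t) : pastAndPlay ftilde x y t ≤ past ftilde x y (t + 1) :=
  sup_le (sup_le (past_mono (Nat.le_succ t))
    (measurable_past_ftilde ht (Nat.lt_succ_self t)).comap_le)
    (measurable_past_x ht (Nat.lt_succ_self t)).comap_le

variable [DecidableEq 𝒳] {mΩ : MeasurableSpace Ω} {P : Measure Ω} {p : Tuning 𝒳} {f : 𝒳 → ℝ}
  {σ : ℝ}

lemma IsRun.past_le (h : IsRun P p f σ ftilde x y) (t : ℕ) : past ftilde x y t ≤ mΩ :=
  iSup₂_le fun s _ => sup_le (sup_le (h.measurable_ftilde s).comap_le (h.measurable_x s).comap_le)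
    (h.measurable_y s).comap_le

end Filtration


open scoped ENNReal

/-! ### Conditional estimates for one round -/

section Round

variable {ι : Type*} [Fintype ι] [Nonempty ι]

lemma measurable_roundFactor {Ω : Type*} {m : MeasurableSpace Ω} {A : Set Ω}
    (hA : MeasurableSet A) {w : Ω → ι → ℝ} (hw : ∀ i, Measurable fun ω => w ω i) {W : Ω → ℝ≥0∞}
    (hW : Measurable W) (R fstar : ℝ) :
    Measurable fun q : Ω × EuclideanSpace ℝ ι => W q.1 * (open scoped Classical in
      if q.1 ∈ A then ENNReal.ofReal (Real.exp ((0.0172 * shortfall R fstar q.2 -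
        0.2 * playedWidth R (w q.1) q.2) / R)) else 1) := by
  refine (hW.comp measurable_fst).mul (Measurable.ite (measurable_fst hA) ?_ measurable_const)
  have h1 : Measurable fun q : Ω × EuclideanSpace ℝ ι => playedWidth R (w q.1) q.2 :=
    measurable_playedWidth (w := fun q : Ω × EuclideanSpace ℝ ι => w q.1)
      (fun i => (hw i).comp measurable_fst) measurable_snd
  have h2 : Measurable fun q : Ω × EuclideanSpace ℝ ι => shortfall R fstar q.2 :=
    measurable_shortfall.comp measurable_snd
  fun_prop

omit [Nonempty ι] in
lemma measurableSet_exceed {Ω : Type*} {m : MeasurableSpace Ω} {A : Set Ω} (hA : MeasurableSet A)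
    {u : Ω → ι → ℝ} (hu : ∀ i, Measurable fun ω => u ω i) :
    MeasurableSet {q : Ω × EuclideanSpace ℝ ι | q.1 ∈ A ∧ ∃ i, u q.1 i < q.2 i} := by
  have h : {q : Ω × EuclideanSpace ℝ ι | q.1 ∈ A ∧ ∃ i, u q.1 i < q.2 i} =
      Prod.fst ⁻¹' A ∩ ⋃ i, {q : Ω × EuclideanSpace ℝ ι | u q.1 i < q.2 i} := by
    ext; simp
  rw [h]
  refine (measurable_fst hA).inter (MeasurableSet.iUnion fun i => ?_)
  exact measurableSet_lt ((hu i).comp measurable_fst) (by fun_prop)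

variable {Ω : Type*} {mΩ : MeasurableSpace Ω} {P : Measure Ω} [IsProbabilityMeasure P]
  {G : MeasurableSpace Ω} {Z : Ω → EuclideanSpace ℝ ι} {ν : Ω → Measure (EuclideanSpace ℝ ι)}
  [∀ ω, IsProbabilityMeasure (ν ω)] {A : Set Ω} {m s : Ω → ι → ℝ} {f : ι → ℝ} {R c fstar : ℝ}

/-- The one-round moment bound conditionally on the past `G`. Outside the `G`-measurable event `A`,
where the estimates may be unreliable, the factor is `1`, so the product remains a supermartingale.
-/
lemma lintegral_mul_roundFactor_le (hG : G ≤ mΩ) (hZ : Measurable[mΩ] Z)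
    (h : ∀ s, MeasurableSet s → P⟦Z ⁻¹' s | G⟧ =ᵐ[P] fun ω => (ν ω).real s)
    (hA : MeasurableSet[G] A) (hsm : ∀ i, Measurable[G] fun ω => s ω i)
    (hlaw : ∀ ω ∈ A, ∀ i, (ν ω).map (fun z => z i) = gaussianReal (m ω i) (s ω i ^ 2).toNNReal)
    (hs : ∀ ω ∈ A, ∀ i, 0 ≤ s ω i) (hm : ∀ ω ∈ A, ∀ i, |m ω i - f i| ≤ 1.25 * s ω i)
    (hstar : ∃ i, f i = fstar) (hR : 0 < R) (hc : 0 ≤ c)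
    (hn : Fintype.card ι * Real.exp (-(c ^ 2 / 2)) ≤ 0.0045) {W : Ω → ℝ≥0∞}
    (hW : Measurable[G] W) :
    ∫⁻ ω, W ω * (open scoped Classical in
      if ω ∈ A then ENNReal.ofReal (Real.exp ((0.0172 * shortfall R fstar (Z ω) -
        0.2 * playedWidth R (fun i => (c + 1 / 2) * s ω i) (Z ω)) / R)) else 1) ∂P
      ≤ ∫⁻ ω, W ω ∂P := by
  classical
  have hF := measurable_roundFactor hA (w := fun ω i => (c + 1 / 2) * s ω i)
    (fun i => (hsm i).const_mul _) hW R fstar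
  have key := lintegral_eq_lintegral_condLaw hG hZ h hF
  refine (key.trans_le ?_)
  refine lintegral_mono fun ω => ?_
  by_cases hω : ω ∈ A
  · simp only [hω, if_true]
    have hm2 : Measurable fun z : EuclideanSpace ℝ ι =>
        playedWidth R (fun i => (c + 1 / 2) * s ω i) z :=
      measurable_playedWidth (fun i => measurable_const) measurable_id
    have hm1 : Measurable fun z : EuclideanSpace ℝ ι => shortfall R fstar z := measurable_shortfall
    rw [lintegral_const_mul _ (by fun_prop)]
    exact mul_le_of_le_one_right' (lintegral_exp_shortfall_le_one (hlaw ω hω) (hs ω hω) (hm ω hω)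
      hstar hR hc hn)
  · simp [hω]

omit [Nonempty ι] in
lemma measure_exceed_le (hG : G ≤ mΩ) (hZ : Measurable[mΩ] Z)
    (h : ∀ s, MeasurableSet s → P⟦Z ⁻¹' s | G⟧ =ᵐ[P] fun ω => (ν ω).real s)
    (hA : MeasurableSet[G] A) (hmm : ∀ i, Measurable[G] fun ω => m ω i)
    (hsm : ∀ i, Measurable[G] fun ω => s ω i)
    (hlaw : ∀ ω ∈ A, ∀ i, (ν ω).map (fun z => z i) = gaussianReal (m ω i) (s ω i ^ 2).toNNReal)
    (hs : ∀ ω ∈ A, ∀ i, 0 ≤ s ω i) (hc : 0 ≤ c) :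
    P {ω | ω ∈ A ∧ ∃ i, m ω i + c * s ω i < Z ω i} ≤
      ENNReal.ofReal (Fintype.card ι * Real.exp (-(c ^ 2 / 2))) := by
  set B : Set (Ω × EuclideanSpace ℝ ι) := {q | q.1 ∈ A ∧ ∃ i, m q.1 i + c * s q.1 i < q.2 i}
    with hB
  have hBm : @MeasurableSet _ (G.prod inferInstance) B :=
    measurableSet_exceed hA (u := fun ω i => m ω i + c * s ω i)
      fun i => (hmm i).add ((hsm i).const_mul c)
  have hF : @Measurable _ _ (G.prod inferInstance) _ (B.indicator (fun _ => (1 : ℝ≥0∞))) :=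
    measurable_const.indicator hBm
  have key := lintegral_eq_lintegral_condLaw hG hZ h hF
  have hset : MeasurableSet[mΩ] {ω | ω ∈ A ∧ ∃ i, m ω i + c * s ω i < Z ω i} := by
    have hi : ∀ i, MeasurableSet[mΩ] {ω | m ω i + c * s ω i < Z ω i} := fun i =>
      measurableSet_lt (((hmm i).add ((hsm i).const_mul c)).mono hG le_rfl) (by fun_prop)
    have h3 := (hG _ hA).inter (MeasurableSet.iUnion hi)
    convert h3 using 1
    ext; simp
  have e1 : P {ω | ω ∈ A ∧ ∃ i, m ω i + c * s ω i < Z ω i} =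
      ∫⁻ ω, B.indicator (fun _ => (1 : ℝ≥0∞)) (ω, Z ω) ∂P := by
    rw [← lintegral_indicator_one hset]
    rfl
  rw [e1, key]
  have hle : ∀ ω, ∫⁻ z, B.indicator (fun _ => (1 : ℝ≥0∞)) (ω, z) ∂(ν ω) ≤
      ENNReal.ofReal (Fintype.card ι * Real.exp (-(c ^ 2 / 2))) := by
    intro ω
    by_cases hω : ω ∈ A
    · have hz : MeasurableSet {z : EuclideanSpace ℝ ι | ∃ i, m ω i + c * s ω i < z i} := by
        have h : {z : EuclideanSpace ℝ ι | ∃ i, m ω i + c * s ω i < z i} =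
            ⋃ i, (fun z => z i) ⁻¹' Set.Ioi (m ω i + c * s ω i) := by ext; simp
        rw [h]
        exact MeasurableSet.iUnion fun i => measurableSet_Ioi.preimage (by fun_prop)
      have e2 : ∀ z, B.indicator (fun _ => (1 : ℝ≥0∞)) (ω, z) =
          {z : EuclideanSpace ℝ ι | ∃ i, m ω i + c * s ω i < z i}.indicator 1 z := by
        intro z
        simp [Set.indicator, hB, hω]
      simp only [e2]
      rw [lintegral_indicator_one hz, ← ofReal_measureReal]
      exact ENNReal.ofReal_le_ofReal (measureReal_exists_lt_le (hlaw ω hω) (hs ω hω) hc)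
    · have e2 : ∀ z, B.indicator (fun _ => (1 : ℝ≥0∞)) (ω, z) = 0 := by
        intro z
        simp [hB, hω]
      simp [e2]
  refine (lintegral_mono hle).trans_eq ?_
  simp

end Round

/-! ### The widths of a run -/

section Width

variable {𝒳 : Type*}

/-- The width of the confidence interval at `z` in round `t`. -/
def Tuning.width (p : Tuning 𝒳) (x : ℕ → 𝒳) (y : ℕ → ℝ) (t : ℕ) (z : 𝒳) : ℝ :=
  √(postKernel p.k x (p.reg x y t) (t - 1) z z / p.reg x y t) * p.confB x y t

/-- The estimates of round `t` are meaningful and the posterior means are within `1.25` widths of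
the target function. -/
def Tuning.Reliable (p : Tuning 𝒳) (arms : Finset 𝒳) (f : 𝒳 → ℝ) (x : ℕ → 𝒳) (y : ℕ → ℝ)
    (t : ℕ) : Prop :=
  0 < p.sdPlus x y (t - 1) ∧ ∀ a : arms,
    |postMean p.k x y (p.reg x y t) (t - 1) a - f a| ≤ 1.25 * p.width x y t a

lemma Tuning.confB_nonneg {p : Tuning 𝒳} (hC : 0 < p.C) {x : ℕ → 𝒳} {y : ℕ → ℝ} {t : ℕ}
    (h : 0 < p.sdPlus x y (t - 1)) : 0 ≤ p.confB x y t := by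
  unfold Tuning.confB
  positivity

lemma Tuning.width_nonneg {p : Tuning 𝒳} (hC : 0 < p.C) {x : ℕ → 𝒳} {y : ℕ → ℝ} {t : ℕ}
    (h : 0 < p.sdPlus x y (t - 1)) (z : 𝒳) : 0 ≤ p.width x y t z :=
  mul_nonneg (Real.sqrt_nonneg _) (Tuning.confB_nonneg hC h)

variable {H : Type*} [NormedAddCommGroup H] [InnerProductSpace ℝ H] {φ : 𝒳 → H}

/-- This is what the inflation is for: in `v_t² σ₊² / λ_t · k` the factor `σ₊` cancels, leaving the
squared confidence width as variance. -/
lemma Tuning.map_eval_sample {p : Tuning 𝒳} (hk : ∀ a b, p.k a b = inner ℝ (φ a) (φ b))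
    (hC : 0 < p.C) {arms : Finset 𝒳} [DecidableEq 𝒳] {x : ℕ → 𝒳} {y : ℕ → ℝ} {t : ℕ}
    (h : 0 < p.sdPlus x y (t - 1)) (a : arms) :
    (multivariateGaussian (p.sampleMean x y arms t) (p.sampleCov x y arms t)).map (fun z => z a) =
      gaussianReal (postMean p.k x y (p.reg x y t) (t - 1) a)
        (p.width x y t a ^ 2).toNNReal := by
  have hreg : 0 < p.reg x y t := by unfold Tuning.reg; positivity
  have hcov : p.sampleCov x y arms t = Matrix.of fun a b : arms =>
      (p.inflation x y t ^ 2 * (p.sdPlus x y (t - 1) ^ 2 / p.reg x y t)) *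
        postKernel p.k x (p.reg x y t) (t - 1) a b := by
    ext a b
    simp [Tuning.sampleCov, mul_assoc]
  have hpsd : (p.sampleCov x y arms t).PosSemidef := by
    rw [hcov]
    exact posSemidef_postKernel hk hreg arms (by positivity)
  rw [(measurePreserving_eval_multivariateGaussian hpsd (i := a)).map_eq]
  congr 2
  have hnn := postKernel_self_nonneg (x := x) (t := t - 1) hk hreg (a : 𝒳)
  rw [hcov, Matrix.of_apply, Tuning.width, mul_pow, Real.sq_sqrt (by positivity),
    Tuning.inflation]
  field_simp

variable {Ω : Type*} {m : MeasurableSpace Ω} {arms : Finset 𝒳} {p : Tuning 𝒳}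
  {x : ℕ → Ω → arms} {y : ℕ → Ω → ℝ} {t : ℕ}

lemma measurable_width (hx : ∀ s, 1 ≤ s → s ≤ t - 1 → Measurable[m, ⊤] (x s))
    (hy : ∀ s, 1 ≤ s → s ≤ t - 1 → Measurable (y s)) (z : 𝒳) :
    Measurable fun ω => p.width (fun s => (x s ω : 𝒳)) (fun s => y s ω) t z := by
  have h1 := measurable_reg (p := p) hx hy
  have h2 := measurable_postKernel (k := p.k) hx h1 z z
  have h3 := measurable_confB (p := p) hx hy
  unfold Tuning.width
  fun_prop

lemma measurableSet_reliable (hx : ∀ s, 1 ≤ s → s ≤ t - 1 → Measurable[m, ⊤] (x s))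
    (hy : ∀ s, 1 ≤ s → s ≤ t - 1 → Measurable (y s)) (f : 𝒳 → ℝ) :
    MeasurableSet {ω | p.Reliable arms f (fun s => (x s ω : 𝒳)) (fun s => y s ω) t} := by
  have h1 := measurable_reg (p := p) hx hy
  have e : {ω | p.Reliable arms f (fun s => (x s ω : 𝒳)) (fun s => y s ω) t} =
      {ω | 0 < p.sdPlus (fun s => (x s ω : 𝒳)) (fun s => y s ω) (t - 1)} ∩ ⋂ a : arms,
        {ω | |postMean p.k (fun s => (x s ω : 𝒳)) (fun s => y s ω)
            (p.reg (fun s => (x s ω : 𝒳)) (fun s => y s ω) t) (t - 1) a - f a| ≤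
          1.25 * p.width (fun s => (x s ω : 𝒳)) (fun s => y s ω) t a} := by
    ext ω
    simp only [Tuning.Reliable, Set.mem_inter_iff, Set.mem_iInter, Set.mem_ofPred_eq]
  rw [e]
  refine (measurableSet_lt measurable_const (measurable_sdBounds hx hy).snd).inter
    (MeasurableSet.iInter fun a => measurableSet_le ?_ ((measurable_width hx hy a).const_mul _))
  exact ((measurable_postMean hx hy h1 a).sub_const _).norm

end Width


open scoped ENNReal

/-! ### The events of high probability -/

/-- The number of standard deviations that no sampled value exceeds in round `t`. -/
def sampleRadius (n : ℕ) (δ : ℝ) (t : ℕ) : ℝ :=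
  √(2 * Real.log (t * (t + 1) * n / (√Real.pi * δ)))

lemma sampleRadius_nonneg {n : ℕ} {δ : ℝ} {t : ℕ} : 0 ≤ sampleRadius n δ t := Real.sqrt_nonneg _

lemma sqrt_pi_le : √Real.pi ≤ 1.7725 := by
  rw [Real.sqrt_le_left (by norm_num)]
  have := Real.pi_lt_d4
  norm_num at this ⊢
  linarith

/-- The radius is tuned so that the union bound over the arms is summable, by telescoping, over the
rounds. The logarithm in it is nonnegative because `√π δ < 2 ≤ t (t + 1) n`, so the square root is
not truncated. -/
lemma mul_exp_sampleRadius {n : ℕ} {δ : ℝ} {t : ℕ} (hn : 1 ≤ n) (hδ : 0 < δ) (hδ1 : δ < 1)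
    (ht : 1 ≤ t) :
    n * Real.exp (-(sampleRadius n δ t ^ 2 / 2)) = √Real.pi * δ * (1 / (t * (t + 1))) := by
  have hn' : (1 : ℝ) ≤ n := by exact_mod_cast hn
  have ht' : (1 : ℝ) ≤ t := by exact_mod_cast ht
  have hpi : 0 < √Real.pi := Real.sqrt_pos.2 Real.pi_pos
  have h1 : 1 ≤ t * (t + 1) * n / (√Real.pi * δ) := by
    rw [one_le_div (by positivity)]
    have h2 : √Real.pi * δ ≤ 1.7725 * 1 := mul_le_mul sqrt_pi_le hδ1.le hδ.le (by norm_num)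
    have h3 : (1 : ℝ) * (1 + 1) * 1 ≤ t * (t + 1) * n := by gcongr
    linarith
  rw [sampleRadius, Real.sq_sqrt (by have := Real.log_nonneg h1; positivity),
    mul_div_cancel_left₀ _ two_ne_zero, Real.exp_neg, Real.exp_log (by positivity)]
  field_simp

section Events

variable {𝒳 Ω H : Type*} [DecidableEq 𝒳] [NormedAddCommGroup H] [InnerProductSpace ℝ H]
  {arms : Finset 𝒳} {mΩ : MeasurableSpace Ω} {P : Measure Ω} [IsProbabilityMeasure P]
  {p : Tuning 𝒳} {f : 𝒳 → ℝ} {φ : 𝒳 → H} {σ : ℝ} {ftilde : ℕ → Ω → EuclideanSpace ℝ arms}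
  {x : ℕ → Ω → arms} {y : ℕ → Ω → ℝ}

omit [DecidableEq 𝒳] in
lemma measurable_past_noise {s t : ℕ} (hs : 1 ≤ s)
    (hst : s < t) : Measurable[past ftilde x y t] fun ω => y s ω - f (x s ω) :=
  (measurable_past_y hs hst).sub (measurable_apply_of_countable (F := fun (a : arms) _ => f a)
    (fun _ => measurable_const) (measurable_past_x hs hst))

lemma IsRun.measure_logRatio_le (hrun : IsRun P p f σ ftilde x y) (hσ : 0 < σ)
    {μ τ : ℕ → Ω → ℝ} (hμ : ∀ s, 1 ≤ s → Measurable[pastAndPlay ftilde x y s] (μ s))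
    (hτ : ∀ s, 1 ≤ s → Measurable[pastAndPlay ftilde x y s] (τ s))
    (hτ0 : ∀ s, 1 ≤ s → ∀ ω, 0 < τ s ω) (c : ℝ) :
    P {ω | ∃ t, 2 * c ≤ ∑ s ∈ Finset.Icc 1 t,
      (((y s ω - f (x s ω)) ^ 2 - (y s ω - f (x s ω) - μ s ω) ^ 2 / τ s ω) / σ ^ 2
        - Real.log (τ s ω))} ≤ ENNReal.ofReal (Real.exp (-c)) :=
  measure_exists_le_logRatio_le past_mono hrun.past_le (fun _ => past_le_pastAndPlay)
    (fun _ => pastAndPlay_le_past) (fun s hs => measurable_past_noise hs (Nat.lt_succ_self s)) hσ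
    hrun.noise hμ hτ hτ0 c

/-- The likelihood ratio of the centred model with constant variance `σ² τ`. -/
lemma IsRun.chiSquareBound (hrun : IsRun P p f σ ftilde x y) (hσ : 0 < σ) :
    ChiSquareBound P fun t ω => (∑ s ∈ Finset.Icc 1 t, (y s ω - f (x s ω)) ^ 2) / σ ^ 2 := by
  intro τ hτ c
  refine le_trans (measure_mono ?_) (hrun.measure_logRatio_le hσ (μ := fun _ _ => 0)
    (τ := fun _ _ => τ) (fun _ _ => measurable_const) (fun _ _ => measurable_const)
    (fun _ _ _ => hτ) c)
  rintro ω ⟨t, ht⟩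
  refine ⟨t, ht.trans_eq ?_⟩
  rw [Finset.sum_sub_distrib, Finset.sum_const, Nat.card_Icc, Nat.add_sub_cancel, nsmul_eq_mul,
    ← Finset.sum_div]
  congr 1
  rw [← mul_div_assoc, Finset.mul_sum]
  congr 1
  refine Finset.sum_congr rfl fun s _ => ?_
  field_simp
  ring

/-- The alternative model predicts each noise value by regressing the earlier noise, with predictive
variance `σ² (1 + k / lam)`. Its log-variances sum to twice the information gain, and its exponents
to the quadratic form. -/
lemma IsRun.measure_noiseForm_le (hrun : IsRun P p f σ ftilde x y) (hσ : 0 < σ)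
    {k : 𝒳 → 𝒳 → ℝ} (hk : ∀ a b, k a b = inner ℝ (φ a) (φ b)) {lam : ℝ} (hlam : 0 < lam)
    (L : ℝ) :
    P {ω | ∃ t, σ ^ 2 * (2 * L + 2 * infoGain k (fun s => (x s ω : 𝒳)) lam t) <
      noiseForm k (fun s => (x s ω : 𝒳)) (fun s => y s ω - f (x s ω)) lam t} ≤
      ENNReal.ofReal (Real.exp (-L)) := by
  have hx : ∀ s r, 1 ≤ r → r ≤ s - 1 → Measurable[pastAndPlay ftilde x y s, ⊤] (x r) :=
    fun s r h1 h2 => (measurable_past_x h1 (by omega)).mono past_le_pastAndPlay le_rfl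
  have hξ : ∀ s r, 1 ≤ r → r ≤ s - 1 →
      Measurable[pastAndPlay ftilde x y s] fun ω => y r ω - f (x r ω) :=
    fun s r h1 h2 => (measurable_past_noise h1 (by omega)).mono past_le_pastAndPlay le_rfl
  refine le_trans (measure_mono ?_) (hrun.measure_logRatio_le hσ
    (μ := fun s ω => postMean k (fun s => (x s ω : 𝒳)) (fun s => y s ω - f (x s ω)) lam (s - 1)
      (x s ω))
    (τ := fun s ω => 1 + 1 / lam * postKernel k (fun s => (x s ω : 𝒳)) lam (s - 1)
      (x s ω) (x s ω))
    (fun s hs => measurable_postMean_apply (y := fun r ω => y r ω - f (x r ω)) (hx s) (hξ s)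
      measurable_const measurable_pastAndPlay_x)
    (fun s hs => measurable_const.add (measurable_const.mul
      (measurable_postKernel_apply (hx s) measurable_const measurable_pastAndPlay_x)))
    (fun s hs ω => ?_) L)
  · rintro ω ⟨t, ht⟩
    refine ⟨t, ?_⟩
    rw [noiseForm_eq_sum hk hlam] at ht
    rw [Finset.sum_sub_distrib, ← Finset.sum_div, le_sub_iff_add_le, le_div_iff₀ (by positivity)]
    have e : ∑ s ∈ Finset.Icc 1 t, Real.log (1 + 1 / lam *
        postKernel k (fun s => (x s ω : 𝒳)) lam (s - 1) (x s ω) (x s ω)) =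
        2 * infoGain k (fun s => (x s ω : 𝒳)) lam t := by
      rw [infoGain]; ring
    rw [e, mul_comm]
    exact ht.le
  · have := postKernel_self_nonneg (x := fun s => (x s ω : 𝒳)) (t := s - 1) hk hlam (x s ω : 𝒳)
    positivity

/-- `5.02 = 1 + 2.42 + 1.6`: quadratic form, upper deviations, lower deviations. -/
lemma IsRun.measure_not_goodNoise_le (hrun : IsRun P p f σ ftilde x y) (hσ : 0 < σ)
    {k : 𝒳 → 𝒳 → ℝ} (hk : ∀ a b, k a b = inner ℝ (φ a) (φ b)) {C L : ℝ} (hC : 0 < C)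
    (hL : 2.4 ≤ L) :
    P {ω | ¬ GoodNoise k (fun s => (x s ω : 𝒳)) (fun s => y s ω - f (x s ω)) σ C L} ≤
      ENNReal.ofReal (5.02 * Real.exp (-L)) := by
  have h1 := hrun.measure_noiseForm_le hσ hk (show 0 < σ ^ 2 / C ^ 2 by positivity) L
  have h2 := (hrun.chiSquareBound hσ).measure_upper_le hL
  have h3 := (hrun.chiSquareBound hσ).measure_lower_le (fun t ω => by positivity) hL
  refine (measure_mono (t := _ ∪ _ ∪ _) ?_).trans ((measure_union_le _ _).trans
    (add_le_add ((measure_union_le _ _).trans (add_le_add h1 h2)) h3)) |>.trans_eq ?_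
  · intro ω hω
    by_contra hcon
    simp only [Set.mem_union, Set.mem_ofPred_eq, not_or, not_exists, not_and, not_lt] at hcon
    exact hω ⟨hcon.1.1, hcon.1.2, hcon.2⟩
  · have := Real.exp_pos (-L)
    rw [← ENNReal.ofReal_add (by positivity) (by positivity),
      ← ENNReal.ofReal_add (by positivity) (by positivity)]
    congr 1
    ring

variable {δ : ℝ}

/-- With high probability no sampled value exceeds its mean by more than `sampleRadius` widths. -/
lemma IsRun.measure_exists_exceed_le (hrun : IsRun P p f σ ftilde x y)
    (hk : ∀ a b, p.k a b = inner ℝ (φ a) (φ b)) (hC : 0 < p.C) (harms : arms.Nonempty)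
    (hδ : 0 < δ) (hδ1 : δ < 1) :
    P {ω | ∃ t, 11 ≤ t ∧ p.Reliable arms f (fun s => (x s ω : 𝒳)) (fun s => y s ω) t ∧
      ∃ a : arms, postMean p.k (fun s => (x s ω : 𝒳)) (fun s => y s ω)
        (p.reg (fun s => (x s ω : 𝒳)) (fun s => y s ω) t) (t - 1) a + sampleRadius arms.card δ t *
          p.width (fun s => (x s ω : 𝒳)) (fun s => y s ω) t a < ftilde t ω a} ≤
      ENNReal.ofReal (√Real.pi * δ / 11) := by
  set B : ℕ → Set Ω := fun t =>
    {ω | ω ∈ {ω | p.Reliable arms f (fun s => (x s ω : 𝒳)) (fun s => y s ω) t} ∧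
      ∃ a : arms, postMean p.k (fun s => (x s ω : 𝒳)) (fun s => y s ω)
        (p.reg (fun s => (x s ω : 𝒳)) (fun s => y s ω) t) (t - 1) a + sampleRadius arms.card δ t *
          p.width (fun s => (x s ω : 𝒳)) (fun s => y s ω) t a < ftilde t ω a} with hB
  have hBt : ∀ t, 1 ≤ t → P (B t) ≤ ENNReal.ofReal (√Real.pi * δ * (1 / (t * (t + 1)))) := by
    intro t ht
    have hx : ∀ r, 1 ≤ r → r ≤ t - 1 → Measurable[past ftilde x y t, ⊤] (x r) :=
      fun r h1 h2 => measurable_past_x h1 (by omega)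
    have hy : ∀ r, 1 ≤ r → r ≤ t - 1 → Measurable[past ftilde x y t] (y r) :=
      fun r h1 h2 => measurable_past_y h1 (by omega)
    have h := measure_exceed_le (hrun.past_le t) (hrun.measurable_ftilde t) (hrun.sample t ht)
      (measurableSet_reliable hx hy f)
      (fun a => measurable_postMean (k := p.k) hx hy (measurable_reg (p := p) hx hy) a)
      (fun a => measurable_width hx hy a)
      (fun ω hω a => Tuning.map_eval_sample hk hC hω.1 a)
      (fun ω hω a => Tuning.width_nonneg hC hω.1 a) (sampleRadius_nonneg (n := arms.card) (δ := δ)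
        (t := t))
    rwa [Fintype.card_coe, mul_exp_sampleRadius harms.card_pos hδ hδ1 ht] at h
  -- Leaving out ten rounds makes the telescoping sum `1 / 11`.
  have hs := (hasSum_inv_mul_succ 11 (by norm_num)).mul_left (√Real.pi * δ)
  calc _ ≤ P (⋃ i : ℕ, B (i + 11)) := by
        refine measure_mono ?_
        rintro ω ⟨t, ht, h⟩
        refine Set.mem_iUnion.2 ⟨t - 11, ?_⟩
        rw [Nat.sub_add_cancel ht]
        exact h
    _ ≤ ∑' i : ℕ, P (B (i + 11)) := measure_iUnion_le _
    _ ≤ ∑' i : ℕ, ENNReal.ofReal (√Real.pi * δ *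
          (1 / (((i + 11 : ℕ) : ℝ) * ((i + 11 : ℕ) + 1)))) :=
        ENNReal.tsum_le_tsum fun i => hBt (i + 11) (by omega)
    _ = ENNReal.ofReal (√Real.pi * δ / 11) := by
        rw [← ENNReal.ofReal_tsum_of_nonneg (fun i => by positivity) hs.summable, hs.tsum_eq]
        congr 1
        push_cast
        ring

/-- With high probability the cumulated shortfall of the sampled maxima is controlled by the
cumulated width of the points played. -/
lemma IsRun.measure_exists_shortfall_le (hrun : IsRun P p f σ ftilde x y)
    (hk : ∀ a b, p.k a b = inner ℝ (φ a) (φ b)) (hC : 0 < p.C) [Nonempty arms] {R fstar : ℝ}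
    (hR : 0 < R) (hstar : ∃ a : arms, f a = fstar) (hδ : 0 < δ) (hδ1 : δ ≤ 1 / 3) :
    P {ω | ∃ T, Real.log (1 / δ) ≤ ∑ t ∈ Finset.Icc 1 T, open scoped Classical in
      if 11 ≤ t ∧ p.Reliable arms f (fun s => (x s ω : 𝒳)) (fun s => y s ω) t then
        (0.0172 * shortfall R fstar (ftilde t ω) - 0.2 * playedWidth R
          (fun a : arms => (sampleRadius arms.card δ t + 1 / 2) *
            p.width (fun s => (x s ω : 𝒳)) (fun s => y s ω) t a) (ftilde t ω)) / R else 0} ≤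
      ENNReal.ofReal δ := by
  classical
  set A : ℕ → Set Ω := fun t =>
    {ω | p.Reliable arms f (fun s => (x s ω : 𝒳)) (fun s => y s ω) t} with hA
  set g : ℕ → Ω → ℝ := fun t ω => (0.0172 * shortfall R fstar (ftilde t ω) - 0.2 * playedWidth R
          (fun a : arms => (sampleRadius arms.card δ t + 1 / 2) *
            p.width (fun s => (x s ω : 𝒳)) (fun s => y s ω) t a) (ftilde t ω)) / R with hg
  -- Rounds before the eleventh and unreliable rounds contribute the neutral factor `1`.
  set X : ℕ → Ω → ℝ≥0∞ := fun t ω =>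
    if 11 ≤ t then (if ω ∈ A t then ENNReal.ofReal (Real.exp (g t ω)) else 1) else 1 with hX
  have hx : ∀ t r, 1 ≤ r → r ≤ t - 1 → Measurable[past ftilde x y t, ⊤] (x r) :=
    fun t r h1 h2 => measurable_past_x h1 (by omega)
  have hy : ∀ t r, 1 ≤ r → r ≤ t - 1 → Measurable[past ftilde x y t] (y r) :=
    fun t r h1 h2 => measurable_past_y h1 (by omega)
  have hXm : ∀ t, 1 ≤ t → Measurable[past ftilde x y (t + 1)] (X t) := by
    intro t ht
    have hf' : Measurable[past ftilde x y (t + 1)] (ftilde t) :=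
      measurable_past_ftilde ht (Nat.lt_succ_self t)
    have hle : past ftilde x y t ≤ past ftilde x y (t + 1) := past_mono (Nat.le_succ t)
    have hAt : MeasurableSet[past ftilde x y (t + 1)] (A t) :=
      hle _ (measurableSet_reliable (hx t) (hy t) f)
    have h1 : Measurable[past ftilde x y (t + 1)] fun ω => shortfall R fstar (ftilde t ω) :=
      measurable_shortfall.comp hf'
    have h2 : Measurable[past ftilde x y (t + 1)] fun ω => playedWidth R
          (fun a : arms => (sampleRadius arms.card δ t + 1 / 2) *
            p.width (fun s => (x s ω : 𝒳)) (fun s => y s ω) t a) (ftilde t ω) :=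
      measurable_playedWidth (fun a => ((measurable_width (hx t) (hy t) a).mono hle
        le_rfl).const_mul _) hf'
    by_cases h11 : 11 ≤ t
    · simp only [hX, h11, if_true]
      refine Measurable.ite hAt ?_ measurable_const
      simp only [hg]
      fun_prop
    · simp only [hX, h11, if_false]
      exact measurable_const
  have hint : ∀ t, 1 ≤ t → ∀ W : Ω → ℝ≥0∞, Measurable[past ftilde x y t] W →
      ∫⁻ ω, W ω * X t ω ∂P ≤ ∫⁻ ω, W ω ∂P := by
    intro t ht W hW
    by_cases h11 : 11 ≤ t
    · simp only [hX, h11, if_true]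
      refine lintegral_mul_roundFactor_le (f := fun a : arms => f a)
        (hrun.past_le t) (hrun.measurable_ftilde t)
        (hrun.sample t ht) (measurableSet_reliable (hx t) (hy t) f)
        (fun a => measurable_width (hx t) (hy t) a)
        (fun ω hω a => Tuning.map_eval_sample hk hC hω.1 a)
        (fun ω hω a => Tuning.width_nonneg hC hω.1 a) (fun ω hω a => hω.2 a) hstar hR
        sampleRadius_nonneg ?_ hW
      have hcard : 1 ≤ arms.card := by
        rw [← Fintype.card_coe]
        exact Fintype.card_pos
      rw [Fintype.card_coe, mul_exp_sampleRadius hcard hδ (by linarith) ht]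
      have ht' : (11 : ℝ) ≤ t := by exact_mod_cast h11
      have h1 : √Real.pi * δ ≤ 1.7725 * (1 / 3) :=
        mul_le_mul sqrt_pi_le hδ1 hδ.le (by norm_num)
      -- The threshold `11` comes from here: `1.7725 / (3 * 132) ≤ 0.0045`.
      have h2 : 1 / ((t : ℝ) * (t + 1)) ≤ 1 / (11 * (11 + 1)) := by gcongr
      calc _ ≤ 1.7725 * (1 / 3) * (1 / (11 * (11 + 1)) : ℝ) := by gcongr
        _ ≤ _ := by norm_num
    · simp [hX, h11]
  have hV := mul_measure_exists_le_prod_le past_mono hrun.past_le hXm hint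
    (ENNReal.ofReal (1 / δ))
  have hset : {ω | ∃ T, Real.log (1 / δ) ≤ ∑ t ∈ Finset.Icc 1 T,
      if 11 ≤ t ∧ ω ∈ A t then g t ω else 0} =
      {ω | ∃ T, ENNReal.ofReal (1 / δ) ≤ ∏ t ∈ Finset.Icc 1 T, X t ω} := by
    ext ω
    simp only [Set.mem_ofPred_eq]
    refine exists_congr fun T => ?_
    have hXe : ∀ t, X t ω =
        ENNReal.ofReal (Real.exp (if 11 ≤ t ∧ ω ∈ A t then g t ω else 0)) := by
      intro t
      simp only [hX]
      by_cases h1 : 11 ≤ t <;> by_cases h2 : ω ∈ A t <;> simp [h1, h2]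
    simp only [hXe]
    rw [← ENNReal.ofReal_prod_of_nonneg (fun _ _ => (Real.exp_pos _).le), ← Real.exp_sum,
      ENNReal.ofReal_le_ofReal_iff (Real.exp_pos _).le, Real.log_le_iff_le_exp (by positivity)]
  rw [← hset] at hV
  have hδ0 : ENNReal.ofReal (1 / δ) ≠ 0 := by simpa using hδ
  have := ENNReal.le_inv_iff_mul_le.2 ((mul_comm _ _).trans_le hV)
  rw [← ENNReal.ofReal_inv_of_pos (by positivity), inv_div, div_one] at this
  exact this

end Events


/-! ### The regret bound with the observed widths -/

section RegretBound

lemma sq_C₂_ge (hδ : 0 ≤ δ) : 68.2 ≤ C₂ δ ^ 2 := by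
  have hpi := Real.pi_gt_d4
  have he := Real.exp_one_gt_d9
  have h1 : 68.2 ≤ 8 * Real.pi * Real.exp 1 := by nlinarith
  rw [C₂, Real.sq_sqrt (by positivity)]
  have h2 : 1 ≤ (1 + δ * √(4 * Real.pi * Real.exp 1)) ^ 2 :=
    one_le_pow₀ (le_add_of_nonneg_right (by positivity))
  nlinarith

lemma four_mul_sqrt_pi_exp_ge : 11.68 ≤ 4 * √(Real.pi * Real.exp 1) := by
  have hpi := Real.pi_gt_d4
  have he := Real.exp_one_gt_d9
  have h : 2.92 ≤ √(Real.pi * Real.exp 1) := Real.le_sqrt_of_sq_le (by nlinarith)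
  linarith

/-- The cumulated regret in terms of the shortfalls `W` of the sampled maxima and the widths `s` of
the points played. -/
lemma sum_le_of_shortfall {T : ℕ} {R ℓ c δ : ℝ} {r W Y s : ℕ → ℝ} (hR : 0 < R) (hℓ : 1 ≤ ℓ)
    (hδ : 0 ≤ δ) (hc : 0 ≤ c) (hs : ∀ t, 0 ≤ s t) (hrR : ∀ t, r t ≤ R)
    (hr : ∀ t, 11 ≤ t → t ≤ T → r t ≤ W t + (c + 1.25) * s t)
    (hY : ∀ t, 11 ≤ t → t ≤ T → Y t ≤ (c + 1 / 2) * s t)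
    (hW : ∑ t ∈ Finset.Icc 1 T, (if 11 ≤ t then (0.0172 * W t - 0.2 * Y t) / R else 0) ≤ ℓ) :
    ∑ t ∈ Finset.Icc 1 T, r t ≤ (4 * √(Real.pi * Real.exp 1) + 1) * (1 + c) *
      ∑ t ∈ Finset.Icc 1 T, s t + C₂ δ * R * √(T * ℓ) := by
  have hS : 0 ≤ ∑ t ∈ Finset.Icc 1 T, s t := Finset.sum_nonneg fun t _ => hs t
  have hC2 : 0 ≤ C₂ δ := Real.sqrt_nonneg _
  have hC2' := sq_C₂_ge hδ
  have hpe := four_mul_sqrt_pi_exp_ge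
  have hℓ0 : 0 ≤ ℓ := by linarith
  rw [Real.sqrt_mul (Nat.cast_nonneg T)]
  -- For small `T` the trivial bound `T R` suffices. For large `T`, `C₂² ℓ ≤ C₂ √(T ℓ)`, and `68.2
  -- ℓ` covers both the ten free rounds and `ℓ / 0.0172 ≤ 58.15 ℓ`.
  rcases le_or_gt (√T) (C₂ δ * √ℓ) with h | h
  · have h1 : ∑ t ∈ Finset.Icc 1 T, r t ≤ T * R := by
      refine (Finset.sum_le_card_nsmul _ _ R fun t _ => hrR t).trans_eq ?_
      simp
    have h2 : (T : ℝ) * R ≤ C₂ δ * R * (√T * √ℓ) := by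
      calc (T : ℝ) * R = √T * √T * R := by rw [Real.mul_self_sqrt (Nat.cast_nonneg T)]
        _ ≤ √T * (C₂ δ * √ℓ) * R := by gcongr
        _ = _ := by ring
    have : 0 ≤ (4 * √(Real.pi * Real.exp 1) + 1) * (1 + c) * ∑ t ∈ Finset.Icc 1 T, s t := by
      positivity
    linarith
  · have h1 : R * (10 + 58.15 * ℓ) ≤ C₂ δ * R * (√T * √ℓ) := by
      calc R * (10 + 58.15 * ℓ) ≤ R * (C₂ δ ^ 2 * ℓ) := by gcongr; nlinarith
        _ = C₂ δ * R * (C₂ δ * √ℓ * √ℓ) := by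
            rw [mul_assoc (C₂ δ) (√ℓ), Real.mul_self_sqrt hℓ0]; ring
        _ ≤ _ := by gcongr
    -- Eliminating `W` gives `(0.2 / 0.0172) (c + 1/2) + c + 1.25 ≤ 12.63 (1 + c)` widths, and `4
    -- √(π e) + 1 ≥ 12.68`.
    have hterm : ∀ t ∈ Finset.Icc 1 T, r t ≤ R * (if t ≤ 10 then 1 else 0) +
        (R / 0.0172) * (if 11 ≤ t then (0.0172 * W t - 0.2 * Y t) / R else 0) +
        (12.63 * (1 + c)) * s t := by
      intro t ht
      have hT := (Finset.mem_Icc.1 ht).2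
      have hst := hs t
      have hcs : 0 ≤ c * s t := mul_nonneg hc hst
      by_cases h11 : 11 ≤ t
      · have e : (R / 0.0172) * ((0.0172 * W t - 0.2 * Y t) / R) =
            W t - 0.2 / 0.0172 * Y t := by field_simp
        have h3 := hr t h11 hT
        have h4 : 0.2 / 0.0172 * Y t ≤ 0.2 / 0.0172 * ((c + 1 / 2) * s t) := by
          have := hY t h11 hT
          gcongr
        simp only [h11, show ¬ t ≤ 10 by omega, if_true, if_false]
        rw [e]
        norm_num at h3 h4 ⊢
        nlinarith
      · simp only [h11, show t ≤ 10 by omega, if_true, if_false]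
        have := hrR t
        nlinarith
    have h10 : ∑ t ∈ Finset.Icc 1 T, (if t ≤ 10 then (1 : ℝ) else 0) ≤ 10 := by
      rw [Finset.sum_ite, Finset.sum_const_zero, add_zero, Finset.sum_const, nsmul_eq_mul, mul_one]
      have : (Finset.filter (fun t => t ≤ 10) (Finset.Icc 1 T)).card ≤ (Finset.Icc 1 10).card :=
        Finset.card_le_card fun t ht => by
          rw [Finset.mem_filter, Finset.mem_Icc] at ht
          exact Finset.mem_Icc.2 ⟨ht.1.1, ht.2⟩
      rw [Nat.card_Icc] at this
      exact_mod_cast this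
    have h2 := Finset.sum_le_sum hterm
    rw [Finset.sum_add_distrib, Finset.sum_add_distrib, ← Finset.mul_sum, ← Finset.mul_sum,
      ← Finset.mul_sum] at h2
    have h3 : R / 0.0172 * ∑ t ∈ Finset.Icc 1 T,
        (if 11 ≤ t then (0.0172 * W t - 0.2 * Y t) / R else 0) ≤ R / 0.0172 * ℓ := by gcongr
    have h4 : R / 0.0172 * ℓ ≤ R * (58.15 * ℓ) := by
      rw [div_mul_eq_mul_div, div_le_iff₀ (by norm_num)]
      nlinarith [mul_nonneg hR.le hℓ0]
    have h5 : 12.63 * (1 + c) * ∑ t ∈ Finset.Icc 1 T, s t ≤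
        (4 * √(Real.pi * Real.exp 1) + 1) * (1 + c) * ∑ t ∈ Finset.Icc 1 T, s t := by
      gcongr
      linarith
    nlinarith

lemma sampleRadius_le {n : ℕ} {δ : ℝ} {t T : ℕ} (hn : 1 ≤ n) (hδ : 0 < δ) (ht : 1 ≤ t)
    (hT : t ≤ T) : sampleRadius n δ t ≤ sampleRadius n δ T := by
  have hn' : (0 : ℝ) < n := by exact_mod_cast hn
  have ht' : (0 : ℝ) < t := by exact_mod_cast ht
  have hT' : (t : ℝ) ≤ T := by exact_mod_cast hT
  have hpi : 0 < √Real.pi := Real.sqrt_pos.2 Real.pi_pos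
  unfold sampleRadius
  gcongr

variable {𝒳 : Type*} {arms : Finset 𝒳} {f : 𝒳 → ℝ} {p : Tuning 𝒳} {x : ℕ → arms} {y : ℕ → ℝ}
  {ftilde : ℕ → EuclideanSpace ℝ arms} {δ : ℝ} {T : ℕ}

lemma sub_le_maxGap (harms : arms.Nonempty) (a : arms) :
    arms.sup' harms f - f a ≤ maxGap harms f :=
  Finset.le_sup' (fun a => arms.sup' harms f - f a) a.2

lemma maxGap_nonneg (harms : arms.Nonempty) : 0 ≤ maxGap harms f := by
  obtain ⟨a, ha⟩ := harms
  have h1 := sub_le_maxGap (f := f) ⟨a, ha⟩ ⟨a, ha⟩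
  have h2 := Finset.le_sup' f ha
  simp only at h1
  linarith

lemma C₁_nonneg {n : ℕ} : 0 ≤ C₁ n δ T := by
  unfold C₁
  positivity

/-- The gap at the point played splits into the shortfall of the sampled maximum, the excess of the
sampled value over its mean, and the error of the mean. The case of zero maximal gap is separate, as
the exponents are divided by it. -/
lemma regret_le_sum_width (harms : arms.Nonempty) [Nonempty arms] (hC : 0 < p.C) (hδ : 0 < δ)
    (hδ1 : δ ≤ 1 / 3) (hrel : ∀ t, p.Reliable arms f (fun s => x s) y t)
    (hex : ∀ t, 11 ≤ t → ∀ a : arms, ftilde t a ≤ postMean p.k (fun s => (x s : 𝒳)) y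
      (p.reg (fun s => (x s : 𝒳)) y t) (t - 1) a +
        sampleRadius arms.card δ t * p.width (fun s => (x s : 𝒳)) y t a)
    (hsf : 0 < maxGap harms f → ∑ t ∈ Finset.Icc 1 T, (if 11 ≤ t then
      (0.0172 * shortfall (maxGap harms f) (arms.sup' harms f) (ftilde t) -
        0.2 * playedWidth (maxGap harms f) (fun a : arms => (sampleRadius arms.card δ t + 1 / 2) *
          p.width (fun s => (x s : 𝒳)) y t a) (ftilde t)) / maxGap harms f else 0)
      ≤ Real.log (1 / δ))
    (hmax : ∀ t, 1 ≤ t → ∀ a, ftilde t a ≤ ftilde t (x t)) :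
    regret harms f (fun s => (x s : 𝒳)) T ≤ C₁ arms.card δ T *
        (∑ t ∈ Finset.Icc 1 T, p.width (fun s => (x s : 𝒳)) y t (x t)) +
      C₂ δ * maxGap harms f * √(T * Real.log (1 / δ)) := by
  set R := maxGap harms f with hRdef
  set fstar := arms.sup' harms f with hfstar
  have hw : ∀ t a, 0 ≤ p.width (fun s => (x s : 𝒳)) y t a := fun t a =>
    Tuning.width_nonneg hC (hrel t).1 a
  rcases (maxGap_nonneg (f := f) harms).eq_or_lt with hR | hR
  · rw [← hRdef] at hR
    have h1 : regret harms f (fun s => (x s : 𝒳)) T ≤ 0 :=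
      Finset.sum_nonpos fun t _ => (sub_le_maxGap harms (x t)).trans_eq hR.symm
    have h2 := C₁_nonneg (n := arms.card) (δ := δ) (T := T)
    have h3 : 0 ≤ ∑ t ∈ Finset.Icc 1 T, p.width (fun s => (x s : 𝒳)) y t (x t) :=
      Finset.sum_nonneg fun t _ => hw t _
    rw [← hR, mul_zero, zero_mul, add_zero]
    exact h1.trans (mul_nonneg h2 h3)
  have hℓ : 1 ≤ Real.log (1 / δ) := by
    rw [Real.le_log_iff_exp_le (by positivity)]
    have h1 := Real.exp_one_lt_d9
    have h2 : 3 ≤ 1 / δ := by rw [le_div_iff₀ hδ]; linarith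
    linarith
  have hcard : 1 ≤ arms.card := harms.card_pos
  have hC₁ : C₁ arms.card δ T =
      (4 * √(Real.pi * Real.exp 1) + 1) * (1 + sampleRadius arms.card δ T) := rfl
  have hsub : ∀ t, fstar - f (x t) ≤ R := fun t => sub_le_maxGap harms (x t)
  rw [hC₁]
  refine sum_le_of_shortfall hR hℓ hδ.le (sampleRadius_nonneg (n := arms.card) (δ := δ) (t := T))
    (fun t => hw t (x t)) hsub (fun t h11 hT => ?_)
    (fun t h11 hT => ?_) (hsf hR)
  · have hc := sampleRadius_le hcard hδ (by omega : 1 ≤ t) hT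
    have hmul := mul_le_mul_of_nonneg_right hc (hw t (x t))
    have h1 := hex t h11 (x t)
    have h2 := (abs_le.1 ((hrel t).2 (x t))).2
    have h3 : Finset.univ.sup' Finset.univ_nonempty (fun a => ftilde t a) = ftilde t (x t) :=
      le_antisymm (Finset.sup'_le _ _ fun a _ => hmax t (by omega) a)
        (Finset.le_sup' (fun a => ftilde t a) (Finset.mem_univ (x t)))
    have h4 : 0 ≤ (sampleRadius arms.card δ T + 1.25) *
        p.width (fun s => (x s : 𝒳)) y t (x t) :=
      mul_nonneg (add_nonneg sampleRadius_nonneg (by norm_num)) (hw t (x t))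
    -- Cutting the shortfall at `R` is harmless, since the gap of the round never exceeds `R`.
    rw [shortfall, h3, ← min_add_add_right]
    refine le_min ((hsub t).trans (le_add_of_nonneg_right h4)) ?_
    change fstar - f (x t) ≤ _
    have h5 := le_max_left (fstar - ftilde t (x t)) 0
    rw [add_mul]
    linarith
  · have hc := sampleRadius_le hcard hδ (by omega : 1 ≤ t) hT
    refine (playedWidth_le_of_forall_le _ (hmax t (by omega))).trans ((min_le_right _ _).trans ?_)
    exact mul_le_mul_of_nonneg_right (by linarith) (hw t (x t))

end RegretBound

/-! ### The widths and the information gain -/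

section SumWidth

variable {𝒳 H : Type*} [NormedAddCommGroup H] [InnerProductSpace ℝ H]
variable {k : 𝒳 → 𝒳 → ℝ} {φ : 𝒳 → H} {x : ℕ → 𝒳} {y ξ : ℕ → ℝ} {f : H} {p : Tuning 𝒳}
variable {σ σlow σhigh C η lam : ℝ} {T : ℕ}

/-- Concavity of the logarithm between `1` and `1 + v`. It compares posterior variances in `[0, 1]`
with the increments of the information gain. -/
lemma mul_log_le_log_one_add_mul {u v : ℝ} (hv : 0 ≤ v) (hu : 0 ≤ u) (hu1 : u ≤ 1) :
    u * Real.log (1 + v) ≤ Real.log (1 + v * u) := by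
  have h := strictConcaveOn_log_Ioi.concaveOn.2 (x := 1) (y := 1 + v)
    (Set.mem_Ioi.2 one_pos) (Set.mem_Ioi.2 (by positivity)) (sub_nonneg.2 hu1) hu (by ring)
  simp only [smul_eq_mul, Real.log_one, mul_zero, zero_add, mul_one] at h
  refine h.trans_eq ?_
  congr 1
  ring

lemma sum_postKernel_le (hk : ∀ a b, k a b = inner ℝ (φ a) (φ b)) (hlam : 0 < lam)
    (hk1 : ∀ t, k (x t) (x t) ≤ 1) :
    ∑ t ∈ Finset.Icc 1 T, postKernel k x lam (t - 1) (x t) (x t) ≤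
      2 * infoGain k x lam T / Real.log (1 + 1 / lam) := by
  have hlog : 0 < Real.log (1 + 1 / lam) := Real.log_pos (by simpa using hlam)
  rw [le_div_iff₀ hlog, infoGain, Finset.sum_mul, ← mul_assoc, mul_one_div_cancel two_ne_zero,
    one_mul]
  exact Finset.sum_le_sum fun t _ => mul_log_le_log_one_add_mul (by positivity)
    (postKernel_self_nonneg hk hlam _) ((postKernel_self_le hk hlam _).trans (hk1 t))

lemma sum_sqrt_postKernel_le (hk : ∀ a b, k a b = inner ℝ (φ a) (φ b)) (hlam : 0 < lam)
    (hk1 : ∀ t, k (x t) (x t) ≤ 1) :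
    ∑ t ∈ Finset.Icc 1 T, √(postKernel k x lam (t - 1) (x t) (x t)) ≤
      √(T * (2 * infoGain k x lam T / Real.log (1 + 1 / lam))) := by
  refine Real.le_sqrt_of_sq_le ?_
  have h := sq_sum_le_card_mul_sum_sq (s := Finset.Icc 1 T)
    (f := fun t => √(postKernel k x lam (t - 1) (x t) (x t)))
  rw [Nat.card_Icc, Nat.add_sub_cancel] at h
  refine h.trans ?_
  refine mul_le_mul_of_nonneg_left ?_ (Nat.cast_nonneg T)
  refine le_trans (le_of_eq ?_) (sum_postKernel_le hk hlam hk1)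
  exact Finset.sum_congr rfl fun t _ => Real.sq_sqrt (postKernel_self_nonneg hk hlam _)

-- As `√λ_t = σ_{+,t-1} / C`, the estimate `σ_{+,t-1}` disappears except through the regularisation
-- of the posterior variance.
omit [InnerProductSpace ℝ H] in
lemma width_eq (hp : p = ⟨k, ‖f‖, C, σlow, σhigh, η⟩) (hC : 0 < C) {t : ℕ}
    (h : 0 < p.sdPlus x y (t - 1)) (z : 𝒳) :
    p.width x y t z = C * √(postKernel k x (p.reg x y t) (t - 1) z z) *
      (1 + √(2 * Real.log (1 / η) +
        2 * infoGain k x (p.sdMinus x y (t - 1) ^ 2 / C ^ 2) (t - 1))) := by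
  have hpC : p.C = C := by rw [hp]
  have hpk : p.k = k := by rw [hp]
  have hpη : p.η = η := by rw [hp]
  have hsq : √(p.reg x y t) = p.sdPlus x y (t - 1) / C := by
    rw [Tuning.reg, hpC, ← div_pow, Real.sqrt_sq (by positivity)]
  have hreg : 0 ≤ p.reg x y t := by unfold Tuning.reg; positivity
  rw [Tuning.width, Tuning.confB, Real.sqrt_div' _ hreg, hsq, hpC, hpk, hpη]
  field_simp

lemma sum_width_le (hk : ∀ a b, k a b = inner ℝ (φ a) (φ b)) (hlow : 0 < σlow)
    (hlowσ : σlow ≤ σ) (hC : 0 < C)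
    (hp : p = ⟨k, ‖f‖, C, σlow, σhigh, η⟩)
    (hsd : ∀ t, σlow ≤ p.sdMinus x y t ∧ 0 < p.sdPlus x y t ∧ p.sdPlus x y t ≤ σhigh)
    (hσhigh : σ ≤ σhigh) (hk1 : ∀ t, k (x t) (x t) ≤ 1) :
    ∑ t ∈ Finset.Icc 1 T, p.width x y t (x t) ≤ (σhigh / σ) *
      (1 + √(2 * Real.log (1 / η) + 2 * infoGain k x (σlow ^ 2 / C ^ 2) T)) * C *
      √(T * (2 * infoGain k x (σ ^ 2 / C ^ 2) T / Real.log (1 + C ^ 2 / σ ^ 2))) := by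
  have hσ : 0 < σ := hlow.trans_le hlowσ
  have hσh : 0 < σhigh := hσ.trans_le hσhigh
  have hlamS : 0 < σ ^ 2 / C ^ 2 := by positivity
  have hlamH : 0 < σhigh ^ 2 / C ^ 2 := by positivity
  have hlamL : 0 < σlow ^ 2 / C ^ 2 := by positivity
  have hcs := sum_sqrt_postKernel_le (T := T) hk hlamS hk1
  rw [one_div_div] at hcs
  set Q := 1 + √(2 * Real.log (1 / η) + 2 * infoGain k x (σlow ^ 2 / C ^ 2) T) with hQ
  have hterm : ∀ t ∈ Finset.Icc 1 T, p.width x y t (x t) ≤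
      (σhigh / σ) * Q * C * √(postKernel k x (σ ^ 2 / C ^ 2) (t - 1) (x t) (x t)) := by
    intro t ht
    obtain ⟨h1, h2, h3⟩ := hsd (t - 1)
    rw [width_eq hp hC h2]
    have hreg : p.reg x y t = p.sdPlus x y (t - 1) ^ 2 / C ^ 2 := by
      rw [Tuning.reg, hp]
    have hreg0 : 0 < p.reg x y t := by rw [hreg]; positivity
    have hkk : √(postKernel k x (p.reg x y t) (t - 1) (x t) (x t)) ≤
        σhigh / σ * √(postKernel k x (σ ^ 2 / C ^ 2) (t - 1) (x t) (x t)) := by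
      rw [← Real.sqrt_sq (show 0 ≤ σhigh / σ by positivity), ← Real.sqrt_mul (by positivity)]
      refine Real.sqrt_le_sqrt ?_
      -- `λ_t` may lie on either side of the ideal regularisation, so the comparison goes up to
      -- `σhigh² / C²` first and then down.
      have a1 := postKernel_mono (x := x) (t := t - 1) hk hreg0
        (show p.reg x y t ≤ σhigh ^ 2 / C ^ 2 by rw [hreg]; gcongr) (x t)
      have a2 := postKernel_div_anti (x := x) (t := t - 1) hk hlamS
        (show σ ^ 2 / C ^ 2 ≤ σhigh ^ 2 / C ^ 2 by gcongr) (x t)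
      rw [div_le_iff₀ hlamH] at a2
      refine a1.trans (a2.trans_eq ?_)
      field_simp
    have hγ : 1 + √(2 * Real.log (1 / η) +
        2 * infoGain k x (p.sdMinus x y (t - 1) ^ 2 / C ^ 2) (t - 1)) ≤ Q := by
      have b1 := infoGain_anti (x := x) (t := t - 1) hk hlamL
        (show σlow ^ 2 / C ^ 2 ≤ p.sdMinus x y (t - 1) ^ 2 / C ^ 2 by gcongr)
      have b2 := infoGain_mono (x := x) hk hlamL
        (show t - 1 ≤ T by have := (Finset.mem_Icc.1 ht).2; omega)
      rw [hQ]
      gcongr 1 + √(_ + 2 * ?_)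
      exact b1.trans b2
    calc _ ≤ C * (σhigh / σ * √(postKernel k x (σ ^ 2 / C ^ 2) (t - 1) (x t) (x t))) * Q := by
          gcongr
      _ = _ := by ring
  refine (Finset.sum_le_sum hterm).trans ?_
  rw [← Finset.mul_sum]
  have : 0 ≤ (σhigh / σ) * Q * C := by
    have : 0 ≤ Q := by positivity
    positivity
  exact mul_le_mul_of_nonneg_left hcs this

/-- The first round alone contributes this much, as no data have yet reduced the prior variance. -/
lemma le_infoGain (hk : ∀ a b, k a b = inner ℝ (φ a) (φ b)) (hlam : 0 < lam) {κ : ℝ}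
    (hκ : 0 ≤ κ) (hx : ∀ t, κ ≤ k (x t) (x t)) (hT : 1 ≤ T) :
    1 / 2 * Real.log (1 + κ / lam) ≤ infoGain k x lam T := by
  refine le_trans ?_ (infoGain_mono hk hlam hT)
  have h : postKernel k x lam 0 (x 1) (x 1) = k (x 1) (x 1) := by simp [postKernel]
  simp only [infoGain, Finset.Icc_self, Finset.sum_singleton, Nat.sub_self]
  rw [h, one_div_mul_eq_div lam]
  have := hx 1
  gcongr

end SumWidth


/-! ### The rate -/

section Rate

/-- Once `T n ≥ 2`, `log (T n) ≥ 1/2`, so constants can be absorbed into it. -/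
lemma sampleRadius_le_sqrt {n T : ℕ} {δ : ℝ} (hδ : 0 < δ) (hδ1 : δ < 1) (hTn : 2 ≤ T * n) :
    sampleRadius n δ T ≤ √((4 * Real.log (2 / δ) + 4) * Real.log (T * n)) ∧
      1 ≤ 2 * Real.log (T * n) := by
  have hT : (1 : ℝ) ≤ T := by
    have : T ≠ 0 := by rintro rfl; omega
    exact_mod_cast Nat.one_le_iff_ne_zero.2 this
  have hn : (1 : ℝ) ≤ n := by
    have : n ≠ 0 := by rintro rfl; omega
    exact_mod_cast Nat.one_le_iff_ne_zero.2 this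
  have hTn' : (2 : ℝ) ≤ T * n := by exact_mod_cast hTn
  have hln : 1 ≤ 2 * Real.log (T * n) := by
    have h1 := Real.log_two_gt_d9
    have h2 : Real.log 2 ≤ Real.log (T * n) := Real.log_le_log (by norm_num) hTn'
    linarith
  refine ⟨Real.sqrt_le_sqrt ?_, hln⟩
  have ha : 0 ≤ Real.log (2 / δ) := Real.log_nonneg (by rw [one_le_div hδ]; linarith)
  have hpi : 1 ≤ √Real.pi := Real.one_le_sqrt.2 (by have := Real.pi_gt_three; linarith)
  have h1 : T * (T + 1) * n / (√Real.pi * δ) ≤ 2 / δ * (T * n) ^ 2 := by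
    rw [div_le_iff₀ (by positivity)]
    have e : 2 / δ * ((T : ℝ) * n) ^ 2 * (√Real.pi * δ) = 2 * (T * n) ^ 2 * √Real.pi := by
      field_simp
    rw [e]
    calc (T : ℝ) * (T + 1) * n ≤ T * (T + T) * (n * n) := by
          gcongr
          exact le_mul_of_one_le_left (by linarith) hn
      _ = 2 * (T * n) ^ 2 * 1 := by ring
      _ ≤ _ := by gcongr
  have h2 : Real.log (T * (T + 1) * n / (√Real.pi * δ)) ≤
      Real.log (2 / δ) + 2 * Real.log (T * n) := by
    refine (Real.log_le_log (by positivity) h1).trans_eq ?_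
    rw [Real.log_mul (by positivity) (by positivity), Real.log_pow]
    norm_num
  nlinarith

/-- The constant of the rate, with `γ₀` a lower bound on the information gain. -/
def rateConst (δ σ σlow σhigh C κ : ℝ) : ℝ :=
  let γ₀ := 1 / 2 * Real.log (1 + κ / (σ ^ 2 / C ^ 2))
  (4 * √(Real.pi * Real.exp 1) + 1) * (√2 + √(4 * Real.log (2 / δ) + 4)) * (σhigh / σ) *
      (√(1 / γ₀) + √(2 * Real.log (4 / δ) / γ₀ + 2 * ((σ ^ 2 / C ^ 2) / (σlow ^ 2 / C ^ 2)))) *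
      √(2 / Real.log (1 + C ^ 2 / σ ^ 2)) +
    C₂ δ * 2 * √(2 * Real.log (1 / δ)) / γ₀ + 4 * Real.pi * Real.exp 1 * δ * 2 * √2 / γ₀

/-- Every missing factor is supplied by `1 ≤ √T`, `1 ≤ √2 √u` or `1 ≤ γ / γ₀`. The two factors `√γ`,
from the confidence term and from the sum of variances, combine to `γ`. -/
lemma le_rate {T u γ γ' γ₀ R C c₀ r s a b q ρ ℓ c₂ d : ℝ} (hT : 1 ≤ T) (hu : 1 ≤ 2 * u)
    (hγ₀ : 0 < γ₀) (hγ : γ₀ ≤ γ) (hγ' : γ' ≤ ρ * γ) (hR : R ≤ 2 * C) (hC : 0 ≤ C) (hc₀ : 0 ≤ c₀)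
    (hs : 0 ≤ s) (ha : 0 ≤ a) (hr : r ≤ √(a * u)) (hb : 0 ≤ b) (hc₂ : 0 ≤ c₂)
    (hd : 0 ≤ d) :
    c₀ * (1 + r) * s * (1 + √(b + 2 * γ')) * C * √(T * (2 * γ / q)) + c₂ * R * √(T * ℓ) + d * R ≤
      (c₀ * (√2 + √a) * s * (√(1 / γ₀) + √(b / γ₀ + 2 * ρ)) * √(2 / q) + c₂ * 2 * √(2 * ℓ) / γ₀ +
        d * 2 * √2 / γ₀) * (C * √(T * u) * γ) := by
  have hu0 : 0 ≤ u := by linarith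
  have hT0 : 0 ≤ T := by linarith
  have hγ0 : 0 ≤ γ := hγ₀.le.trans hγ
  have hγγ : 1 ≤ γ / γ₀ := (one_le_div hγ₀).2 hγ
  have hsu : 1 ≤ √2 * √u := by
    rw [← Real.sqrt_mul (by norm_num)]; exact Real.one_le_sqrt.2 hu
  have hsT : 1 ≤ √T := Real.one_le_sqrt.2 hT
  have h1 : 1 + r ≤ (√2 + √a) * √u := by
    rw [Real.sqrt_mul ha] at hr
    linarith
  have h2 : 1 + √(b + 2 * γ') ≤ (√(1 / γ₀) + √(b / γ₀ + 2 * ρ)) * √γ := by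
    rw [add_mul, ← Real.sqrt_mul (by positivity), ← Real.sqrt_mul' _ hγ0]
    have e1 : 1 ≤ √(1 / γ₀ * γ) := Real.one_le_sqrt.2 (by rwa [one_div_mul_eq_div])
    have e2 : √(b + 2 * γ') ≤ √((b / γ₀ + 2 * ρ) * γ) := by
      refine Real.sqrt_le_sqrt ?_
      have : b ≤ b * (γ / γ₀) := le_mul_of_one_le_right hb hγγ
      calc b + 2 * γ' ≤ b * (γ / γ₀) + 2 * (ρ * γ) := by linarith
        _ = _ := by ring
    linarith
  have h3 : √(T * (2 * γ / q)) = √T * (√(2 / q) * √γ) := by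
    rw [Real.sqrt_mul hT0, ← Real.sqrt_mul' _ hγ0]
    congr 2
    ring
  have hγs : √γ * √γ = γ := Real.mul_self_sqrt hγ0
  have t1 : c₀ * (1 + r) * s * (1 + √(b + 2 * γ')) * C * √(T * (2 * γ / q)) ≤
      c₀ * (√2 + √a) * s * (√(1 / γ₀) + √(b / γ₀ + 2 * ρ)) * √(2 / q) * (C * √(T * u) * γ) := by
    rw [h3, Real.sqrt_mul hT0]
    calc _ ≤ c₀ * ((√2 + √a) * √u) * s * ((√(1 / γ₀) + √(b / γ₀ + 2 * ρ)) * √γ) * C *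
          (√T * (√(2 / q) * √γ)) := by gcongr
      _ = c₀ * (√2 + √a) * s * (√(1 / γ₀) + √(b / γ₀ + 2 * ρ)) * √(2 / q) *
          (C * (√T * √u) * (√γ * √γ)) := by ring
      _ = _ := by rw [hγs]
  have t2 : c₂ * R * √(T * ℓ) ≤ c₂ * 2 * √(2 * ℓ) / γ₀ * (C * √(T * u) * γ) := by
    rw [Real.sqrt_mul hT0, Real.sqrt_mul hT0, Real.sqrt_mul (by norm_num) ℓ]
    calc c₂ * R * (√T * √ℓ) ≤ c₂ * (2 * C) * (√T * √ℓ) * (√2 * √u) * (γ / γ₀) := by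
          rw [mul_assoc _ (√2 * √u)]
          have h4 : 1 ≤ √2 * √u * (γ / γ₀) := one_le_mul_of_one_le_of_one_le hsu hγγ
          have h5 : c₂ * R * (√T * √ℓ) ≤ c₂ * (2 * C) * (√T * √ℓ) := by gcongr
          exact h5.trans (le_mul_of_one_le_right (by positivity) h4)
      _ = _ := by ring
  have t3 : d * R ≤ d * 2 * √2 / γ₀ * (C * √(T * u) * γ) := by
    rw [Real.sqrt_mul hT0]
    calc d * R ≤ d * (2 * C) * (√T * (√2 * √u) * (γ / γ₀)) := by
          have h4 : 1 ≤ √T * (√2 * √u) * (γ / γ₀) :=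
            one_le_mul_of_one_le_of_one_le (one_le_mul_of_one_le_of_one_le hsT hsu) hγγ
          have h5 : d * R ≤ d * (2 * C) := by gcongr
          exact h5.trans (le_mul_of_one_le_right (by positivity) h4)
      _ = _ := by ring
  linarith

variable {𝒳 H : Type*} [NormedAddCommGroup H] [InnerProductSpace ℝ H]
variable {k : 𝒳 → 𝒳 → ℝ} {φ : 𝒳 → H} {g : H} {f : 𝒳 → ℝ} {C : ℝ} {arms : Finset 𝒳}

lemma maxGap_le (harms : arms.Nonempty) (hk : ∀ a b, k a b = inner ℝ (φ a) (φ b))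
    (hf : ∀ a, f a = inner ℝ g (φ a)) (hg : ‖g‖ ≤ C) (hk1 : ∀ a ∈ arms, k a a ≤ 1) :
    maxGap harms f ≤ 2 * C := by
  have hfC : ∀ a ∈ arms, |f a| ≤ C := by
    intro a ha
    have h1 : ‖φ a‖ ≤ 1 := by
      have h2 := hk1 a ha
      rw [hk, real_inner_self_eq_norm_sq] at h2
      exact (sq_le_one_iff₀ (norm_nonneg _)).1 h2
    rw [hf]
    refine (abs_real_inner_le_norm _ _).trans ?_
    calc ‖g‖ * ‖φ a‖ ≤ ‖g‖ * 1 := by gcongr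
      _ ≤ C := by linarith
  refine Finset.sup'_le _ _ fun a ha => ?_
  have h1 := (abs_le.1 (hfC a ha)).1
  have h2 : arms.sup' harms f ≤ C :=
    Finset.sup'_le _ _ fun b hb => (abs_le.1 (hfC b hb)).2
  linarith

lemma regret_eq_zero_of_card_eq_one (harms : arms.Nonempty) (hcard : arms.card = 1)
    (x : ℕ → arms) (T : ℕ) : regret harms f (fun t => (x t : 𝒳)) T = 0 := by
  obtain ⟨a, rfl⟩ := Finset.card_eq_one.1 hcard
  refine Finset.sum_eq_zero fun t _ => ?_
  have h := (x t).2
  rw [Finset.mem_singleton] at h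
  simp [h]

variable {δ σ σlow σhigh κ : ℝ} {x : ℕ → arms} {T : ℕ}

/-- The rate follows from the bound through the information gain. -/
lemma regret_le_rate (harms : arms.Nonempty) (hk : ∀ a b, k a b = inner ℝ (φ a) (φ b))
    (hf : ∀ a, f a = inner ℝ g (φ a)) (hg : ‖g‖ ≤ C) (hδ : 0 < δ) (hδ1 : δ < 1)
    (hlow : 0 < σlow) (hlowσ : σlow ≤ σ) (hσhigh : σ ≤ σhigh) (hC : 0 < C) (hκ : 0 < κ)
    (hkκ : ∀ a ∈ arms, κ ≤ k a a ∧ k a a ≤ 1)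
    (h : regret harms f (fun s => (x s : 𝒳)) T ≤ C₁ arms.card δ T * (σhigh / σ) *
        (1 + √(2 * Real.log (4 / δ) +
          2 * infoGain k (fun s => (x s : 𝒳)) (σlow ^ 2 / C ^ 2) T)) * C *
        √(T * (2 * infoGain k (fun s => (x s : 𝒳)) (σ ^ 2 / C ^ 2) T /
          Real.log (1 + C ^ 2 / σ ^ 2))) +
      C₂ δ * maxGap harms f * √(T * Real.log (1 / δ)) +
      4 * Real.pi * Real.exp 1 * maxGap harms f * δ) :
    regret harms f (fun s => (x s : 𝒳)) T ≤ rateConst δ σ σlow σhigh C κ *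
      (C * √(T * Real.log (T * arms.card)) *
        infoGain k (fun s => (x s : 𝒳)) (σ ^ 2 / C ^ 2) T) := by
  have hσ : 0 < σ := hlow.trans_le hlowσ
  have hlamS : 0 < σ ^ 2 / C ^ 2 := by positivity
  have hlamL : 0 < σlow ^ 2 / C ^ 2 := by positivity
  rcases Nat.eq_zero_or_pos T with rfl | hT
  · simp [regret]
  -- With one round and one arm the logarithm in the rate vanishes, but so does the regret.
  rcases lt_or_ge (T * arms.card) 2 with hTn | hTn
  · have hn := harms.card_pos
    have h1 : arms.card = 1 := by nlinarith
    have h2 : T = 1 := by rw [h1] at hTn; omega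
    rw [regret_eq_zero_of_card_eq_one harms h1, h1, h2]
    simp
  obtain ⟨hr, hu⟩ := sampleRadius_le_sqrt hδ hδ1 hTn
  have hγ := le_infoGain (x := fun s => (x s : 𝒳)) hk hlamS hκ.le (fun t => (hkκ _ (x t).2).1) hT
  have hγ₀ : 0 < 1 / 2 * Real.log (1 + κ / (σ ^ 2 / C ^ 2)) := by
    have : 0 < Real.log (1 + κ / (σ ^ 2 / C ^ 2)) :=
      Real.log_pos (lt_add_of_pos_right _ (by positivity))
    positivity
  have hγ' := infoGain_le_mul (x := fun s => (x s : 𝒳)) (t := T) hk hlamL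
    (show σlow ^ 2 / C ^ 2 ≤ σ ^ 2 / C ^ 2 by gcongr)
  have hR := maxGap_le harms hk hf hg fun a ha => (hkκ a ha).2
  have hlog : ∀ c : ℝ, 1 ≤ c → 0 ≤ Real.log (c / δ) := fun c hc =>
    Real.log_nonneg (by rw [one_le_div hδ]; linarith)
  have h2 := hlog 2 (by norm_num)
  have h4 := hlog 4 (by norm_num)
  refine h.trans (le_trans (le_of_eq ?_) (le_rate (T := T) (c₀ := 4 * √(Real.pi * Real.exp 1) + 1)
    (s := σhigh / σ) (q := Real.log (1 + C ^ 2 / σ ^ 2)) (c₂ := C₂ δ)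
    (d := 4 * Real.pi * Real.exp 1 * δ) (b := 2 * Real.log (4 / δ)) (ℓ := Real.log (1 / δ))
    (by exact_mod_cast hT) hu hγ₀ hγ hγ' hR hC.le (by positivity)
    (div_nonneg (hσ.le.trans hσhigh) hσ.le) (by positivity) hr (by positivity)
    (Real.sqrt_nonneg _) (by positivity)))
  rw [C₁, sampleRadius]
  ring

end Rate

/-! ### Confidence thresholds and the final union bound. -/

lemma log_le_of_le_third {δ : ℝ} (hδ : 0 < δ) (hδ1 : δ ≤ 1 / 3) :
    2.4 ≤ Real.log (1 / (δ / 4)) := by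
  rw [Real.le_log_iff_exp_le (by positivity)]
  have h1 : Real.exp 2.4 ≤ 12 := by
    refine le_of_pow_le_pow_left₀ (n := 5) (by norm_num) (by norm_num) ?_
    have e : Real.exp 2.4 ^ 5 = Real.exp 1 ^ 12 := by
      rw [← Real.exp_nat_mul, ← Real.exp_nat_mul]; norm_num
    rw [e]
    calc Real.exp 1 ^ 12 ≤ 2.7182818286 ^ 12 := by
          gcongr
          exact Real.exp_one_lt_d9.le
      _ ≤ _ := by norm_num
  refine h1.trans ?_
  rw [le_div_iff₀ (by positivity)]
  linarith

lemma ofReal_one_sub_le_measure {Ω : Type*} {mΩ : MeasurableSpace Ω} {P : Measure Ω}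
    [IsProbabilityMeasure P] {A : Set Ω} {c : ℝ} (hc : 0 ≤ c) (h : P Aᶜ ≤ ENNReal.ofReal c) :
    ENNReal.ofReal (1 - c) ≤ P A := by
  rw [ENNReal.ofReal_sub _ hc, ENNReal.ofReal_one, tsub_le_iff_right]
  calc 1 = P (A ∪ Aᶜ) := by rw [Set.union_compl_self, measure_univ]
    _ ≤ P A + P Aᶜ := measure_union_le _ _
    _ ≤ _ := by gcongr

end KernelTS

end

theorem theorem5 {δ σ σlow σhigh C κ : ℝ} (hδ : 0 < δ) (hδ1 : δ < 1)
    (hlow : 0 < σlow) (hlowσ : σlow ≤ σ) (hσhigh : σ ≤ σhigh) (hC : 0 < C) (hκ : 0 < κ) :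
    ∃ K : ℝ, ∀ {𝒳 : Type*} [DecidableEq 𝒳]
      {H : Type*} [NormedAddCommGroup H] [InnerProductSpace ℝ H] [CompleteSpace H] [RKHS ℝ H 𝒳 ℝ]
      {Ω : Type*} {mΩ : MeasurableSpace Ω} (P : Measure Ω) [IsProbabilityMeasure P]
      (arms : Finset 𝒳) (harms : arms.Nonempty) (f : H) (_hf : ‖f‖ ≤ C)
      (k : 𝒳 → 𝒳 → ℝ) (_hk : ∀ a b, k a b = RKHS.kernel H a b 1)
      (p : KernelTS.Tuning 𝒳) (_hp : p = ⟨k, ‖f‖, C, σlow, σhigh, δ / 4⟩)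
      (ftilde : ℕ → Ω → EuclideanSpace ℝ arms) (x : ℕ → Ω → arms) (y : ℕ → Ω → ℝ)
      (_hrun : KernelTS.IsRun P p f σ ftilde x y),
      ENNReal.ofReal (1 - 3 * δ) ≤ P {ω | ∀ T : ℕ,
        let xs : ℕ → 𝒳 := fun t => x t ω
        let ys : ℕ → ℝ := fun t => y t ω
        let R : ℝ := KernelTS.maxGap harms f
        let γ : ℝ → ℝ := fun lam => KernelTS.infoGain k xs lam T
        -- the bound with the observed confidence widths
        KernelTS.regret harms f xs T ≤
            KernelTS.C₁ arms.card δ T * (∑ t ∈ Finset.Icc 1 T,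
              Real.sqrt (KernelTS.postKernel k xs (p.reg xs ys t) (t - 1) (xs t) (xs t)
                / p.reg xs ys t) * p.confB xs ys t)
            + KernelTS.C₂ δ * R * Real.sqrt (T * Real.log (1 / δ))
            + 4 * Real.pi * Real.exp 1 * R * δ ∧
        -- the bound through the information gain
        ((∀ a ∈ arms, k a a ≤ 1) →
          KernelTS.regret harms f xs T ≤
            KernelTS.C₁ arms.card δ T * (σhigh / σ) *
              (1 + Real.sqrt (2 * Real.log (4 / δ) + 2 * γ (σlow ^ 2 / C ^ 2))) * C *
              Real.sqrt (T * (2 * γ (σ ^ 2 / C ^ 2) / Real.log (1 + C ^ 2 / σ ^ 2)))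
            + KernelTS.C₂ δ * R * Real.sqrt (T * Real.log (1 / δ))
            + 4 * Real.pi * Real.exp 1 * R * δ) ∧
        -- the rate
        ((∀ a ∈ arms, κ ≤ k a a ∧ k a a ≤ 1) →
          KernelTS.regret harms f xs T ≤
            K * (C * Real.sqrt (T * Real.log (T * arms.card)) * γ (σ ^ 2 / C ^ 2)))} := by
  refine ⟨KernelTS.rateConst δ σ σlow σhigh C κ, ?_⟩
  intro 𝒳 _ H _ _ _ _ Ω _ P _ arms harms g hg k hk' p hp ftilde x y hrun
  -- For `δ ≥ 1/3` there is nothing to prove. Below, `log (4 / δ) ≥ log 12 > 2.4`, which all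
  -- numerical estimates rely on.
  rcases le_or_gt (1 / 3) δ with hδ3 | hδ3
  · rw [ENNReal.ofReal_of_nonpos (by linarith)]
    exact zero_le
  classical
  set φ : 𝒳 → H := fun a => RKHS.kerFun H a (1 : ℝ) with hφ
  have hk : ∀ a b, k a b = inner ℝ (φ a) (φ b) := by
    intro a b
    have h := RKHS.kernel_inner (𝕜 := ℝ) (H := H) a b (1 : ℝ) (1 : ℝ)
    rw [hk', hφ, real_inner_comm, ← h]
    simp
  have hf : ∀ a, g a = inner ℝ g (φ a) := by
    intro a
    rw [hφ, RKHS.inner_kerFun]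
    simp
  have hσ : 0 < σ := hlow.trans_le hlowσ
  have hpk : p.k = k := by rw [hp]
  have hpC : 0 < p.C := by rw [hp]; exact hC
  have hkp : ∀ a b, p.k a b = inner ℝ (φ a) (φ b) := by rw [hpk]; exact hk
  have hL : 2.4 ≤ Real.log (1 / (δ / 4)) := KernelTS.log_le_of_le_third hδ hδ3.le
  let : Nonempty arms := harms.to_subtype
  have hstar : ∃ a : arms, g a = arms.sup' harms g := by
    obtain ⟨a, ha, h⟩ := Finset.exists_mem_eq_sup' harms g
    exact ⟨⟨a, ha⟩, h.symm⟩
  have hN := hrun.measure_not_goodNoise_le hσ hk hC hL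
  have hE := hrun.measure_exists_exceed_le hkp hpC harms hδ hδ1
  -- For zero maximal gap the event is made empty.
  have hS : P {ω | 0 < KernelTS.maxGap harms g ∧ ∃ T, Real.log (1 / δ) ≤
      ∑ t ∈ Finset.Icc 1 T, if 11 ≤ t ∧
          p.Reliable arms g (fun s => (x s ω : 𝒳)) (fun s => y s ω) t then
        (0.0172 * KernelTS.shortfall (KernelTS.maxGap harms g) (arms.sup' harms g) (ftilde t ω) -
          0.2 * KernelTS.playedWidth (KernelTS.maxGap harms g)
          (fun a : arms => (KernelTS.sampleRadius arms.card δ t + 1 / 2) *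
            p.width (fun s => (x s ω : 𝒳)) (fun s => y s ω) t a) (ftilde t ω)) /
          KernelTS.maxGap harms g else 0} ≤ ENNReal.ofReal δ := by
    by_cases hR : 0 < KernelTS.maxGap harms g
    · simp only [hR, true_and]
      exact hrun.measure_exists_shortfall_le hkp hpC hR hstar hδ hδ3.le
    · simp [hR]
  refine KernelTS.ofReal_one_sub_le_measure (by positivity) ?_
  refine (measure_mono (t := _ ∪ _ ∪ _) ?_).trans (((measure_union_le _ _).trans
    (add_le_add ((measure_union_le _ _).trans (add_le_add hN hE)) hS)).trans ?_)
  · intro ω hω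
    by_contra hcon
    simp only [Set.mem_union, Set.mem_ofPred_eq, not_or, not_not] at hcon
    obtain ⟨⟨hgood, hex⟩, hsf⟩ := hcon
    push Not at hex hsf
    refine hω fun T => ?_
    have hsd := hgood.sdBounds hk hlow hlowσ hσhigh hC (by positivity) hL (by linarith) hg
      (y := fun s => y s ω) (fun s _ => by rw [← hf]; ring)
    rw [← hp] at hsd
    have hrel : ∀ t, p.Reliable arms g (fun s => (x s ω : 𝒳)) (fun s => y s ω) t := by
      intro t
      refine ⟨lt_of_lt_of_le (by positivity) (hsd (t - 1)).2.2.1, fun a => ?_⟩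
      have h := hgood.abs_postMean_sub_le hk hlow hlowσ hσhigh hC (by positivity) hL (by linarith)
        hg (y := fun s => y s ω) (fun s _ => by rw [← hf]; ring) t (a : 𝒳) hp
      rw [← hf] at h
      rw [KernelTS.Tuning.width, hpk]
      exact h
    have hmain := KernelTS.regret_le_sum_width (T := T) harms hpC hδ hδ3.le hrel
      (fun t ht a => hex t ht (hrel t) a)
      (fun hR => by
        have h := (hsf hR T).le
        simp only [hrel, and_true] at h
        exact h)
      (fun t ht a => hrun.argmax t ht ω a)
    have hgap := KernelTS.maxGap_nonneg (f := g) harms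
    have hlast : 0 ≤ 4 * Real.pi * Real.exp 1 * KernelTS.maxGap harms g * δ := by positivity
    have hgain : (∀ a ∈ arms, k a a ≤ 1) → KernelTS.regret harms g (fun t => (x t ω : 𝒳)) T ≤
        KernelTS.C₁ arms.card δ T * (σhigh / σ) *
          (1 + √(2 * Real.log (4 / δ) +
            2 * KernelTS.infoGain k (fun t => (x t ω : 𝒳)) (σlow ^ 2 / C ^ 2) T)) * C *
          √(T * (2 * KernelTS.infoGain k (fun t => (x t ω : 𝒳)) (σ ^ 2 / C ^ 2) T /
            Real.log (1 + C ^ 2 / σ ^ 2))) +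
        KernelTS.C₂ δ * KernelTS.maxGap harms g * √(T * Real.log (1 / δ)) +
        4 * Real.pi * Real.exp 1 * KernelTS.maxGap harms g * δ := by
      intro hk1
      have h := KernelTS.sum_width_le (T := T) hk hlow hlowσ hC hp
        (fun t => ⟨(hsd t).1, lt_of_lt_of_le (by positivity) (hsd t).2.2.1, (hsd t).2.2.2⟩)
        hσhigh (fun t => hk1 _ (x t ω).2)
      rw [one_div_div] at h
      have h' := mul_le_mul_of_nonneg_left h
        (KernelTS.C₁_nonneg (n := arms.card) (δ := δ) (T := T))
      simp only [← mul_assoc] at h' hmain ⊢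
      linarith
    refine ⟨?_, hgain, fun hkκ => ?_⟩
    · simp only [KernelTS.Tuning.width, hpk] at hmain
      -- The bound already holds without the term `4 π e R δ`.
      exact hmain.trans (le_add_of_nonneg_right hlast)
    · exact KernelTS.regret_le_rate harms hk hf hg hδ hδ1 hlow hlowσ hσhigh hC hκ hkκ
        (hgain fun a ha => (hkκ a ha).2)
  · have hexp : Real.exp (-Real.log (1 / (δ / 4))) = δ / 4 := by
      rw [one_div, Real.log_inv, neg_neg, Real.exp_log (by positivity)]
    rw [hexp, ← ENNReal.ofReal_add (by positivity) (by positivity),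
      ← ENNReal.ofReal_add (by positivity) (by positivity)]
    -- `5.02 / 4 + 1.7725 / 11 + 1 < 3`, in units of `δ`.
    refine ENNReal.ofReal_le_ofReal ?_
    have := mul_le_mul_of_nonneg_right KernelTS.sqrt_pi_le hδ.le
    linarith
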